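/- **Setting.** Let $\mathfrak t$ be a finite-dimensional real vector space with an integer lattice $\ell\subset\mathfrak t$ (the $\mathbb Z$-span of a basis), let $\mathfrak t^*$ be its dual, and let $\ell^*=\{x\in\mathfrak t^* : \langle \xi,x\rangle\in\mathbb Z\ \forall\,\xi\in\ell\}$ be the dual lattice. Given $\eta_1,\dots,\eta_N\in\mathfrak t$ and $\kappa\in\mathbb R^N$ put $$\Delta=\Delta(\kappa)=\bigcap_{i=1}^N\{x\in\mathfrak t^* : \langle\eta_i,x\rangle\le\kappa_i\},\qquad F_i=F_i(\kappa)=\Delta\cap\{x : \langle\eta_i,x\rangle=\kappa_i\}.$$ $\Delta(\kappa)$ is *simple* if it is bounded, its affine span is $\mathfrak t^*$, each $F_i$ is nonempty with affine span a hyperplane, and exactly $\dim\mathfrak t$ of the facets $F_i$ meet at each vertex. It is *smooth* if moreover each $\eta_i$ is a primitive vector of $\ell$ and, at each vertex, the conormals $\eta_i$ of the facets meeting there form a $\mathbb Z$-basis of $\ell$. The *chamber* $\mathcal C_\Delta$ is the connected component containing $\kappa$ of the set of all $\kappa'\in\mathbb R^N$ such that $\Delta(\kappa')$ is simple, and $c_\Delta(\kappa')$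 denotes the center of mass of $\Delta(\kappa')$ for $\kappa'\in\mathcal C_\Delta$. An element $H\in\mathfrak t$ is *mass linear* on $\Delta$ if there are $\gamma_1,\dots,\gamma_N,C\in\mathbb R$ with $\langle H,c_\Delta(\kappa')\rangle=\sum_i\gamma_i\kappa'_i+C$ for all $\kappa'\in\mathcal C_\Delta$. Let $\Delta$ be smooth. A *symmetry* of $\Delta(\kappa')$ is an affine transformation $a$ of $\mathfrak t^*$ with $a(\Delta(\kappa'))=\Delta(\kappa')$ whose linear part maps $\ell^*$ onto $\ell^*$. A *robust symmetry* is a linear map $\hat a$ of $\mathfrak t^*$ that for every $\kappa'\in\mathcal C_\Delta$ is the linear part of a symmetry $a_{\kappa'}$ of $\Delta(\kappa')$. Facets $F_i,F_j$ are *equivalent* if some robust symmetry $\hat a$ satisfies $a_{\kappa'}(F_i(\kappa'))=F_j(\kappa')$ for all $\kappa'\in\mathcal C_\Delta$. An element $H\in\mathfrak t$ is *inessential* if $H=\sum_i\beta_i\eta_i$ with real $\beta_i$ whose sum over each equivalence class of facets is $0$; otherwise it is *essential*. Smooth polytopes $\Delta\subset\mathfrak t^*$ and $\Delta'\subset\mathfrak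 s^*$, with respect to lattices $\ell\subset\mathfrak t$ and $m\subset\mathfrak s$, are *affine equivalent* if there is an affine isomorphism $\mathfrak t^*\to\mathfrak s^*$ taking $\Delta$ onto $\Delta'$ whose linear part maps $\ell^*$ onto $m^*$. For $a=(a_1,a_2)\in\mathbb Z^2$ let $\mathfrak t=\mathbb R^3$, $\ell=\mathbb Z^3$, let $e_1,e_2,e_3$ be the standard basis of $\mathbb R^3$, and put $$\eta_1=-e_1,\quad \eta_2=-e_2,\quad \eta_3=e_1+e_2,\quad \eta_4=-e_3,\quad \eta_5=e_3+a_1e_1+a_2e_2,$$ $$\mathcal C_a=\Bigl\{\kappa\in\mathbb R^5 : \sum_{i=1}^3\kappa_i>0,\ \ \kappa_4+\kappa_5>-a_1\kappa_1-a_2\kappa_2+\max(0,a_1,a_2)\sum_{i=1}^3\kappa_i\Bigr\},$$ and $Y_a(\kappa)=\bigcap_{i=1}^5\{x\in(\mathbb R^3)^* : \langle\eta_i,x\rangle\le\kappa_i\}$ for $\kappa\in\mathcal C_a$. **Theorem.** (1) Let $\Delta$ be a smooth $3$-dimensional polytope. If there exists an essential mass linear function on $\Delta$, then $\Delta$ is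 affine equivalent to $Y_a(\kappa)$ for some $a\in\mathbb Z^2$ and some $\kappa\in\mathcal C_a$. (2) For every $a\in\mathbb Z^2$ and every $\kappa\in\mathcal C_a$, there exists an essential mass linear function on $Y_a(\kappa)$ if and only if $a_1\ne0$, $a_2\ne0$ and $a_1\ne a_2$. -/

import Mathlib

/-!
Throughout, `t` is a finite-dimensional real vector space and `t* = StrongDual ℝ t` its dual space
(the norm of `t` serves only to give `t*` its usual topology).  A polytope in `t*` is presented by
its outward conormals `η i ∈ t` and its support numbers `κ i ∈ ℝ`.
-/

namespace MassPolytope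

section General

variable {t : Type*} [NormedAddCommGroup t] [NormedSpace ℝ t]
variable {ι : Type*}

/-- The intersection of half-spaces `Δ(κ) = ⋂ i, {x ∈ t* | ⟨η i, x⟩ ≤ κ i}`. -/
def polytope (η : ι → t) (κ : ι → ℝ) : Set (StrongDual ℝ t) :=
  {x | ∀ i, x (η i) ≤ κ i}

/-- The facet `F i = Δ ∩ {x | ⟨η i, x⟩ = κ i}`. -/
def facet (η : ι → t) (κ : ι → ℝ) (i : ι) : Set (StrongDual ℝ t) :=
  polytope η κ ∩ {x | x (η i) = κ i}

/-- `Δ(κ)` is a simple polytope, and `η`, `κ` is a presentation of it by its facets: `Δ(κ)` is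
bounded, its affine span is the whole space, the affine span of every `F i` is a hyperplane (and
so `F i` is nonempty), and exactly `dim t` facets meet at every vertex. -/
structure IsSimple (η : ι → t) (κ : ι → ℝ) : Prop where
  bounded : Bornology.IsBounded (polytope η κ)
  span_eq_top : affineSpan ℝ (polytope η κ) = ⊤
  facet_nonempty : ∀ i, (facet η κ i).Nonempty
  facet_hyperplane : ∀ i,
    Module.finrank ℝ (affineSpan ℝ (facet η κ i)).direction + 1 = Module.finrank ℝ t
  vertex : ∀ v ∈ Set.extremePoints ℝ (polytope η κ),
    {i | v ∈ facet η κ i}.ncard = Module.finrank ℝ t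

/-- A vector of the lattice `L` is primitive if it is not a positive integer multiple of any other
vector of `L`. -/
def IsPrimitive (L : Submodule ℤ t) (ξ : t) : Prop :=
  ξ ∈ L ∧ ∀ ζ ∈ L, ∀ m : ℕ, 0 < m → ξ = m • ζ → ζ = ξ

/-- `Δ(κ)` is a smooth (Delzant) polytope with respect to the lattice `L ⊂ t`, presented by its
primitive outward conormals: it is simple and at each vertex the conormals of the facets that meet
there form a `ℤ`-basis of `L`. -/
structure IsSmooth (L : Submodule ℤ t) (η : ι → t) (κ : ι → ℝ) : Prop where
  simple : IsSimple η κ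
  primitive : ∀ i, IsPrimitive L (η i)
  linearIndependent : ∀ v ∈ Set.extremePoints ℝ (polytope η κ),
    LinearIndependent ℤ (fun i : {i // v ∈ facet η κ i} => η i)
  span_eq : ∀ v ∈ Set.extremePoints ℝ (polytope η κ),
    Submodule.span ℤ (η '' {i | v ∈ facet η κ i}) = L

/-- The chamber of `Δ(κ)`: the connected component containing `κ` of the set of all `κ'` such that
`Δ(κ')` is simple. -/
def chamber (η : ι → t) (κ : ι → ℝ) : Set (ι → ℝ) :=
  connectedComponentIn {κ' | IsSimple η κ'} κ

/-- The center of mass of a subset of `t*`.  It does not depend on the normalization of the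
translation-invariant measure. -/
noncomputable def centerOfMass [FiniteDimensional ℝ t] (Δ : Set (StrongDual ℝ t)) :
    StrongDual ℝ t :=
  MeasureTheory.average ((MeasureTheory.Measure.addHaar).restrict Δ) (fun x => x)

/-- `H ∈ t` is a mass linear function on `Δ(κ)`: on the chamber of `Δ(κ)`, the value of `H` at the
center of mass is a linear function (up to a constant) of the support numbers. -/
def IsMassLinear [FiniteDimensional ℝ t] [Fintype ι] (η : ι → t) (κ : ι → ℝ) (H : t) : Prop :=
  ∃ (γ : ι → ℝ) (C : ℝ), ∀ κ' ∈ chamber η κ,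
    centerOfMass (polytope η κ') H = ∑ i, γ i * κ' i + C

/-- The integer lattice of `t*` dual to the lattice `L` of `t`. -/
def dualLattice (L : Submodule ℤ t) : Set (StrongDual ℝ t) :=
  {x | ∀ ξ ∈ L, ∃ m : ℤ, x ξ = m}

/-- A symmetry of the subset `Δ` of `t*` in the smooth sense: an affine transformation that takes
`Δ` onto itself and whose linear part induces an automorphism of the integer lattice. -/
def IsSymmetry (L : Submodule ℤ t) (Δ : Set (StrongDual ℝ t))
    (a : StrongDual ℝ t ≃ᵃ[ℝ] StrongDual ℝ t) : Prop :=
  a '' Δ = Δ ∧ a.linear '' dualLattice L = dualLattice L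

/-- A robust symmetry of `Δ(κ)`: a linear map which for every `κ'` in the chamber is the linear part
of a symmetry of `Δ(κ')`. -/
def IsRobustSymmetry (L : Submodule ℤ t) (η : ι → t) (κ : ι → ℝ)
    (A : StrongDual ℝ t ≃ₗ[ℝ] StrongDual ℝ t) : Prop :=
  ∀ κ' ∈ chamber η κ, ∃ a : StrongDual ℝ t ≃ᵃ[ℝ] StrongDual ℝ t,
    IsSymmetry L (polytope η κ') a ∧ a.linear = A

/-- The facets `F i` and `F j` of `Δ(κ)` are equivalent: there is a robust symmetry `A` such that
for every `κ'` in the chamber the symmetry of `Δ(κ')` with linear part `A` takes `F i` to `F j`. -/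
def FacetEquiv (L : Submodule ℤ t) (η : ι → t) (κ : ι → ℝ) (i j : ι) : Prop :=
  ∃ A : StrongDual ℝ t ≃ₗ[ℝ] StrongDual ℝ t, IsRobustSymmetry L η κ A ∧
    ∀ κ' ∈ chamber η κ, ∀ a : StrongDual ℝ t ≃ᵃ[ℝ] StrongDual ℝ t,
      IsSymmetry L (polytope η κ') a → a.linear = A → a '' facet η κ' i = facet η κ' j

open Classical in
/-- `H ∈ t` is inessential on `Δ(κ)`: it is a combination `∑ i, β i • η i` such that the `β i` sum
to zero over every equivalence class of facets. -/
def IsInessential [Fintype ι] (L : Submodule ℤ t) (η : ι → t) (κ : ι → ℝ) (H : t) : Prop :=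
  ∃ β : ι → ℝ, H = ∑ i, β i • η i ∧
    ∀ i, ∑ j ∈ Finset.univ.filter (fun j => FacetEquiv L η κ i j), β j = 0

/-- There is an essential mass linear function on `Δ(κ)`. -/
def HasEssentialMassLinear [FiniteDimensional ℝ t] [Fintype ι]
    (L : Submodule ℤ t) (η : ι → t) (κ : ι → ℝ) : Prop :=
  ∃ H : t, IsMassLinear η κ H ∧ ¬ IsInessential L η κ H

end General

/-- Affine equivalence in the smooth sense of `Δ ⊂ t*` and `Δ' ⊂ s*`: there is an affine
isomorphism that takes `Δ` onto `Δ'` and whose linear part takes the integer lattice of `t*` onto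
that of `s*`. -/
def AffineEquivalent {t s : Type*} [NormedAddCommGroup t] [NormedSpace ℝ t]
    [NormedAddCommGroup s] [NormedSpace ℝ s] (L : Submodule ℤ t) (M : Submodule ℤ s)
    (Δ : Set (StrongDual ℝ t)) (Δ' : Set (StrongDual ℝ s)) : Prop :=
  ∃ f : StrongDual ℝ t ≃ᵃ[ℝ] StrongDual ℝ s,
    f '' Δ = Δ' ∧ f.linear '' dualLattice L = dualLattice M

/-- The integer lattice `ℤ³` in `ℝ³`. -/
def latticeZ3 : Submodule ℤ (Fin 3 → ℝ) :=
  Submodule.span ℤ (Set.range fun i : Fin 3 => (Pi.single i 1 : Fin 3 → ℝ))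

/-- The conormals `-e₁`, `-e₂`, `e₁ + e₂`, `-e₃`, `e₃ + a₁ e₁ + a₂ e₂` of the polytopes `Y_a`. -/
def conormalY (a : Fin 2 → ℝ) : Fin 5 → (Fin 3 → ℝ) :=
  ![![-1, 0, 0], ![0, -1, 0], ![1, 1, 0], ![0, 0, -1], ![a 0, a 1, 1]]

/-- The set `C_a` of support numbers of the polytopes `Y_a`. -/
def chamberY (a : Fin 2 → ℝ) : Set (Fin 5 → ℝ) :=
  {κ | 0 < κ 0 + κ 1 + κ 2 ∧
    -(a 0) * κ 0 - a 1 * κ 1 + max 0 (max (a 0) (a 1)) * (κ 0 + κ 1 + κ 2) < κ 3 + κ 4}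

end MassPolytope

namespace MassPolytope

open Set Filter Topology Module MeasureTheory

/-! ### Polytopes given by inequalities: nondegeneracy, vertices, openness of the chamber. -/

section Geometry

variable {t : Type*} [NormedAddCommGroup t] [NormedSpace ℝ t]
variable {ι : Type*}

/-! Let `V` and `M` be the integrals of `1` and of `H` over the polytope, as functions of the
support numbers. Mass linearity says `M = (∑ γ i κ i + C) V` on the chamber, and translating the
polytope gives `H = ∑ γ i • η i`. Finite differences replace derivatives throughout. Moving three
facets a little, the mixed third difference of an integral is the integral over a small
parallelepiped at their common vertex, or zero if there is none (`IsSmooth.exists_isRegularRadius`).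
For `V` it is a constant times the intersection number of the three facets, because conormals at
every vertex form a basis of the same lattice (`exists_box_volume`); for `M` it does not depend on
any fourth facet.

The product rule applied to `M` now gives two relations. The vanishing fourth difference gives `γ i
e j k l + γ j e i k l + γ k e i j l + γ l e i j k = 0`, with `e` the intersection number
(`IsMassLinearWith.four_facets`). For three facets without a common vertex, the vanishing third
difference relates the second differences of `V`, which measure edges; moving one of the three
facets again shows, under suitable conditions, that a self-intersection number is zero
(`IsMassLinearWith.edge_coefficient_eq_zero`).

For part (1) the rest is combinatorics of a simple 3-polytope. If some vertex off a facet `l` with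
`γ l ≠ 0` has exactly one edge leading to `l`, the facet opposite that edge has coefficient `-γ l`
and runs parallel to `l` all around the polytope; the second relation produces a reflection
exchanging the two (`IsBalanced.isPartner`, `IsPartner.facetEquiv`). If every facet with nonzero
coefficient has such a partner, `H` is inessential. Otherwise some facet is a triangle meeting `l`,
and the first relation forces a simplex or a triangular prism. On a simplex all facets are
equivalent. On a prism, either the conormals of the three sides sum to zero, which is the shape of
`Y_a`, or the prism is a product-like polytope on which `H` is again inessential
(`IsBalanced.isInessential_or_isBundle`).

Part (2) is explicit. The chamber of `Y_a(κ)` is `C_a` (`chamber_conormalY`), and the center of mass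
is found by integrating over a triangle (`sub_centerOfMass_conormalY`). Its only non-affine
dependence on `κ` is through one rational function, so mass linearity is one linear equation in `H`
(`isMassLinear_conormalY_iff`). Equivalent facets are equidistant from the center of mass
(`FacetEquiv.sub_centerOfMass`), which rules out equivalences; reflections supply the ones that
exist. Comparing the solutions of the equation with the inessential vectors gives the criterion. -/

theorem mem_facet_iff {η : ι → t} {κ : ι → ℝ} {x : StrongDual ℝ t} (hx : x ∈ polytope η κ) {i : ι} :
    x ∈ facet η κ i ↔ x (η i) = κ i :=
  ⟨fun h => h.2, fun h => ⟨hx, h⟩⟩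

theorem setOf_mem_facet {η : ι → t} {κ : ι → ℝ} {x : StrongDual ℝ t} (hx : x ∈ polytope η κ) :
    {i | x ∈ facet η κ i} = {i | x (η i) = κ i} :=
  Set.ext fun _ => mem_facet_iff hx

theorem isClosed_polytope (η : ι → t) (κ : ι → ℝ) : IsClosed (polytope η κ) := by
  rw [show polytope η κ = ⋂ i, {x | x (η i) ≤ κ i} by ext; simp [polytope]]
  exact isClosed_iInter fun i =>
    isClosed_le (ContinuousLinearMap.apply ℝ ℝ (η i)).continuous continuous_const

/-- Strict inequalities persist after a small displacement. -/
theorem eventually_lt_add_smul [Finite ι] (η : ι → t) (κ : ι → ℝ) (x w : StrongDual ℝ t) :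
    ∀ᶠ ε in 𝓝[>] (0 : ℝ), ∀ i, x (η i) < κ i → (x + ε • w) (η i) < κ i := by
  refine eventually_all.2 fun i => ?_
  by_cases hi : x (η i) < κ i
  · have hc : Continuous fun ε : ℝ => (x + ε • w) (η i) := by
      simp only [add_apply, FunLike.coe_smul, Pi.smul_apply, smul_eq_mul]
      fun_prop
    have h0 : (x + (0 : ℝ) • w) (η i) < κ i := by simpa using hi
    filter_upwards [nhdsWithin_le_nhds (hc.continuousAt.eventually_lt_const h0)] with ε hε _
    exact hε
  · exact Eventually.of_forall fun _ h => absurd h hi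

theorem eventually_add_smul_mem [Finite ι] {η : ι → t} {κ : ι → ℝ} {x w : StrongDual ℝ t}
    (hx : x ∈ polytope η κ) (hw : ∀ i, x (η i) = κ i → w (η i) ≤ 0) :
    ∀ᶠ ε in 𝓝[>] (0 : ℝ), x + ε • w ∈ polytope η κ := by
  filter_upwards [eventually_lt_add_smul η κ x w, self_mem_nhdsWithin] with ε hε hpos i
  rcases (hx i).lt_or_eq with h | h
  · exact (hε i h).le
  · have : ε * w (η i) ≤ 0 := mul_nonpos_of_nonneg_of_nonpos (le_of_lt hpos) (hw i h)
    simp only [add_apply, FunLike.coe_smul, Pi.smul_apply, smul_eq_mul]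
    linarith

/-- A linearly independent family takes arbitrary prescribed values under some functional. -/
theorem exists_dual_of_linearIndependent [FiniteDimensional ℝ t] {α : Type*} {v : α → t}
    (hv : LinearIndependent ℝ v) (g : α → ℝ) : ∃ w : StrongDual ℝ t, ∀ a, w (v a) = g a := by
  obtain ⟨f, hf⟩ := LinearMap.exists_extend ((Basis.span hv).constr ℝ g)
  refine ⟨LinearMap.toContinuousLinearMap f, fun a => ?_⟩
  have h1 : ((Basis.span hv a : Submodule.span ℝ (range v)) : t) = v a := by
    rw [Basis.span_apply]
  have h2 := congrArg (fun φ => φ (Basis.span hv a)) hf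
  simp only [Basis.constr_basis, LinearMap.comp_apply, Submodule.subtype_apply, h1] at h2
  exact h2

theorem eq_zero_of_forall_dual {v : t} (h : ∀ w : StrongDual ℝ t, w v = 0) : v = 0 :=
  SeparatingDual.eq_zero_of_forall_dual_eq_zero (R := ℝ) h

/-- The conormals of the facets through `x` are linearly independent. -/
def ActiveIndependent [Fintype ι] (η : ι → t) (κ : ι → ℝ) (x : StrongDual ℝ t) : Prop :=
  ∀ c : ι → ℝ, (∀ i, x (η i) ≠ κ i → c i = 0) → ∑ i, c i • η i = 0 → c = 0

theorem activeIndependent_iff [Fintype ι] {η : ι → t} {κ : ι → ℝ} {x : StrongDual ℝ t} :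
    ActiveIndependent η κ x ↔ LinearIndependent ℝ fun i : {i // x (η i) = κ i} => η i := by
  classical
  constructor
  · intro h
    rw [Fintype.linearIndependent_iff]
    intro g hg i
    have := h (fun j => if hj : x (η j) = κ j then g ⟨j, hj⟩ else 0)
      (fun j hj => by simp [hj]) ?_
    · have := congrFun this i.1
      simpa [i.2] using this
    · rw [← hg]
      calc _ = ∑ j ∈ Finset.univ.filter fun j => x (η j) = κ j,
            (if hj : x (η j) = κ j then g ⟨j, hj⟩ else 0) • η j := by
            rw [Finset.sum_filter]
            refine Finset.sum_congr rfl fun j _ => ?_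
            by_cases hj : x (η j) = κ j <;> simp [hj]
        _ = _ := by
            rw [Finset.sum_subtype _ (p := fun j => x (η j) = κ j) (by simp)]
            exact Finset.sum_congr rfl fun j _ => by simp [j.2]
  · intro h c hc hsum
    rw [Fintype.linearIndependent_iff] at h
    have := h (fun j => c j) ?_
    · ext i
      by_cases hi : x (η i) = κ i
      · exact this ⟨i, hi⟩
      · exact hc i hi
    · rw [← hsum, ← Finset.sum_subtype (Finset.univ.filter fun j => x (η j) = κ j) (by simp)
        (fun j => c j • η j), Finset.sum_filter]
      refine Finset.sum_congr rfl fun j _ => ?_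
      split_ifs with hj
      · rfl
      · simp [hc j hj]

theorem ActiveIndependent.exists_dual [FiniteDimensional ℝ t] [Fintype ι] {η : ι → t} {κ : ι → ℝ}
    {x : StrongDual ℝ t} (h : ActiveIndependent η κ x) (g : ι → ℝ) :
    ∃ w : StrongDual ℝ t, ∀ i, x (η i) = κ i → w (η i) = g i := by
  obtain ⟨w, hw⟩ := exists_dual_of_linearIndependent (activeIndependent_iff.1 h) fun i => g i
  exact ⟨w, fun i hi => hw ⟨i, hi⟩⟩

/-- A bounded polytope all of whose facets are nonempty, and such that the conormals of the facets
through any of its points are linearly independent. -/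
structure IsNondegenerate [Fintype ι] (η : ι → t) (κ : ι → ℝ) : Prop where
  bounded : Bornology.IsBounded (polytope η κ)
  nonempty : (polytope η κ).Nonempty
  indep : ∀ x ∈ polytope η κ, ActiveIndependent η κ x
  facet_nonempty : ∀ i, (facet η κ i).Nonempty

/-- Near a point of the polytope there is a point that lies on a given set of the facets through it
and on no other ones. -/
theorem IsNondegenerate.exists_active_eq [FiniteDimensional ℝ t] [Fintype ι] {η : ι → t}
    {κ : ι → ℝ} (h : IsNondegenerate η κ) {x : StrongDual ℝ t} (hx : x ∈ polytope η κ) {I : Set ι}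
    (hI : ∀ i ∈ I, x (η i) = κ i) :
    ∃ y : StrongDual ℝ t, (∀ i ∈ I, y (η i) = κ i) ∧ ∀ i ∉ I, y (η i) < κ i := by
  classical
  obtain ⟨w, hw⟩ := (h.indep x hx).exists_dual fun i => if i ∈ I then 0 else -1
  obtain ⟨ε, hε, hpos⟩ := ((eventually_lt_add_smul η κ x w).and self_mem_nhdsWithin).exists
  have hpos : 0 < ε := hpos
  refine ⟨x + ε • w, fun i hi => ?_, fun i hi => ?_⟩
  · have := hw i (hI i hi)
    simp [this, hI i hi, hi]
  · rcases (hx i).lt_or_eq with h1 | h1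
    · exact hε i h1
    · have h2 := hw i h1
      simp only [hi, if_false] at h2
      simp only [add_apply, FunLike.coe_smul, Pi.smul_apply, smul_eq_mul, h2, h1]
      linarith

theorem mem_direction_affineSpan {S : Set (StrongDual ℝ t)} {x w : StrongDual ℝ t} (hx : x ∈ S)
    (hw : ∀ᶠ ε in 𝓝[>] (0 : ℝ), x + ε • w ∈ S) : w ∈ (affineSpan ℝ S).direction := by
  obtain ⟨ε, hε, hpos⟩ := (hw.and self_mem_nhdsWithin).exists
  have hpos : 0 < ε := hpos
  have h1 := AffineSubspace.vsub_mem_direction (subset_affineSpan ℝ S hε) (subset_affineSpan ℝ S hx)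
  have h2 : (x + ε • w) -ᵥ x = ε • w := by simp
  rw [h2] at h1
  simpa [smul_smul, inv_mul_cancel₀ hpos.ne'] using Submodule.smul_mem _ ε⁻¹ h1

theorem finrank_strongDual [FiniteDimensional ℝ t] :
    finrank ℝ (StrongDual ℝ t) = finrank ℝ t := by
  rw [← Subspace.dual_finrank_eq (K := ℝ) (V := t)]
  exact (LinearMap.toContinuousLinearMap (𝕜 := ℝ) (E := t) (F' := ℝ)).finrank_eq.symm

/-- The hyperplane of `t*` that annihilates a vector of `t`. -/
theorem finrank_ker_apply [FiniteDimensional ℝ t] {v : t} (hv : v ≠ 0) :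
    finrank ℝ (LinearMap.ker (ContinuousLinearMap.apply ℝ ℝ v : StrongDual ℝ t →L[ℝ] ℝ).toLinearMap)
      + 1 = finrank ℝ t := by
  have hsurj : Function.Surjective
      (ContinuousLinearMap.apply ℝ ℝ v : StrongDual ℝ t →L[ℝ] ℝ).toLinearMap := by
    obtain ⟨w, hw⟩ := not_forall.1 (mt eq_zero_of_forall_dual hv)
    intro r
    refine ⟨(r / w v) • w, ?_⟩
    simp [div_mul_cancel₀ _ hw]
  have := LinearMap.finrank_range_add_finrank_ker
    (ContinuousLinearMap.apply ℝ ℝ v : StrongDual ℝ t →L[ℝ] ℝ).toLinearMap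
  rw [LinearMap.range_eq_top.2 hsurj, finrank_top, finrank_self, finrank_strongDual] at this
  omega

theorem ActiveIndependent.ne_zero [Fintype ι] {η : ι → t} {κ : ι → ℝ} {x : StrongDual ℝ t}
    (h : ActiveIndependent η κ x) {i : ι} (hi : x (η i) = κ i) : η i ≠ 0 :=
  (activeIndependent_iff.1 h).ne_zero ⟨i, hi⟩

/-- A point of the polytope is extreme if the conormals of the facets through it span `t`. -/
theorem mem_extremePoints_of_active {η : ι → t} {κ : ι → ℝ} {x : StrongDual ℝ t}
    (hx : x ∈ polytope η κ)
    (h : ∀ w : StrongDual ℝ t, (∀ i, x (η i) = κ i → w (η i) = 0) → w = 0) :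
    x ∈ extremePoints ℝ (polytope η κ) := by
  rw [mem_extremePoints_iff_left]
  refine ⟨hx, fun y hy z hz hxyz => ?_⟩
  obtain ⟨a, b, ha, hb, hab, rfl⟩ := hxyz
  have : y - (a • y + b • z) = 0 := by
    refine h _ fun i hi => ?_
    simp only [add_apply, FunLike.coe_smul, Pi.smul_apply, smul_eq_mul,
      sub_apply] at hi ⊢
    have h1 := hy i
    have h2 := hz i
    have hb' : b = 1 - a := by linarith
    subst hb'
    have h3 : a * (κ i - y (η i)) = -((1 - a) * (κ i - z (η i))) := by linarith
    have h4 : 0 ≤ a * (κ i - y (η i)) := mul_nonneg ha.le (by linarith)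
    have h5 : 0 ≤ (1 - a) * (κ i - z (η i)) := mul_nonneg hb.le (by linarith)
    have h6 : a * (κ i - y (η i)) = 0 := by linarith
    have h7 : κ i - y (η i) = 0 := (mul_eq_zero.1 h6).resolve_left ha.ne'
    linarith
  exact sub_eq_zero.1 this

/-- Small steps along `w` and `-w` both stay in the polytope, since only the active inequalities
constrain them; so `x` is the midpoint of a segment, which must be trivial. -/
theorem eq_zero_of_mem_extremePoints [Finite ι] {η : ι → t} {κ : ι → ℝ} {x : StrongDual ℝ t}
    (hx : x ∈ extremePoints ℝ (polytope η κ)) {w : StrongDual ℝ t}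
    (hw : ∀ i, x (η i) = κ i → w (η i) = 0) : w = 0 := by
  have h1 := eventually_add_smul_mem (w := w) hx.1 fun i hi => (hw i hi).le
  have h2 := eventually_add_smul_mem (w := -w) hx.1 fun i hi => by simp [hw i hi]
  obtain ⟨ε, ⟨h1, h2⟩, hpos⟩ := ((h1.and h2).and self_mem_nhdsWithin).exists
  have hpos : 0 < ε := hpos
  have h3 := (mem_extremePoints_iff_left.1 hx).2 _ h1 _ h2
    ⟨1 / 2, 1 / 2, by norm_num, by norm_num, by norm_num, by
      module⟩
  have h4 : ε • w = 0 := by simpa using h3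
  exact (smul_eq_zero.1 h4).resolve_left hpos.ne'

/-- The conormals of the facets through an extreme point span `t`. -/
theorem span_active_eq_top [FiniteDimensional ℝ t] [Finite ι] {η : ι → t} {κ : ι → ℝ}
    {x : StrongDual ℝ t} (hx : x ∈ extremePoints ℝ (polytope η κ)) :
    Submodule.span ℝ (range fun i : {i // x (η i) = κ i} => η i) = ⊤ := by
  by_contra hne
  obtain ⟨f, hf, hle⟩ := Submodule.exists_le_ker_of_lt_top _ (lt_top_iff_ne_top.2 hne)
  apply hf
  have h0 : LinearMap.toContinuousLinearMap f = 0 :=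
    eq_zero_of_mem_extremePoints hx fun i hi =>
      LinearMap.mem_ker.1 (hle (Submodule.subset_span ⟨⟨i, hi⟩, rfl⟩))
  simpa using h0

/-- Every face of a bounded polytope contains an extreme point of the polytope. -/
theorem exists_extremePoint [FiniteDimensional ℝ t] {η : ι → t} {κ : ι → ℝ}
    (hb : Bornology.IsBounded (polytope η κ)) {I : Set ι} {x : StrongDual ℝ t}
    (hx : x ∈ polytope η κ) (hI : ∀ i ∈ I, x (η i) = κ i) :
    ∃ v ∈ extremePoints ℝ (polytope η κ), ∀ i ∈ I, v (η i) = κ i := by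
  set K : Set (StrongDual ℝ t) := polytope η κ ∩ {y | ∀ i ∈ I, y (η i) = κ i} with hK
  have hcl : IsClosed {y : StrongDual ℝ t | ∀ i ∈ I, y (η i) = κ i} := by
    simp only [ofPred_forall]
    exact isClosed_biInter fun i _ =>
      isClosed_eq (ContinuousLinearMap.apply ℝ ℝ (η i)).continuous continuous_const
  have hcomp : IsCompact K :=
    (Metric.isCompact_of_isClosed_isBounded (isClosed_polytope η κ) hb).inter_right hcl
  obtain ⟨v, hv⟩ := hcomp.extremePoints_nonempty ⟨x, hx, hI⟩
  -- On the polytope each `η i` with `i ∈ I` attains its maximum exactly on the facet, so both ends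
  -- of a segment through the face lie in the face.
  have hext : IsExtreme ℝ (polytope η κ) K := by
    refine ⟨inter_subset_left, fun y hy z hz u hu hyz => ⟨hy, fun i hi => ?_⟩⟩
    obtain ⟨a, b, ha, hb, hab, rfl⟩ := hyz
    have h0 := hu.2 i hi
    simp only [add_apply, FunLike.coe_smul, Pi.smul_apply, smul_eq_mul] at h0
    have h1 := mul_le_mul_of_nonneg_left (hz i) hb.le
    have h3 : a * κ i + b * κ i = κ i := by rw [← add_mul, hab, one_mul]
    exact le_antisymm (hy i) (le_of_mul_le_mul_left (by linarith) ha)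
  exact ⟨v, hext.extremePoints_subset_extremePoints hv, hv.1.2⟩

/-- Independence of the active conormals allows leaving any of the active facets while staying on
the others. This yields an interior point, hence full span, and a point on `F i` alone, hence a
hyperplane. At an extreme point the active conormals also span, so there are `dim t` of them. -/
theorem IsNondegenerate.isSimple [FiniteDimensional ℝ t] [Fintype ι] {η : ι → t} {κ : ι → ℝ}
    (h : IsNondegenerate η κ) : IsSimple η κ where
  bounded := h.bounded
  span_eq_top := by
    obtain ⟨x, hx⟩ := h.nonempty
    obtain ⟨y, -, hy⟩ := h.exists_active_eq hx (I := ∅) (by simp)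
    have hyP : y ∈ polytope η κ := fun i => (hy i (by simp)).le
    refine (AffineSubspace.direction_eq_top_iff_of_nonempty
      ((affineSpan_nonempty (k := ℝ)).2 ⟨y, hyP⟩)).1 (eq_top_iff.2 fun w _ => ?_)
    exact mem_direction_affineSpan hyP
      (eventually_add_smul_mem hyP fun i hi => absurd hi (hy i (by simp)).ne)
  facet_nonempty := h.facet_nonempty
  facet_hyperplane i := by
    obtain ⟨x, hx, hxi⟩ := h.facet_nonempty i
    obtain ⟨y, hyi, hy⟩ := h.exists_active_eq hx (I := {i}) (by simpa using hxi)
    have hyi : y (η i) = κ i := hyi i rfl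
    have hyP : y ∈ polytope η κ := fun j => by
      by_cases hj : j = i
      · rw [hj, hyi]
      · exact (hy j hj).le
    rw [← finrank_ker_apply ((h.indep x hx).ne_zero hxi)]
    refine congrArg (fun W : Submodule ℝ (StrongDual ℝ t) => finrank ℝ W + 1) ?_
    apply le_antisymm
    · rw [direction_affineSpan, vectorSpan_def, Submodule.span_le]
      rintro _ ⟨a, ha, b, hb, rfl⟩
      have h1 : a (η i) = κ i := ha.2
      have h2 : b (η i) = κ i := hb.2
      simp [h1, h2]
    · intro w hw
      have hw : w (η i) = 0 := by simpa using hw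
      refine mem_direction_affineSpan (x := y) ⟨hyP, hyi⟩ ?_
      have hw0 : ∀ j, y (η j) = κ j → w (η j) ≤ 0 := fun j hj => by
        by_cases hji : j = i
        · rw [hji, hw]
        · exact absurd hj (hy j hji).ne
      filter_upwards [eventually_add_smul_mem hyP hw0] with ε hε
      refine ⟨hε, ?_⟩
      simp [hw, hyi]
  vertex v hv := by
    classical
    rw [setOf_mem_facet hv.1]
    have hli := activeIndependent_iff.1 (h.indep v hv.1)
    have hsp := span_active_eq_top hv
    rw [finrank_eq_card_basis (Basis.mk hli hsp.ge), ← Nat.card_eq_fintype_card]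
    rfl

/-- Directions along which a nonempty bounded polytope is unbounded do not exist. -/
theorem eq_zero_of_forall_le {η : ι → t} {κ : ι → ℝ}
    (hb : Bornology.IsBounded (polytope η κ)) (hne : (polytope η κ).Nonempty)
    {w : StrongDual ℝ t} (hw : ∀ i, w (η i) ≤ 0) : w = 0 := by
  obtain ⟨x, hx⟩ := hne
  obtain ⟨R, hR⟩ := hb.exists_norm_le
  by_contra hw0
  have hpos : 0 < ‖w‖ := norm_pos_iff.2 hw0
  have hR0 : 0 ≤ R := (norm_nonneg _).trans (hR x hx)
  -- A displacement of length `2 R + 1` from a point of norm at most `R` ends outside the ball of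
  -- radius `R`.
  have hmem : x + ((2 * R + 1) / ‖w‖) • w ∈ polytope η κ := fun i => by
    have : (2 * R + 1) / ‖w‖ * w (η i) ≤ 0 :=
      mul_nonpos_of_nonneg_of_nonpos (by positivity) (hw i)
    have := hx i
    simp only [add_apply, FunLike.coe_smul, Pi.smul_apply, smul_eq_mul]
    linarith
  have h1 := hR _ hmem
  have h2 : ‖((2 * R + 1) / ‖w‖) • w‖ = 2 * R + 1 := by
    rw [norm_smul, Real.norm_of_nonneg (by positivity), div_mul_cancel₀ _ hpos.ne']
  have h3 := norm_sub_norm_le (((2 * R + 1) / ‖w‖) • w) (-x)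
  rw [sub_neg_eq_add, add_comm _ x, norm_neg, h2] at h3
  have := hR x hx
  linarith

/-- All the polytopes with the same conormals as a nonempty bounded one are bounded. -/
theorem isBounded_polytope [FiniteDimensional ℝ t] [Finite ι] {η : ι → t} {κ : ι → ℝ}
    (hb : Bornology.IsBounded (polytope η κ)) (hne : (polytope η κ).Nonempty) (κ' : ι → ℝ) :
    Bornology.IsBounded (polytope η κ') := by
  by_contra hunb
  have hseq : ∀ n : ℕ, ∃ x ∈ polytope η κ', (n : ℝ) < ‖x‖ := by
    intro n
    by_contra! hn
    exact hunb (isBounded_iff_forall_norm_le.2 ⟨n, hn⟩)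
  choose x hx hxn using hseq
  have hpos : ∀ n, 0 < ‖x n‖ := fun n => (Nat.cast_nonneg n).trans_lt (hxn n)
  -- Directions of an unbounded sequence of points accumulate at a unit vector of the recession
  -- cone. That cone does not depend on the support numbers and is zero for `κ`.
  have hsph : ∀ n, ‖x n‖⁻¹ • x n ∈ Metric.sphere (0 : StrongDual ℝ t) 1 := fun n => by
    simp [norm_smul, inv_mul_cancel₀ (hpos n).ne']
  obtain ⟨w, hw, φ, hφ, hlim⟩ := (isCompact_sphere (0 : StrongDual ℝ t) 1).tendsto_subseq hsph
  have hw0 : w = 0 := by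
    refine eq_zero_of_forall_le hb hne fun i => ?_
    have h1 : Tendsto (fun n => (‖x (φ n)‖⁻¹ • x (φ n)) (η i)) atTop (𝓝 (w (η i))) :=
      ((ContinuousLinearMap.apply ℝ ℝ (η i)).continuous.tendsto w).comp hlim
    have h2 : Tendsto (fun n => ‖x (φ n)‖⁻¹ * κ' i) atTop (𝓝 (0 * κ' i)) := by
      refine Tendsto.mul_const _ (tendsto_inv_atTop_zero.comp ?_)
      exact tendsto_atTop_mono (fun n => (hxn (φ n)).le)
        (tendsto_natCast_atTop_atTop.comp hφ.tendsto_atTop)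
    rw [zero_mul] at h2
    refine le_of_tendsto_of_tendsto' h1 h2 fun n => ?_
    simp only [FunLike.coe_smul, Pi.smul_apply, smul_eq_mul]
    exact mul_le_mul_of_nonneg_left (hx _ i) (by positivity)
  simp [hw0] at hw

/-- If a family of facets has no common point, this remains so for all nearby polytopes and
hyperplanes. -/
theorem eventually_face_eq_empty [FiniteDimensional ℝ t] [Finite ι] {η : ι → t} {κ : ι → ℝ}
    (hb : Bornology.IsBounded (polytope η κ)) (hne : (polytope η κ).Nonempty) (I : Set ι)
    (hI : ∀ x ∈ polytope η κ, ∃ i ∈ I, x (η i) ≠ κ i) :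
    ∀ᶠ ρ in 𝓝[>] (0 : ℝ), ∀ x : StrongDual ℝ t,
      (∀ i, x (η i) ≤ κ i + ρ) → (∀ i ∈ I, κ i - ρ ≤ x (η i)) → False := by
  let K : ℝ → Set (StrongDual ℝ t) := fun ρ =>
    polytope η (fun i => κ i + ρ) ∩ {x | ∀ i ∈ I, κ i - ρ ≤ x (η i)}
  have hKmono : ∀ {a b}, a ≤ b → K a ⊆ K b := fun hab x hx =>
    ⟨fun i => (hx.1 i).trans (add_le_add_right hab _),
      fun i hi => le_trans (by linarith) (hx.2 i hi)⟩
  have hcl : ∀ ρ, IsClosed (K ρ) := fun ρ => by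
    refine (isClosed_polytope η _).inter ?_
    simp only [ofPred_forall]
    exact isClosed_biInter fun i _ =>
      isClosed_le continuous_const (ContinuousLinearMap.apply ℝ ℝ (η i)).continuous
  have hcomp : ∀ ρ, IsCompact (K ρ) := fun ρ =>
    (Metric.isCompact_of_isClosed_isBounded (isClosed_polytope η _)
      (isBounded_polytope hb hne _)).of_isClosed_subset (hcl ρ) inter_subset_left
  have hex : ∃ n : ℕ, K (1 / ((n : ℝ) + 1)) = ∅ := by
    -- The compact sets `K (1 / (n + 1))` decrease to the face itself; if all were nonempty, so
    -- would be the face.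
    by_contra! hcon
    have hanti : ∀ n : ℕ, K (1 / (((n + 1 : ℕ) : ℝ) + 1)) ⊆ K (1 / ((n : ℝ) + 1)) := fun n =>
      hKmono (one_div_le_one_div_of_le (by positivity) (by push_cast; linarith))
    obtain ⟨x, hx⟩ := IsCompact.nonempty_iInter_of_sequence_nonempty_isCompact_isClosed
      (fun n : ℕ => K (1 / ((n : ℝ) + 1))) hanti hcon (hcomp _) (fun n => hcl _)
    have hx := mem_iInter.1 hx
    have hlim := tendsto_one_div_add_atTop_nhds_zero_nat (𝕜 := ℝ)
    have hle : ∀ i, x (η i) ≤ κ i := fun i => by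
      have := ge_of_tendsto' (tendsto_const_nhds.add hlim) fun n => (hx n).1 i
      simpa using this
    obtain ⟨i, hi, hne⟩ := hI x hle
    refine hne (le_antisymm (hle i) ?_)
    have := le_of_tendsto' (tendsto_const_nhds.sub hlim) fun n => (hx n).2 i hi
    simpa using this
  obtain ⟨n, hn⟩ := hex
  filter_upwards [Ioo_mem_nhdsGT (show (0 : ℝ) < 1 / ((n : ℝ) + 1) by positivity)] with ρ hρ x h1 h2
  exact Set.eq_empty_iff_forall_notMem.1 hn x (hKmono hρ.2.le ⟨h1, h2⟩)

/-- Nondegeneracy is an open condition on the support numbers. -/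
theorem IsNondegenerate.eventually [FiniteDimensional ℝ t] [Fintype ι] {η : ι → t} {κ : ι → ℝ}
    (h : IsNondegenerate η κ) :
    ∀ᶠ ρ in 𝓝[>] (0 : ℝ), ∀ κ' : ι → ℝ, (∀ i, |κ' i - κ i| ≤ ρ) → IsNondegenerate η κ' := by
  have hface : ∀ᶠ ρ in 𝓝[>] (0 : ℝ), ∀ I : Set ι, (∀ x ∈ polytope η κ, ∃ i ∈ I, x (η i) ≠ κ i) →
      ∀ x : StrongDual ℝ t, (∀ i, x (η i) ≤ κ i + ρ) → (∀ i ∈ I, κ i - ρ ≤ x (η i)) → False :=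
    eventually_all.2 fun I => by
      by_cases hI : ∀ x ∈ polytope η κ, ∃ i ∈ I, x (η i) ≠ κ i
      · filter_upwards [eventually_face_eq_empty h.bounded h.nonempty I hI] with ρ hρ _
        exact hρ
      · exact Eventually.of_forall fun _ h => absurd h hI
  have hfacet : ∀ᶠ ρ in 𝓝[>] (0 : ℝ), ∀ i, ∃ y w : StrongDual ℝ t, y (η i) = κ i ∧ w (η i) = 1 ∧
      ∀ j, j ≠ i → y (η j) + ρ * |w (η j)| < κ j - ρ := by
    refine eventually_all.2 fun i => ?_
    obtain ⟨x, hx, hxi⟩ := h.facet_nonempty i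
    obtain ⟨y, hyi, hy⟩ := h.exists_active_eq hx (I := {i}) (by simpa using hxi)
    obtain ⟨w, hw⟩ := (h.indep x hx).exists_dual fun _ => 1
    have : ∀ᶠ ρ in 𝓝[>] (0 : ℝ), ∀ j, j ≠ i → y (η j) + ρ * |w (η j)| < κ j - ρ := by
      refine eventually_all.2 fun j => ?_
      by_cases hj : j = i
      · exact Eventually.of_forall fun _ h => absurd hj h
      · have h0 : y (η j) + 0 * |w (η j)| < κ j - 0 := by simpa using hy j hj
        have hc : Continuous fun ρ : ℝ => y (η j) + ρ * |w (η j)| := by fun_prop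
        have hc' : Continuous fun ρ : ℝ => κ j - ρ := by fun_prop
        filter_upwards [nhdsWithin_le_nhds
          (hc.continuousAt.eventually_lt hc'.continuousAt h0)] with ρ hρ _
        exact hρ
    filter_upwards [this] with ρ hρ
    exact ⟨y, w, hyi i rfl, hw i hxi, hρ⟩
  obtain ⟨x₀, hx₀⟩ := h.nonempty
  obtain ⟨z, -, hz⟩ := h.exists_active_eq hx₀ (I := ∅) (by simp)
  have hint : ∀ᶠ ρ in 𝓝[>] (0 : ℝ), ∀ i, z (η i) < κ i - ρ := by
    refine eventually_all.2 fun i => ?_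
    have hc : Continuous fun ρ : ℝ => κ i - ρ := by fun_prop
    refine nhdsWithin_le_nhds (hc.continuousAt.eventually_const_lt ?_)
    simpa using hz i (by simp)
  filter_upwards [hface, hfacet, hint] with ρ h1 h2 h3 κ' hκ
  have hκ' : ∀ i, κ' i - κ i ≤ ρ ∧ κ i - κ' i ≤ ρ := fun i => by
    have := abs_le.1 (hκ i)
    constructor <;> linarith
  refine ⟨isBounded_polytope h.bounded h.nonempty κ', ⟨z, fun i => ?_⟩, fun x hx => ?_, fun i => ?_⟩
  · linarith [h3 i, (hκ' i).2]
  · have hex : ∃ y ∈ polytope η κ, ∀ i ∈ {i | x (η i) = κ' i}, y (η i) = κ i := by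
      by_contra! hcon
      refine h1 _ hcon x (fun i => ?_) fun i hi => ?_
      · linarith [hx i, (hκ' i).1]
      · have hi : x (η i) = κ' i := hi
        linarith [(hκ' i).2]
    obtain ⟨y, hy, hyI⟩ := hex
    intro c hc hsum
    exact h.indep y hy c (fun i hi => hc i fun hi' => hi (hyI i hi')) hsum
  · obtain ⟨y, w, hy, hw, hlt⟩ := h2 i
    refine ⟨y + (κ' i - κ i) • w, fun j => ?_, ?_⟩
    · by_cases hj : j = i
      · subst hj
        simp [hy, hw]
      · have h4 := hlt j hj
        have h5 : (κ' i - κ i) * w (η j) ≤ ρ * |w (η j)| :=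
          (le_abs_self _).trans (by rw [abs_mul]; gcongr; exact hκ i)
        simp only [add_apply, FunLike.coe_smul, Pi.smul_apply, smul_eq_mul]
        linarith [(hκ' j).2]
    · simp [hy, hw]

/-- All support numbers near those of a nondegenerate polytope belong to its chamber. -/
theorem IsNondegenerate.eventually_mem_chamber [FiniteDimensional ℝ t] [Fintype ι] {η : ι → t}
    {κ : ι → ℝ} (h : IsNondegenerate η κ) :
    ∀ᶠ ρ in 𝓝[>] (0 : ℝ), ∀ κ' : ι → ℝ, (∀ i, |κ' i - κ i| ≤ ρ) → κ' ∈ chamber η κ := by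
  filter_upwards [h.eventually, self_mem_nhdsWithin] with ρ hρ hpos κ' hκ'
  have hpos : 0 < ρ := hpos
  have hconv : IsPreconnected (Metric.closedBall κ ρ) :=
    (convex_closedBall κ ρ).isPreconnected
  have hmem : ∀ {κ'' : ι → ℝ}, κ'' ∈ Metric.closedBall κ ρ ↔ ∀ i, |κ'' i - κ i| ≤ ρ := by
    intro κ''
    rw [Metric.mem_closedBall, dist_pi_le_iff hpos.le]
    simp [Real.dist_eq]
  exact hconv.subset_connectedComponentIn (Metric.mem_closedBall_self hpos.le)
    (fun κ'' h'' => (hρ κ'' (hmem.1 h'')).isSimple) (hmem.2 hκ')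

theorem IsSmooth.active_card [FiniteDimensional ℝ t] {L : Submodule ℤ t} {η : ι → t} {κ : ι → ℝ}
    (h : IsSmooth L η κ) {v : StrongDual ℝ t} (hv : v ∈ extremePoints ℝ (polytope η κ)) :
    {i | v (η i) = κ i}.ncard = finrank ℝ t := by
  rw [← setOf_mem_facet hv.1]
  exact h.simple.vertex v hv

/-- At an extreme point the active conormals span `t` and their number is `dim t`, so they are
independent. The facets active at any point are among those active at some extreme point of its
face. -/
theorem IsSmooth.isNondegenerate [FiniteDimensional ℝ t] [Fintype ι] {L : Submodule ℤ t}
    {η : ι → t} {κ : ι → ℝ} (h : IsSmooth L η κ) : IsNondegenerate η κ where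
  bounded := h.simple.bounded
  nonempty := by
    have := h.simple.span_eq_top
    rw [← affineSpan_nonempty (k := ℝ), this]
    exact ⟨0, trivial⟩
  indep x hx := by
    classical
    obtain ⟨v, hv, hvx⟩ := exists_extremePoint h.simple.bounded (I := {i | x (η i) = κ i}) hx
      fun _ hi => hi
    have hv' : ActiveIndependent η κ v := by
      rw [activeIndependent_iff]
      refine linearIndependent_of_top_le_span_of_card_eq_finrank (span_active_eq_top hv).ge ?_
      rw [← h.active_card hv, ← Nat.card_eq_fintype_card]
      rfl
    intro c hc hsum
    exact hv' c (fun i hi => hc i fun hi' => hi (hvx i hi')) hsum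
  facet_nonempty := h.simple.facet_nonempty

end Geometry

/-! ### Symmetries, equivalence of facets, inessential vectors. -/

section Symmetry

variable {t : Type*} [NormedAddCommGroup t] [NormedSpace ℝ t]
variable {ι : Type*} {L : Submodule ℤ t} {η : ι → t} {κ : ι → ℝ}

theorem isSimple_of_mem_chamber {κ' : ι → ℝ} (h : κ' ∈ chamber η κ) : IsSimple η κ' :=
  connectedComponentIn_subset _ _ h

theorem IsSimple.nonempty (h : IsSimple η κ) : (polytope η κ).Nonempty := by
  rw [← affineSpan_nonempty (k := ℝ), h.span_eq_top]
  exact ⟨0, trivial⟩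

theorem IsSymmetry.symm {Δ : Set (StrongDual ℝ t)} {a : StrongDual ℝ t ≃ᵃ[ℝ] StrongDual ℝ t}
    (h : IsSymmetry L Δ a) : IsSymmetry L Δ a.symm := by
  constructor
  · nth_rewrite 1 [← h.1]
    rw [← image_comp]
    simp
  · nth_rewrite 1 [← h.2]
    rw [← image_comp]
    simp

theorem IsSymmetry.trans {Δ : Set (StrongDual ℝ t)} {a b : StrongDual ℝ t ≃ᵃ[ℝ] StrongDual ℝ t}
    (ha : IsSymmetry L Δ a) (hb : IsSymmetry L Δ b) : IsSymmetry L Δ (a.trans b) := by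
  constructor
  · rw [AffineEquiv.coe_trans, image_comp, ha.1, hb.1]
  · have : ⇑(a.trans b).linear = ⇑b.linear ∘ ⇑a.linear := rfl
    rw [this, image_comp, ha.2, hb.2]

/-- A symmetry of a bounded polytope is determined by its linear part. -/
theorem IsSymmetry.eq_of_linear_eq {a b : StrongDual ℝ t ≃ᵃ[ℝ] StrongDual ℝ t}
    (hbd : Bornology.IsBounded (polytope η κ)) (hne : (polytope η κ).Nonempty)
    (ha : IsSymmetry L (polytope η κ) a) (hb : IsSymmetry L (polytope η κ) b)
    (hab : a.linear = b.linear) : a = b := by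
  obtain ⟨x₀, hx₀⟩ := hne
  have key : ∀ x, a x = b x + (a x₀ - b x₀) := fun x => by
    have h1 : a x - a x₀ = a.linear (x - x₀) := by
      have := a.toAffineMap.linearMap_vsub x x₀
      simpa using this.symm
    have h2 : b x - b x₀ = b.linear (x - x₀) := by
      have := b.toAffineMap.linearMap_vsub x x₀
      simpa using this.symm
    rw [hab, ← h2] at h1
    have h3 : a x = b x - b x₀ + a x₀ := by rw [← h1]; abel
    rw [h3]; abel
  -- The two symmetries differ by the translation by `c`, so this translation preserves the
  -- polytope; its orbits would be unbounded if `c` were nonzero.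
  set c := a x₀ - b x₀ with hc
  have hstep : ∀ y ∈ polytope η κ, y + c ∈ polytope η κ := fun y hy => by
    rw [← hb.1] at hy
    obtain ⟨x, hx, rfl⟩ := hy
    rw [← key x, ← ha.1]
    exact mem_image_of_mem _ hx
  have hiter : ∀ n : ℕ, x₀ + (n : ℝ) • c ∈ polytope η κ := fun n => by
    induction n with
    | zero => simpa using hx₀
    | succ n ih =>
      have := hstep _ ih
      rwa [add_assoc, show (n : ℝ) • c + c = ((n + 1 : ℕ) : ℝ) • c by push_cast; module] at this
  have hc0 : c = 0 := by
    refine eq_zero_of_forall_le hbd ⟨x₀, hx₀⟩ fun i => ?_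
    by_contra! hpos
    obtain ⟨n, hn⟩ := exists_nat_gt ((κ i - x₀ (η i)) / c (η i))
    have h1 := hiter n i
    rw [div_lt_iff₀ hpos] at hn
    simp only [add_apply, FunLike.coe_smul, Pi.smul_apply, smul_eq_mul] at h1
    linarith
  ext1 x
  rw [key, hc0, add_zero]

/-- The definition quantifies over all symmetries with the given linear part; by
`IsSymmetry.eq_of_linear_eq` there is only one, so it can be taken to be the identity. The same
uniqueness gives transitivity. -/
theorem FacetEquiv.refl (i : ι) : FacetEquiv L η κ i i := by
  have hid : ∀ Δ : Set (StrongDual ℝ t), IsSymmetry L Δ (AffineEquiv.refl ℝ (StrongDual ℝ t)) :=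
    fun Δ => ⟨by simp, by rw [AffineEquiv.linear_refl]; exact image_id _⟩
  refine ⟨LinearEquiv.refl ℝ _, fun κ' _ => ⟨AffineEquiv.refl ℝ _, hid _, rfl⟩,
    fun κ' hκ' a ha hlin => ?_⟩
  have hs := isSimple_of_mem_chamber hκ'
  rw [IsSymmetry.eq_of_linear_eq hs.bounded hs.nonempty ha (hid _) hlin]
  simp

theorem FacetEquiv.symm {i j : ι} (h : FacetEquiv L η κ i j) : FacetEquiv L η κ j i := by
  obtain ⟨A, hA, hij⟩ := h
  refine ⟨A.symm, fun κ' hκ' => ?_, fun κ' hκ' a ha hlin => ?_⟩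
  · obtain ⟨a, ha, rfl⟩ := hA κ' hκ'
    exact ⟨a.symm, ha.symm, rfl⟩
  · have h1 := hij κ' hκ' a.symm ha.symm (by
      have : a.symm.linear = a.linear.symm := rfl
      rw [this, hlin, LinearEquiv.symm_symm])
    rw [← h1, ← image_comp]
    simp

theorem FacetEquiv.trans {i j k : ι} (h : FacetEquiv L η κ i j) (h' : FacetEquiv L η κ j k) :
    FacetEquiv L η κ i k := by
  obtain ⟨A, hA, hij⟩ := h
  obtain ⟨B, hB, hjk⟩ := h'
  refine ⟨A.trans B, fun κ' hκ' => ?_, fun κ' hκ' d hd hlin => ?_⟩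
  · obtain ⟨a, ha, rfl⟩ := hA κ' hκ'
    obtain ⟨b, hb, rfl⟩ := hB κ' hκ'
    exact ⟨a.trans b, ha.trans hb, rfl⟩
  · obtain ⟨a, ha, hla⟩ := hA κ' hκ'
    obtain ⟨b, hb, hlb⟩ := hB κ' hκ'
    have hs := isSimple_of_mem_chamber hκ'
    have hd' : d = a.trans b :=
      IsSymmetry.eq_of_linear_eq hs.bounded hs.nonempty hd (ha.trans hb)
        (by rw [hlin, ← hla, ← hlb]; rfl)
    rw [hd', AffineEquiv.coe_trans, image_comp, hij κ' hκ' a ha hla, hjk κ' hκ' b hb hlb]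

section Inessential

variable [Fintype ι]

theorem IsInessential.zero : IsInessential L η κ 0 := ⟨0, by simp, by simp⟩

theorem IsInessential.add {H H' : t} (h : IsInessential L η κ H) (h' : IsInessential L η κ H') :
    IsInessential L η κ (H + H') := by
  obtain ⟨β, hβ, hs⟩ := h
  obtain ⟨β', hβ', hs'⟩ := h'
  refine ⟨β + β', ?_, fun i => ?_⟩
  · simp only [hβ, hβ', Pi.add_apply, add_smul, Finset.sum_add_distrib]
  · simp only [Pi.add_apply, Finset.sum_add_distrib, hs i, hs' i, add_zero]

theorem IsInessential.smul {H : t} (c : ℝ) (h : IsInessential L η κ H) :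
    IsInessential L η κ (c • H) := by
  obtain ⟨β, hβ, hs⟩ := h
  refine ⟨c • β, ?_, fun i => ?_⟩
  · simp only [hβ, Pi.smul_apply, smul_eq_mul, mul_smul, Finset.smul_sum]
  · simp only [Pi.smul_apply, smul_eq_mul, ← Finset.mul_sum, hs i, mul_zero]

theorem IsInessential.sum {α : Type*} (s : Finset α) {H : α → t}
    (h : ∀ a ∈ s, IsInessential L η κ (H a)) : IsInessential L η κ (∑ a ∈ s, H a) := by
  classical
  induction s using Finset.induction_on with
  | empty => simpa using IsInessential.zero
  | insert a s ha ih =>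
    rw [Finset.sum_insert ha]
    exact (h a (Finset.mem_insert_self _ _)).add
      (ih fun b hb => h b (Finset.mem_insert_of_mem hb))

/-- An equivalence class contains both or neither of `i` and `j`, so the coefficients `1` and `-1`
cancel in every class. -/
theorem FacetEquiv.isInessential_sub {i j : ι} (h : FacetEquiv L η κ i j) :
    IsInessential L η κ (η i - η j) := by
  classical
  refine ⟨Pi.single i 1 - Pi.single j 1, ?_, fun m => ?_⟩
  · simp [sub_smul, Finset.sum_sub_distrib, Pi.single_apply, ite_smul]
  · have hm : FacetEquiv L η κ m i ↔ FacetEquiv L η κ m j :=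
      ⟨fun h' => h'.trans h, fun h' => h'.trans h.symm⟩
    simp [Finset.sum_sub_distrib, Pi.single_apply, hm]

end Inessential

/-- If some integral functional takes the values `1` and `-1` on the conormals of two facets, and
vanishes on all other conormals, then the corresponding reflection shows that these two facets are
equivalent. -/
theorem facetEquiv_of_dual {i j : ι} (hi : η i ∈ L) (hj : η j ∈ L)
    {ξ : StrongDual ℝ t} (hξL : ξ ∈ dualLattice L) (hξi : ξ (η i) = 1) (hξj : ξ (η j) = -1)
    (hξ : ∀ k, k ≠ i → k ≠ j → ξ (η k) = 0) : FacetEquiv L η κ i j := by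
  -- The reflection `x ↦ x + (x (η j) - x (η i)) • ξ` exchanges the values on `η i` and `η j` and
  -- keeps those on all other conormals.
  let f : StrongDual ℝ t →ₗ[ℝ] StrongDual ℝ t :=
    LinearMap.id + (ContinuousLinearMap.apply ℝ ℝ (η j - η i)).toLinearMap.smulRight ξ
  have hf : ∀ x, f x = x + (x (η j) - x (η i)) • ξ := fun x => by simp [f]
  have hinv : Function.Involutive f := fun x => by
    rw [hf, hf]
    simp only [add_apply, FunLike.coe_smul, Pi.smul_apply, smul_eq_mul, hξi, hξj]
    module
  let A := LinearEquiv.ofInvolutive f hinv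
  have hA : ∀ x, A x = x + (x (η j) - x (η i)) • ξ := hf
  have hAL : A '' dualLattice L = dualLattice L := by
    have hsub : ∀ x ∈ dualLattice L, A x ∈ dualLattice L := fun x hx ζ hζ => by
      obtain ⟨p, hp⟩ := hx ζ hζ
      obtain ⟨q, hq⟩ := hx _ hi
      obtain ⟨r, hr⟩ := hx _ hj
      obtain ⟨s, hs⟩ := hξL ζ hζ
      refine ⟨p + (r - q) * s, ?_⟩
      rw [hA]
      simp [hp, hq, hr, hs]
    refine Subset.antisymm (image_subset_iff.2 hsub) fun x hx => ⟨A x, hsub x hx, hinv x⟩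
  -- The translation by `(κ' i - κ' j) • ξ` makes the affine map exchange the distances `κ' i - x (η
  -- i)` and `κ' j - x (η j)`, so it preserves the polytope for every `κ'`.
  let a : (ι → ℝ) → StrongDual ℝ t ≃ᵃ[ℝ] StrongDual ℝ t := fun κ' =>
    A.toAffineEquiv.trans (AffineEquiv.constVAdd ℝ _ ((κ' i - κ' j) • ξ))
  have ha : ∀ κ' x, a κ' x = x + (x (η j) - x (η i) + (κ' i - κ' j)) • ξ := fun κ' x => by
    have : a κ' x = (κ' i - κ' j) • ξ + A x := rfl
    rw [this, hA]
    module
  have ha_inv : ∀ κ' x, a κ' (a κ' x) = x := fun κ' x => by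
    rw [ha, ha]
    simp only [add_apply, FunLike.coe_smul, Pi.smul_apply, smul_eq_mul, hξi, hξj]
    module
  have hai : ∀ κ' x, a κ' x (η i) = x (η j) + (κ' i - κ' j) := fun κ' x => by
    rw [ha]
    simp only [add_apply, FunLike.coe_smul, Pi.smul_apply, smul_eq_mul, hξi]
    ring
  have haj : ∀ κ' x, a κ' x (η j) = x (η i) - (κ' i - κ' j) := fun κ' x => by
    rw [ha]
    simp only [add_apply, FunLike.coe_smul, Pi.smul_apply, smul_eq_mul, hξj]
    ring
  have hak : ∀ κ' x k, k ≠ i → k ≠ j → a κ' x (η k) = x (η k) := fun κ' x k hki hkj => by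
    rw [ha]
    simp [hξ k hki hkj]
  have hmaps : ∀ κ', ∀ x ∈ polytope η κ', a κ' x ∈ polytope η κ' := fun κ' x hx k => by
    by_cases hki : k = i
    · rw [hki, hai]
      linarith [hx j]
    by_cases hkj : k = j
    · rw [hkj, haj]
      linarith [hx i]
    rw [hak κ' x k hki hkj]
    exact hx k
  have hsym : ∀ κ', IsSymmetry L (polytope η κ') (a κ') := fun κ' =>
    ⟨Subset.antisymm (image_subset_iff.2 (hmaps κ')) fun x hx => ⟨_, hmaps κ' x hx, ha_inv κ' x⟩,
      hAL⟩
  refine ⟨A, fun κ' _ => ⟨a κ', hsym κ', rfl⟩, fun κ' hκ' b hb hlin => ?_⟩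
  have hs := isSimple_of_mem_chamber hκ'
  rw [IsSymmetry.eq_of_linear_eq hs.bounded hs.nonempty hb (hsym κ') hlin]
  refine Subset.antisymm (image_subset_iff.2 fun x hx => ⟨hmaps κ' x hx.1, ?_⟩) fun x hx =>
    ⟨a κ' x, ⟨hmaps κ' x hx.1, ?_⟩, ha_inv κ' x⟩
  · have : x (η i) = κ' i := hx.2
    rw [mem_ofPred_eq, haj]
    linarith
  · have : x (η j) = κ' j := hx.2
    rw [mem_ofPred_eq, hai]
    linarith

end Symmetry

/-! ### Vertices and edges of smooth three-dimensional polytopes. -/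

section Vertices

variable {t : Type*} [NormedAddCommGroup t] [NormedSpace ℝ t]
variable {ι : Type*} {L : Submodule ℤ t} {η : ι → t} {κ : ι → ℝ}

/-- The facets with indices `i`, `j` and `k` are distinct and have a common point. -/
def IsVertex (η : ι → t) (κ : ι → ℝ) (i j k : ι) : Prop :=
  (i ≠ j ∧ i ≠ k ∧ j ≠ k) ∧
    ∃ x ∈ polytope η κ, x (η i) = κ i ∧ x (η j) = κ j ∧ x (η k) = κ k

theorem IsVertex.swap₁₂ {i j k : ι} (h : IsVertex η κ i j k) : IsVertex η κ j i k := by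
  obtain ⟨⟨h1, h2, h3⟩, x, hx, hi, hj, hk⟩ := h
  exact ⟨⟨h1.symm, h3, h2⟩, x, hx, hj, hi, hk⟩

theorem IsVertex.swap₂₃ {i j k : ι} (h : IsVertex η κ i j k) : IsVertex η κ i k j := by
  obtain ⟨⟨h1, h2, h3⟩, x, hx, hi, hj, hk⟩ := h
  exact ⟨⟨h2, h1, h3.symm⟩, x, hx, hi, hk, hj⟩

theorem IsSmooth.mem_lattice (h : IsSmooth L η κ) (i : ι) : η i ∈ L := (h.primitive i).1

variable [FiniteDimensional ℝ t] [Fintype ι]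

/-- At a point where three facets of a smooth polytope of dimension three meet there are no further
facets. -/
theorem IsSmooth.active_eq (h : IsSmooth L η κ) (h3 : finrank ℝ t = 3) {i j k : ι}
    (hne : i ≠ j ∧ i ≠ k ∧ j ≠ k) {x : StrongDual ℝ t} (hx : x ∈ polytope η κ)
    (hi : x (η i) = κ i) (hj : x (η j) = κ j) (hk : x (η k) = κ k) :
    {m | x (η m) = κ m} = {i, j, k} ∧ Submodule.span ℤ {η i, η j, η k} = L := by
  obtain ⟨v, hv, hvx⟩ := exists_extremePoint h.simple.bounded (I := {m | x (η m) = κ m}) hx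
    fun _ hm => hm
  have hsub : ({i, j, k} : Set ι) ⊆ {m | x (η m) = κ m} := by
    rintro m (rfl | rfl | rfl) <;> assumption
  have hsub' : {m | x (η m) = κ m} ⊆ {m | v (η m) = κ m} := hvx
  have hcard : ({i, j, k} : Set ι).ncard = 3 := by
    rw [Set.ncard_eq_three]
    exact ⟨i, j, k, hne.1, hne.2.1, hne.2.2, rfl⟩
  have heq : ({i, j, k} : Set ι) = {m | v (η m) = κ m} :=
    Set.eq_of_subset_of_ncard_le (hsub.trans hsub') (by rw [h.active_card hv, h3, hcard])
  refine ⟨Subset.antisymm (heq ▸ hsub') hsub, ?_⟩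
  have := h.span_eq v hv
  rwa [setOf_mem_facet hv.1, ← heq, image_insert_eq, image_pair] at this

theorem IsVertex.linearIndependent (h : IsSmooth L η κ) {i j k : ι} (hv : IsVertex η κ i j k) :
    LinearIndependent ℝ ![η i, η j, η k] := by
  obtain ⟨⟨h1, h2, h3⟩, x, hx, hi, hj, hk⟩ := hv
  have hli := activeIndependent_iff.1 (h.isNondegenerate.indep x hx)
  have hinj : Function.Injective
      ![(⟨i, hi⟩ : {i // x (η i) = κ i}), ⟨j, hj⟩, ⟨k, hk⟩] := by
    intro a b
    fin_cases a <;> fin_cases b <;> simp [h1, h2, h3, h1.symm, h2.symm, h3.symm]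
  convert hli.comp _ hinj using 1
  ext a
  fin_cases a <;> rfl

theorem IsVertex.span_int (h : IsSmooth L η κ) (h3 : finrank ℝ t = 3) {i j k : ι}
    (hv : IsVertex η κ i j k) : Submodule.span ℤ (range ![η i, η j, η k]) = L := by
  obtain ⟨hne, x, hx, hi, hj, hk⟩ := hv
  rw [← (h.active_eq h3 hne hx hi hj hk).2]
  congr 1
  ext y
  simp
  tauto

/-- Every lattice vector is an integral combination of the conormals at a vertex. -/
theorem IsVertex.exists_int (h : IsSmooth L η κ) (h3 : finrank ℝ t = 3) {i j k : ι}
    (hv : IsVertex η κ i j k) {ζ : t} (hζ : ζ ∈ L) :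
    ∃ p q r : ℤ, ζ = (p : ℝ) • η i + (q : ℝ) • η j + (r : ℝ) • η k := by
  rw [← hv.span_int h h3, Submodule.mem_span_range_iff_exists_fun] at hζ
  obtain ⟨c, hc⟩ := hζ
  refine ⟨c 0, c 1, c 2, ?_⟩
  rw [← hc, Fin.sum_univ_three]
  simp [Int.cast_smul_eq_zsmul]

theorem IsVertex.exists_dual (h : IsSmooth L η κ) {i j k : ι} (hv : IsVertex η κ i j k)
    (a b c : ℝ) : ∃ w : StrongDual ℝ t, w (η i) = a ∧ w (η j) = b ∧ w (η k) = c := by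
  obtain ⟨w, hw⟩ := exists_dual_of_linearIndependent (hv.linearIndependent h) ![a, b, c]
  exact ⟨w, hw 0, hw 1, hw 2⟩

theorem IsVertex.ext (h : IsSmooth L η κ) (h3 : finrank ℝ t = 3) {i j k : ι}
    (hv : IsVertex η κ i j k) {w w' : StrongDual ℝ t} (hi : w (η i) = w' (η i))
    (hj : w (η j) = w' (η j)) (hk : w (η k) = w' (η k)) : w = w' := by
  have hsp : ⊤ ≤ Submodule.span ℝ (range ![η i, η j, η k]) :=
    ((hv.linearIndependent h).span_eq_top_of_card_eq_finrank (by simp [h3])).ge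
  have : (w : t →ₗ[ℝ] ℝ) = w' := by
    refine (Basis.mk (hv.linearIndependent h) hsp).ext fun a => ?_
    fin_cases a <;> simpa
  ext x
  exact congrArg (fun f : t →ₗ[ℝ] ℝ => f x) this

theorem IsVertex.eq_zero_of_smul (h : IsSmooth L η κ) {i j k : ι} (hv : IsVertex η κ i j k)
    {a b c : ℝ} (habc : a • η i + b • η j + c • η k = 0) : a = 0 ∧ b = 0 ∧ c = 0 := by
  have := Fintype.linearIndependent_iff.1 (hv.linearIndependent h) ![a, b, c]
    (by simpa [Fin.sum_univ_three] using habc)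
  exact ⟨this 0, this 1, this 2⟩

omit [Fintype ι] in
/-- Every facet contains a vertex. -/
theorem IsSmooth.exists_isVertex (h : IsSmooth L η κ) (h3 : finrank ℝ t = 3) (i : ι) :
    ∃ j k, IsVertex η κ i j k := by
  obtain ⟨x, hx, hxi⟩ := h.simple.facet_nonempty i
  obtain ⟨v, hv, hvi⟩ := exists_extremePoint h.simple.bounded (I := {i}) hx (by simpa using hxi)
  have hcard := h.active_card hv
  rw [h3, Set.ncard_eq_three] at hcard
  obtain ⟨a, b, c, hab, hac, hbc, heq⟩ := hcard
  have hmem : ∀ m, v (η m) = κ m ↔ m = a ∨ m = b ∨ m = c := fun m => by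
    have : m ∈ {m | v (η m) = κ m} ↔ m ∈ ({a, b, c} : Set ι) := by rw [heq]
    simpa using this
  have ha := (hmem a).2 (by simp)
  have hb := (hmem b).2 (by simp)
  have hc := (hmem c).2 (by simp)
  rcases (hmem i).1 (hvi i rfl) with rfl | rfl | rfl
  · exact ⟨b, c, ⟨hab, hac, hbc⟩, v, hv.1, ha, hb, hc⟩
  · exact ⟨a, c, ⟨hab.symm, hbc, hac⟩, v, hv.1, hb, ha, hc⟩
  · exact ⟨a, b, ⟨hac.symm, hbc.symm, hab⟩, v, hv.1, hc, ha, hb⟩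

/-- If the facets `i` and `j` have a common point, they have a common vertex. -/
theorem IsSmooth.exists_isVertex_of_mem (h : IsSmooth L η κ) (h3 : finrank ℝ t = 3) {i j : ι}
    (hij : i ≠ j) {x : StrongDual ℝ t} (hx : x ∈ polytope η κ) (hi : x (η i) = κ i)
    (hj : x (η j) = κ j) : ∃ k, IsVertex η κ i j k := by
  obtain ⟨v, hv, hvI⟩ := exists_extremePoint h.simple.bounded (I := {i, j}) hx
    (by rintro m (rfl | rfl) <;> assumption)
  have hcard : ({i, j} : Set ι).ncard < {m | v (η m) = κ m}.ncard := by
    rw [h.active_card hv, h3, Set.ncard_pair hij]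
    norm_num
  obtain ⟨k, hk, hk'⟩ := Set.exists_mem_notMem_of_ncard_lt_ncard hcard
  simp only [mem_insert_iff, mem_singleton_iff, not_or] at hk'
  exact ⟨k, ⟨hij, Ne.symm hk'.1, Ne.symm hk'.2⟩, v, hv.1, hvI i (by simp), hvI j (by simp), hk⟩

/-- A vertex of the facets `i`, `j`, `k` and a further vertex on the edge of `j` and `k` differ by
a positive multiple of the dual vector to `-η i`. -/
theorem IsVertex.edge_vector (h : IsSmooth L η κ) (h3 : finrank ℝ t = 3) {i j k m : ι}
    (hv : IsVertex η κ i j k) (hm : IsVertex η κ m j k) (hmi : m ≠ i) {v y u : StrongDual ℝ t}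
    (hvi : v (η i) = κ i) (hvj : v (η j) = κ j)
    (hvk : v (η k) = κ k) (hy : y ∈ polytope η κ) (hym : y (η m) = κ m) (hyj : y (η j) = κ j)
    (hyk : y (η k) = κ k) (hui : u (η i) = -1) (huj : u (η j) = 0) (huk : u (η k) = 0) :
    ∃ s : ℝ, 0 < s ∧ y = v + s • u := by
  refine ⟨κ i - y (η i), ?_, ?_⟩
  · have hlt : y (η i) < κ i := lt_of_le_of_ne (hy i) fun heq => by
      have : i ∈ ({m, j, k} : Set ι) := by
        rw [← (h.active_eq h3 hm.1 hy hym hyj hyk).1]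
        exact heq
      rcases this with rfl | rfl | rfl
      · exact hmi rfl
      · exact hv.1.1 rfl
      · exact hv.1.2.1 rfl
    linarith
  · refine hv.ext h h3 ?_ ?_ ?_
    · simp [hvi, hui]
    · simp [hyj, hvj, huj]
    · simp [hyk, hvk, huk]

/-- Every edge of a smooth polytope of dimension three has exactly two ends. -/
theorem IsVertex.exists_edge (h : IsSmooth L η κ) (h3 : finrank ℝ t = 3) {i j k : ι}
    (hv : IsVertex η κ i j k) :
    ∃ m, m ≠ i ∧ IsVertex η κ m j k ∧
      (∃ q r : ℤ, η m = -η i + (q : ℝ) • η j + (r : ℝ) • η k) ∧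
      ∀ n, IsVertex η κ n j k → n = i ∨ n = m := by
  have hv' := hv
  obtain ⟨hne, v, hvP, hvi, hvj, hvk⟩ := hv'
  have hact := (h.active_eq h3 hne hvP hvi hvj hvk).1
  have hact : ∀ n, v (η n) = κ n → n = i ∨ n = j ∨ n = k := fun n hn => by
    have : n ∈ ({i, j, k} : Set ι) := hact ▸ hn
    simpa using this
  -- The direction in which the edge of `j` and `k` leaves the facet `i`.
  obtain ⟨u, hui, huj, huk⟩ := hv.exists_dual h (-1) 0 0
  have hlt : ∀ n, 0 < u (η n) → v (η n) < κ n := fun n hn =>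
    lt_of_le_of_ne (hvP n) fun heq => by
      rcases hact n heq with rfl | rfl | rfl <;> linarith
  classical
  have hpos : (Finset.univ.filter fun n => 0 < u (η n)).Nonempty := by
    by_contra hemp
    rw [Finset.not_nonempty_iff_eq_empty, Finset.filter_eq_empty_iff] at hemp
    have : u = 0 := eq_zero_of_forall_le h.simple.bounded h.simple.nonempty fun n =>
      not_lt.1 (hemp (Finset.mem_univ n))
    rw [this] at hui
    simp at hui
  -- The other end is on the hyperplane that the ray from `v` along `u` reaches first.
  obtain ⟨m, hm, hmin⟩ := Finset.exists_min_image _ (fun n => (κ n - v (η n)) / u (η n)) hpos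
  have hm : 0 < u (η m) := by simpa using hm
  have hmin : ∀ n, 0 < u (η n) → (κ m - v (η m)) / u (η m) ≤ (κ n - v (η n)) / u (η n) :=
    fun n hn => hmin n (by simpa using hn)
  set s := (κ m - v (η m)) / u (η m) with hs
  have hs0 : 0 < s := div_pos (by linarith [hlt m hm]) hm
  have happ : ∀ n, (v + s • u) (η n) = v (η n) + s * u (η n) := fun n => by simp
  have hxP : v + s • u ∈ polytope η κ := fun n => by
    rw [happ]
    rcases le_or_gt (u (η n)) 0 with hn | hn
    · have := mul_nonpos_of_nonneg_of_nonpos hs0.le hn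
      linarith [hvP n]
    · have := hmin n hn
      rw [le_div_iff₀ hn] at this
      linarith
  have hxm : (v + s • u) (η m) = κ m := by
    rw [happ, hs, div_mul_cancel₀ _ hm.ne']
    ring
  have hxj : (v + s • u) (η j) = κ j := by rw [happ, huj, hvj]; ring
  have hxk : (v + s • u) (η k) = κ k := by rw [happ, huk, hvk]; ring
  have hmi : m ≠ i := by rintro rfl; linarith
  have hmj : m ≠ j := by rintro rfl; linarith
  have hmk : m ≠ k := by rintro rfl; linarith
  have hVm : IsVertex η κ m j k := ⟨⟨hmj, hmk, hne.2.2⟩, _, hxP, hxm, hxj, hxk⟩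
  refine ⟨m, hmi, hVm, ?_, fun n hn => ?_⟩
  -- Expanding `η m` in the basis at one end and `η i` in the basis at the other gives `p' * p = 1`
  -- for the leading coefficients; `u (η m) > 0` excludes `p = 1`.
  · obtain ⟨p, q, r, hpqr⟩ := hv.exists_int h h3 (h.mem_lattice m)
    obtain ⟨p', q', r', hpqr'⟩ := hVm.exists_int h h3 (h.mem_lattice i)
    refine ⟨q, r, ?_⟩
    have h1 : u (η m) = -p := by rw [hpqr]; simp [hui, huj, huk]
    have h2 : (-1 : ℝ) = p' * u (η m) := by
      rw [← hui]
      nth_rewrite 1 [hpqr']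
      simp [huj, huk]
    have h4 : p' * p = 1 := by
      have : (p' : ℝ) * p = 1 := by rw [h1] at h2; linarith
      exact_mod_cast this
    have h5 : p < 0 := by
      have : (p : ℝ) < 0 := by linarith
      exact_mod_cast this
    have h6 : p = -1 := by
      rcases Int.eq_one_or_neg_one_of_mul_eq_one (show p * p' = 1 by linarith) with h6 | h6
      · omega
      · exact h6
    rw [hpqr, h6]
    simp
  · by_contra! hcon
    have hn' := hn
    obtain ⟨hnne, y, hy, hyn, hyj, hyk⟩ := hn'
    obtain ⟨s', hs', rfl⟩ := hv.edge_vector h h3 hn hcon.1 hvi hvj hvk hy hyn hyj hyk hui huj huk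
    have happ' : ∀ n, (v + s' • u) (η n) = v (η n) + s' * u (η n) := fun n => by simp
    have hvn : v (η n) < κ n := lt_of_le_of_ne (hvP n) fun heq => by
      rcases hact n heq with rfl | rfl | rfl
      · exact hcon.1 rfl
      · exact hnne.1 rfl
      · exact hnne.2.1 rfl
    rw [happ'] at hyn
    have hun : 0 < u (η n) := by
      by_contra! hle
      have := mul_nonpos_of_nonneg_of_nonpos hs'.le hle
      linarith
    have h1 : s ≤ s' := by
      have := hmin n hun
      rw [le_div_iff₀ hun] at this
      exact le_of_mul_le_mul_right (by linarith) hun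
    have h2 : s' ≤ s := by
      have h3 := hy m
      rw [happ'] at h3
      rw [happ] at hxm
      exact le_of_mul_le_mul_right (by linarith) hm
    have h4 : n ∈ ({m, j, k} : Set ι) := by
      rw [← (h.active_eq h3 hVm.1 hxP hxm hxj hxk).1, mem_ofPred_eq, happ, le_antisymm h1 h2, hyn]
    rcases h4 with rfl | rfl | rfl
    · exact hcon.2 rfl
    · exact hnne.1 rfl
    · exact hnne.2.1 rfl

/-- A linear function that does not increase along the edges at a vertex is maximal there. -/
theorem IsVertex.le_of_forall_edge (h : IsSmooth L η κ) (h3 : finrank ℝ t = 3) {i j k : ι}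
    (hv : IsVertex η κ i j k) {v x : StrongDual ℝ t} (hvi : v (η i) = κ i) (hvj : v (η j) = κ j)
    (hvk : v (η k) = κ k) (hx : x ∈ polytope η κ) (f : t)
    (hi : ∀ u : StrongDual ℝ t, u (η i) = -1 → u (η j) = 0 → u (η k) = 0 → u f ≤ 0)
    (hj : ∀ u : StrongDual ℝ t, u (η i) = 0 → u (η j) = -1 → u (η k) = 0 → u f ≤ 0)
    (hk : ∀ u : StrongDual ℝ t, u (η i) = 0 → u (η j) = 0 → u (η k) = -1 → u f ≤ 0) :
    x f ≤ v f := by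
  obtain ⟨a, ha⟩ := hv.exists_dual h (-1) 0 0
  obtain ⟨b, hb⟩ := hv.exists_dual h 0 (-1) 0
  obtain ⟨c, hc⟩ := hv.exists_dual h 0 0 (-1)
  have hxe : x = v + (κ i - x (η i)) • a + (κ j - x (η j)) • b + (κ k - x (η k)) • c := by
    refine hv.ext h h3 ?_ ?_ ?_
    · simp [ha, hb, hc, hvi]
    · simp [ha, hb, hc, hvj]
    · simp [ha, hb, hc, hvk]
  have h1 := mul_nonpos_of_nonneg_of_nonpos (sub_nonneg.2 (hx i)) (hi a ha.1 ha.2.1 ha.2.2)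
  have h2 := mul_nonpos_of_nonneg_of_nonpos (sub_nonneg.2 (hx j)) (hj b hb.1 hb.2.1 hb.2.2)
  have h4 := mul_nonpos_of_nonneg_of_nonpos (sub_nonneg.2 (hx k)) (hk c hc.1 hc.2.1 hc.2.2)
  have h5 : x f = v f + (κ i - x (η i)) * a f + (κ j - x (η j)) * b f + (κ k - x (η k)) * c f := by
    nth_rewrite 1 [hxe]
    simp
  linarith

/-- The vertices off the facet `l` are connected by edges off this facet. -/
theorem IsSmooth.off_facet_connected (h : IsSmooth L η κ) (h3 : finrank ℝ t = 3) (l : ι)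
    (P : Set ι → Prop)
    (hstep : ∀ i j k m, IsVertex η κ i j k → IsVertex η κ m j k → l ≠ i → l ≠ j → l ≠ k → l ≠ m →
      P {i, j, k} → P {m, j, k})
    {i j k : ι} (hv : IsVertex η κ i j k) (hl : l ≠ i ∧ l ≠ j ∧ l ≠ k) (hP : P {i, j, k})
    {i' j' k' : ι} (hv' : IsVertex η κ i' j' k') (hl' : l ≠ i' ∧ l ≠ j' ∧ l ≠ k') :
    P {i', j', k'} := by
  classical
  let W := {w : ι × ι × ι // IsVertex η κ w.1 w.2.1 w.2.2 ∧ l ≠ w.1 ∧ l ≠ w.2.1 ∧ l ≠ w.2.2}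
  have hpt : ∀ w : W, ∃ x ∈ polytope η κ, x (η w.1.1) = κ w.1.1 ∧ x (η w.1.2.1) = κ w.1.2.1 ∧
      x (η w.1.2.2) = κ w.1.2.2 := fun w => w.2.1.2
  choose pt hptP hpt using hpt
  have hptl : ∀ w, pt w (η l) < κ l := fun w => lt_of_le_of_ne (hptP w l) fun heq => by
    have : l ∈ ({w.1.1, w.1.2.1, w.1.2.2} : Set ι) := by
      rw [← (h.active_eq h3 w.2.1.1 (hptP w) (hpt w).1 (hpt w).2.1 (hpt w).2.2).1]
      exact heq
    rcases this with h' | h' | h'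
    · exact w.2.2.1 h'
    · exact w.2.2.2.1 h'
    · exact w.2.2.2.2 h'
  have : Nonempty W := ⟨⟨(i, j, k), hv, hl⟩⟩
  obtain ⟨w₀, hw₀⟩ := Finite.exists_min fun w : W => pt w (η l)
  -- every set of vertices off `l` that is closed under adjacency contains `w₀`
  have key : ∀ Q : Set ι → Prop,
      (∀ i j k m, IsVertex η κ i j k → IsVertex η κ m j k → l ≠ i → l ≠ j → l ≠ k → l ≠ m →
        Q {i, j, k} → Q {m, j, k}) →
      (∃ w : W, Q {w.1.1, w.1.2.1, w.1.2.2}) → Q {w₀.1.1, w₀.1.2.1, w₀.1.2.2} := by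
    intro Q hQ hex
    -- This is the simplex method. The functional `g` attains its maximum only at `w₀`, a vertex
    -- farthest from the facet `l`, so `f = -η l + ε • g` prefers vertices far from `l` and breaks
    -- ties in favour of `w₀`. For small `ε` vertices on `l` have smaller values than all vertices
    -- off `l`. Hence an `f`-maximal vertex within `Q` has no increasing edge at all, so it is a
    -- global maximum of `f`, and it must be `w₀`.
    set g : t := η w₀.1.1 + η w₀.1.2.1 + η w₀.1.2.2 with hg
    have hgle : ∀ x ∈ polytope η κ, x g ≤ pt w₀ g := fun x hx => by
      simp only [hg, map_add, (hpt w₀).1, (hpt w₀).2.1, (hpt w₀).2.2]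
      linarith [hx w₀.1.1, hx w₀.1.2.1, hx w₀.1.2.2]
    have hev : ∀ᶠ ε in 𝓝[>] (0 : ℝ), ∀ w : W,
        -κ l + ε * pt w₀ g < -pt w (η l) + ε * pt w g := by
      refine eventually_all.2 fun w => nhdsWithin_le_nhds ?_
      have hc1 : Continuous fun ε : ℝ => -κ l + ε * pt w₀ g := by fun_prop
      have hc2 : Continuous fun ε : ℝ => -pt w (η l) + ε * pt w g := by fun_prop
      refine hc1.continuousAt.eventually_lt hc2.continuousAt ?_
      simpa using hptl w
    obtain ⟨ε, hε, hpos⟩ := (hev.and self_mem_nhdsWithin).exists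
    have hpos : 0 < ε := hpos
    set f : t := -η l + ε • g with hf
    have hfx : ∀ x : StrongDual ℝ t, x f = -x (η l) + ε * x g := fun x => by simp [hf]
    have : Nonempty {w : W // Q {w.1.1, w.1.2.1, w.1.2.2}} :=
      let ⟨w, hw⟩ := hex; ⟨⟨w, hw⟩⟩
    obtain ⟨⟨w, hwQ⟩, hw⟩ := Finite.exists_max
      fun w : {w : W // Q {w.1.1, w.1.2.1, w.1.2.2}} => pt w.1 f
    have hw : ∀ w' : W, Q {w'.1.1, w'.1.2.1, w'.1.2.2} → pt w' f ≤ pt w f := fun w' h' =>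
      hw ⟨w', h'⟩
    -- no edge at `w` increases `f`
    have hedge : ∀ a b c, IsVertex η κ a b c → l ≠ a → l ≠ b → l ≠ c → Q {a, b, c} →
        pt w (η a) = κ a → pt w (η b) = κ b → pt w (η c) = κ c →
        ∀ u : StrongDual ℝ t, u (η a) = -1 → u (η b) = 0 → u (η c) = 0 → u f ≤ 0 := by
      intro a b c habc hla hlb hlc hQabc ha hb hc u hua hub huc
      obtain ⟨m, hma, hm, -, -⟩ := habc.exists_edge h h3
      have hm' := hm
      obtain ⟨-, y, hy, hym, hyb, hyc⟩ := hm'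
      obtain ⟨s, hs, hyu⟩ :=
        habc.edge_vector h h3 hm hma ha hb hc hy hym hyb hyc hua hub huc
      have hle : y f ≤ pt w f := by
        by_cases hlm : l = m
        · rw [hfx, hfx, hlm, hym]
          have h1 := hε w
          rw [hlm] at h1
          have h2 := mul_le_mul_of_nonneg_left (hgle y hy) hpos.le
          linarith
        · let w' : W := ⟨(m, b, c), hm, hlm, hlb, hlc⟩
          have h1 : pt w' = y := hm.ext h h3 ((hpt w').1.trans hym.symm)
            ((hpt w').2.1.trans hyb.symm) ((hpt w').2.2.trans hyc.symm)
          rw [← h1]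
          exact hw w' (hQ a b c m habc hm hla hlb hlc hlm hQabc)
      have : y f = pt w f + s * u f := by rw [hyu]; simp
      by_contra! hcon
      have := mul_pos hs hcon
      linarith
    obtain ⟨hwv, hw1, hw2, hw3⟩ := w.2
    obtain ⟨hp1, hp2, hp3⟩ := hpt w
    have hperm1 : ({w.1.1, w.1.2.1, w.1.2.2} : Set ι) = {w.1.2.1, w.1.1, w.1.2.2} :=
      Set.insert_comm _ _ _
    have hperm2 : ({w.1.1, w.1.2.1, w.1.2.2} : Set ι) = {w.1.2.2, w.1.2.1, w.1.1} := by
      ext; simp; tauto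
    have hmax := hwv.le_of_forall_edge h h3 hp1 hp2 hp3 (hptP w₀) f
      (hedge _ _ _ hwv hw1 hw2 hw3 hwQ hp1 hp2 hp3)
      (fun u h1 h2 h3' => hedge _ _ _ hwv.swap₁₂ hw2 hw1 hw3 (hperm1 ▸ hwQ) hp2 hp1 hp3 u h2 h1 h3')
      (fun u h1 h2 h3' => hedge _ _ _ hwv.swap₁₂.swap₂₃.swap₁₂ hw3 hw2 hw1 (hperm2 ▸ hwQ) hp3 hp2
        hp1 u h3' h2 h1)
    have hge : pt w₀ g ≤ pt w g := by
      rw [hfx, hfx] at hmax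
      have h1 := hw₀ w
      exact le_of_mul_le_mul_left (by linarith) hpos
    simp only [hg, map_add, (hpt w₀).1, (hpt w₀).2.1, (hpt w₀).2.2] at hge
    have e1 := hptP w w₀.1.1
    have e2 := hptP w w₀.1.2.1
    have e3 := hptP w w₀.1.2.2
    have hset : ({w.1.1, w.1.2.1, w.1.2.2} : Set ι) = {w₀.1.1, w₀.1.2.1, w₀.1.2.2} := by
      rw [← (h.active_eq h3 hwv.1 (hptP w) hp1 hp2 hp3).1,
        ← (h.active_eq h3 w₀.2.1.1 (hptP w) (by linarith) (by linarith) (by linarith)).1]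
    rw [← hset]
    exact hwQ
  by_contra hcon
  -- Adjacency is symmetric, so the complement of `P` is closed under it as well. If both were
  -- nonempty, both would contain `w₀`.
  refine key (fun S => ¬ P S) (fun a b c m habc hm hla hlb hlc hlm hna hpm => hna ?_)
    ⟨⟨(i', j', k'), hv', hl'⟩, hcon⟩ (key P hstep ⟨⟨(i, j, k), hv, hl⟩, hP⟩)
  exact hstep m b c a hm habc hlm hlb hlc hla hpm

end Vertices

/-! ### Moments of polytopes and their mixed differences. -/

section Moments

variable {t : Type*} [NormedAddCommGroup t] [NormedSpace ℝ t] [FiniteDimensional ℝ t]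
variable {ι : Type*} {L : Submodule ℤ t} {η : ι → t} {κ : ι → ℝ}

/-- The integral of a function over the polytope `Δ(κ)`. -/
noncomputable def moment (η : ι → t) (f : StrongDual ℝ t → ℝ) (κ : ι → ℝ) : ℝ :=
  ∫ x in polytope η κ, f x ∂(Measure.addHaar : Measure (StrongDual ℝ t))

theorem integrableOn_of_isBounded {E : Type*} [NormedAddCommGroup E] {f : StrongDual ℝ t → E}
    (hf : Continuous f) {S : Set (StrongDual ℝ t)} (hS : Bornology.IsBounded S) :
    IntegrableOn f S (Measure.addHaar : Measure (StrongDual ℝ t)) :=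
  (hf.continuousOn.integrableOn_compact hS.isCompact_closure).mono_set subset_closure

theorem centerOfMass_apply {S : Set (StrongDual ℝ t)} (hS : Bornology.IsBounded S) (H : t) :
    centerOfMass S H =
      (∫ _ in S, (1 : ℝ) ∂(Measure.addHaar : Measure (StrongDual ℝ t)))⁻¹ *
        ∫ x in S, x H ∂(Measure.addHaar : Measure (StrongDual ℝ t)) := by
  have h1 := ContinuousLinearMap.integral_comp_comm (ContinuousLinearMap.apply ℝ ℝ H)
    (integrableOn_of_isBounded continuous_id hS)
  simp only [id, ContinuousLinearMap.apply_apply] at h1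
  rw [centerOfMass, average_eq, h1]
  simp

/-- On the chamber, mass linearity says that the first moment is a product of an affine function
and the volume. -/
theorem moment_eq_of_centerOfMass {H : t} {r : ℝ}
    (hb : Bornology.IsBounded (polytope η κ)) (h : centerOfMass (polytope η κ) H = r) :
    moment η (fun x => x H) κ = r * moment η (fun _ => 1) κ := by
  rw [centerOfMass_apply hb] at h
  -- With zero volume the quotient defining the center of mass is a default value, but then the
  -- polytope is a null set and both moments vanish.
  by_cases h0 : moment η (fun _ => (1 : ℝ)) κ = 0
  · rw [h0, mul_zero]
    have hfin : (Measure.addHaar : Measure (StrongDual ℝ t)) (polytope η κ) ≠ ⊤ :=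
      (hb.measure_lt_top).ne
    have : (Measure.addHaar : Measure (StrongDual ℝ t)) (polytope η κ) = 0 := by
      simp only [moment, integral_const, smul_eq_mul, mul_one, Measure.real,
        Measure.restrict_apply_univ] at h0
      exact ((ENNReal.toReal_eq_zero_iff _).1 h0).resolve_right hfin
    rw [moment, Measure.restrict_eq_zero.2 this, integral_zero_measure]
  · rw [← h]
    unfold moment at h0 ⊢
    field_simp

/-- Translations act on the support numbers. -/
theorem moment_translate (f : StrongDual ℝ t → ℝ) (x : StrongDual ℝ t) :
    moment η f (κ + fun i => x (η i)) = moment η (fun y => f (y + x)) κ := by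
  have hpre : (fun y => y + x) ⁻¹' polytope η (κ + fun i => x (η i)) = polytope η κ := by
    ext y
    simp [polytope]
  rw [moment, moment, ← hpre]
  exact ((measurePreserving_add_right (Measure.addHaar : Measure (StrongDual ℝ t)) x)
    |>.setIntegral_preimage_emb (measurableEmbedding_addRight x) f _).symm

/-- The mixed second difference of a function of the support numbers. -/
def diff₂ [DecidableEq ι] (Φ : (ι → ℝ) → ℝ) (κ : ι → ℝ) (i j : ι) (a a' b b' : ℝ) : ℝ :=
  Φ (κ + (Pi.single i a' + Pi.single j b')) - Φ (κ + (Pi.single i a + Pi.single j b')) -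
    (Φ (κ + (Pi.single i a' + Pi.single j b)) - Φ (κ + (Pi.single i a + Pi.single j b)))

/-- The mixed third difference of a function of the support numbers. -/
def diff₃ [DecidableEq ι] (Φ : (ι → ℝ) → ℝ) (κ : ι → ℝ) (i j k : ι) (a a' b b' c c' : ℝ) : ℝ :=
  diff₂ Φ (κ + Pi.single k c') i j a a' b b' - diff₂ Φ (κ + Pi.single k c) i j a a' b b'

/-- Moving one facet changes an integral over the polytope by the integral over a slab. -/
theorem setIntegral_slab [DecidableEq ι] {f : StrongDual ℝ t → ℝ} (hf : Continuous f)
    (hb : ∀ κ' : ι → ℝ, Bornology.IsBounded (polytope η κ')) (κ : ι → ℝ) (i : ι) {a a' : ℝ}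
    (ha : a ≤ a') {Q : Set (StrongDual ℝ t)} (hQ : MeasurableSet Q) :
    (∫ x in polytope η (κ + Pi.single i a') ∩ Q, f x ∂(Measure.addHaar : Measure (StrongDual ℝ t)))
      - ∫ x in polytope η (κ + Pi.single i a) ∩ Q, f x
          ∂(Measure.addHaar : Measure (StrongDual ℝ t))
      = ∫ x in polytope η (κ + Pi.single i a') ∩ ({x | κ i + a < x (η i)} ∩ Q), f x
          ∂(Measure.addHaar : Measure (StrongDual ℝ t)) := by
  have hunion : polytope η (κ + Pi.single i a') ∩ Q = (polytope η (κ + Pi.single i a) ∩ Q) ∪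
      (polytope η (κ + Pi.single i a') ∩ ({x | κ i + a < x (η i)} ∩ Q)) := by
    ext x
    constructor
    · rintro ⟨h1, h2⟩
      by_cases h3 : κ i + a < x (η i)
      · exact Or.inr ⟨h1, h3, h2⟩
      · refine Or.inl ⟨fun n => ?_, h2⟩
        by_cases hn : n = i
        · subst hn
          simpa using not_lt.1 h3
        · simpa [hn] using h1 n
    · rintro (⟨h1, h2⟩ | ⟨h1, h2, h3⟩)
      · refine ⟨fun n => (h1 n).trans ?_, h2⟩
        by_cases hn : n = i
        · subst hn
          simpa using ha
        · simp [hn]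
      · exact ⟨h1, h3⟩
  have hdisj : Disjoint (polytope η (κ + Pi.single i a) ∩ Q)
      (polytope η (κ + Pi.single i a') ∩ ({x | κ i + a < x (η i)} ∩ Q)) := by
    refine Set.disjoint_left.2 fun x h1 h2 => ?_
    have h3 := h1.1 i
    simp only [Pi.add_apply, Pi.single_eq_same] at h3
    exact absurd h2.2.1 (not_lt.2 h3)
  have hmeas : MeasurableSet
      (polytope η (κ + Pi.single i a') ∩ ({x | κ i + a < x (η i)} ∩ Q)) :=
    (isClosed_polytope η _).measurableSet.inter ((isOpen_lt continuous_const
      (ContinuousLinearMap.apply ℝ ℝ (η i)).continuous).measurableSet.inter hQ)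
  rw [hunion, setIntegral_union hdisj hmeas
    (integrableOn_of_isBounded hf ((hb _).subset inter_subset_left))
    (integrableOn_of_isBounded hf ((hb _).subset inter_subset_left))]
  ring

/-- The slab cut out by the first facet is absorbed into the auxiliary set when the second facet is
moved; this is why a set `Q` is carried along. -/
theorem diff₂_moment [DecidableEq ι] {f : StrongDual ℝ t → ℝ} (hf : Continuous f)
    (hb : ∀ κ' : ι → ℝ, Bornology.IsBounded (polytope η κ')) (κ : ι → ℝ) {i j : ι} (hij : i ≠ j)
    {a a' b b' : ℝ} (ha : a ≤ a') (hb' : b ≤ b') {Q : Set (StrongDual ℝ t)}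
    (hQ : MeasurableSet Q) :
    diff₂ (fun κ => ∫ x in polytope η κ ∩ Q, f x ∂(Measure.addHaar : Measure (StrongDual ℝ t)))
      κ i j a a' b b'
      = ∫ x in polytope η (κ + (Pi.single i a' + Pi.single j b')) ∩
          ({x | κ i + a < x (η i)} ∩ ({x | κ j + b < x (η j)} ∩ Q)), f x
          ∂(Measure.addHaar : Measure (StrongDual ℝ t)) := by
  have h1 := setIntegral_slab hf hb (κ + Pi.single j b') i ha hQ
  have h2 := setIntegral_slab hf hb (κ + Pi.single j b) i ha hQ
  have h3 := setIntegral_slab hf hb (κ + Pi.single i a') j hb' (Q := {x | κ i + a < x (η i)} ∩ Q)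
    ((isOpen_lt continuous_const
      (ContinuousLinearMap.apply ℝ ℝ (η i)).continuous).measurableSet.inter hQ)
  have e : ∀ c d : ℝ, κ + Pi.single j c + Pi.single i d = κ + (Pi.single i d + Pi.single j c) :=
    fun c d => by
      rw [add_assoc, add_comm (Pi.single j c : ι → ℝ)]
  simp only [e, add_assoc, Pi.add_apply, Pi.single_eq_of_ne hij, Pi.single_eq_of_ne hij.symm,
    add_zero] at h1 h2 h3
  simp only [diff₂]
  rw [h1, h2, h3]
  congr 2
  ext x
  simp only [mem_inter_iff, mem_ofPred_eq]
  tauto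

theorem diff₃_moment [DecidableEq ι] {f : StrongDual ℝ t → ℝ} (hf : Continuous f)
    (hb : ∀ κ' : ι → ℝ, Bornology.IsBounded (polytope η κ')) (κ : ι → ℝ) {i j k : ι}
    (hne : i ≠ j ∧ i ≠ k ∧ j ≠ k) {a a' b b' c c' : ℝ} (ha : a ≤ a') (hb' : b ≤ b') (hc : c ≤ c') :
    diff₃ (moment η f) κ i j k a a' b b' c c'
      = ∫ x in polytope η (κ + (Pi.single i a' + Pi.single j b' + Pi.single k c')) ∩
          ({x | κ i + a < x (η i)} ∩ ({x | κ j + b < x (η j)} ∩ {x | κ k + c < x (η k)})), f x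
          ∂(Measure.addHaar : Measure (StrongDual ℝ t)) := by
  have h1 := fun c => diff₂_moment hf hb (κ + Pi.single k c) hne.1 ha hb' (Q := univ) .univ
  have hm : ∀ (n : ι) (r : ℝ), MeasurableSet {x : StrongDual ℝ t | r < x (η n)} := fun n r =>
    (isOpen_lt continuous_const (ContinuousLinearMap.apply ℝ ℝ (η n)).continuous).measurableSet
  have h2 := setIntegral_slab hf hb (κ + (Pi.single i a' + Pi.single j b')) k hc
    (Q := {x | κ i + a < x (η i)} ∩ {x | κ j + b < x (η j)}) ((hm _ _).inter (hm _ _))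
  have e : ∀ c : ℝ, κ + Pi.single k c + (Pi.single i a' + Pi.single j b') =
      κ + (Pi.single i a' + Pi.single j b') + Pi.single k c := fun c => by
    rw [add_right_comm]
  simp only [inter_univ, Pi.add_apply, Pi.single_eq_of_ne hne.2.1, Pi.single_eq_of_ne hne.2.2,
    add_zero, e] at h1
  simp only [Pi.add_apply, Pi.single_eq_of_ne hne.2.1.symm, Pi.single_eq_of_ne hne.2.2.symm,
    add_zero] at h2
  have hmom : moment η f = fun κ => ∫ x in polytope η κ, f x
      ∂(Measure.addHaar : Measure (StrongDual ℝ t)) := rfl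
  rw [diff₃, hmom, h1, h1, h2, add_assoc]
  congr 2
  ext x
  simp only [mem_inter_iff, mem_ofPred_eq]
  tauto

/-- The volume of a parallelepiped whose facets have conormals that form a `ℤ`-basis of the
lattice. -/
theorem exists_box_volume (L : Submodule ℤ t) (d : ℕ) (hd : finrank ℝ t = d) :
    ∃ c : ℝ, 0 < c ∧ ∀ v : Fin d → t, LinearIndependent ℝ v → Submodule.span ℤ (range v) = L →
      ∀ lo hi : Fin d → ℝ, (∀ n, lo n ≤ hi n) →
        (Measure.addHaar : Measure (StrongDual ℝ t)).real
          {x | ∀ n, lo n < x (v n) ∧ x (v n) ≤ hi n} = c * ∏ n, (hi n - lo n) := by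
  set μ : Measure (StrongDual ℝ t) := Measure.addHaar with hμ
  have hφ : ∀ v : Fin d → t, LinearIndependent ℝ v →
      ∃ φ : StrongDual ℝ t ≃L[ℝ] (Fin d → ℝ), ∀ x n, φ x n = x (v n) := by
    intro v hv
    let f : StrongDual ℝ t →ₗ[ℝ] (Fin d → ℝ) :=
      LinearMap.pi fun n => (ContinuousLinearMap.apply ℝ ℝ (v n)).toLinearMap
    have hsurj : Function.Surjective f := fun g => by
      obtain ⟨w, hw⟩ := exists_dual_of_linearIndependent hv g
      exact ⟨w, funext hw⟩
    have hfr : finrank ℝ (StrongDual ℝ t) = finrank ℝ (Fin d → ℝ) := by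
      rw [finrank_strongDual, hd, finrank_fin_fun]
    have hinj := (LinearMap.injective_iff_surjective_of_finrank_eq_finrank hfr).2 hsurj
    exact ⟨(LinearEquiv.ofBijective f ⟨hinj, hsurj⟩).toContinuousLinearEquiv, fun x n => rfl⟩
  -- Without such a basis of `L` the claim is vacuous and any positive constant serves.
  by_cases hex : ∃ v : Fin d → t, LinearIndependent ℝ v ∧ Submodule.span ℤ (range v) = L
  swap
  · exact ⟨1, one_pos, fun v hv hs => absurd ⟨v, hv, hs⟩ hex⟩
  obtain ⟨v, hv, hvL⟩ := hex
  obtain ⟨φ, hφv⟩ := hφ v hv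
  have : (μ.map φ).IsAddHaarMeasure := φ.isAddHaarMeasure_map μ
  obtain ⟨c, hc0, hctop, hc⟩ : ∃ c : ENNReal, c ≠ 0 ∧ c ≠ ⊤ ∧ μ.map φ = c • volume :=
    ⟨_, by simpa using (Measure.addHaarScalarFactor_pos_of_isAddHaarMeasure (μ.map φ) volume).ne',
      ENNReal.coe_ne_top, Measure.isAddLeftInvariant_eq_smul (μ.map φ) volume⟩
  refine ⟨c.toReal, ENNReal.toReal_pos hc0 hctop, fun w hw hwL lo hi hle => ?_⟩
  obtain ⟨ψ, hψw⟩ := hφ w hw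
  have hint : ∀ v w : Fin d → t, Submodule.span ℤ (range v) = L → Submodule.span ℤ (range w) = L →
      ∃ A : Matrix (Fin d) (Fin d) ℤ, ∀ m, w m = ∑ n, (A m n : ℝ) • v n := by
    intro v w hvL hwL
    have : ∀ m, ∃ a : Fin d → ℤ, ∑ n, a n • v n = w m := fun m => by
      rw [← Submodule.mem_span_range_iff_exists_fun, hvL, ← hwL]
      exact Submodule.subset_span (mem_range_self m)
    choose A hA using this
    exact ⟨A, fun m => by simp only [← hA, Int.cast_smul_eq_zsmul]⟩
  -- Two bases of one lattice are related by mutually inverse integer matrices, of determinant `1`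
  -- or `-1`; hence the constant found for `v` is right for `w` too.
  obtain ⟨A, hA⟩ := hint v w hvL hwL
  obtain ⟨B, hB⟩ := hint w v hwL hvL
  have hmul : ∀ {v w : Fin d → t} {φ ψ : StrongDual ℝ t ≃L[ℝ] (Fin d → ℝ)}
      {A : Matrix (Fin d) (Fin d) ℤ}, (∀ x n, φ x n = x (v n)) → (∀ x n, ψ x n = x (w n)) →
      (∀ m, w m = ∑ n, (A m n : ℝ) • v n) → ∀ y,
      Matrix.toLin' (A.map (Int.cast : ℤ → ℝ)) y = ψ (φ.symm y) := by
    intro v w φ ψ A hφ hψ hA y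
    ext m
    rw [hψ, hA, map_sum, Matrix.toLin'_apply, Matrix.mulVec, dotProduct]
    refine Finset.sum_congr rfl fun n _ => ?_
    rw [map_smul, ← hφ, φ.apply_symm_apply]
    simp
  have hAlin := hmul hφv hψw hA
  have hBlin := hmul hψw hφv hB
  have hcomp : Matrix.toLin' (A.map (Int.cast : ℤ → ℝ)) ∘ₗ
      Matrix.toLin' (B.map (Int.cast : ℤ → ℝ)) = LinearMap.id := by
    ext1 y
    ext1
    rw [LinearMap.comp_apply, LinearMap.comp_apply, hBlin, hAlin]
    simp
  have hdet : A.det * B.det = 1 := by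
    have h1 := congrArg LinearMap.det hcomp
    rw [LinearMap.det_comp, LinearMap.det_toLin', LinearMap.det_toLin', LinearMap.det_id] at h1
    have h2 : ∀ M : Matrix (Fin d) (Fin d) ℤ, (M.map (Int.cast : ℤ → ℝ)).det = (M.det : ℝ) :=
      fun M => ((Int.castRingHom ℝ).map_det M).symm
    rw [h2, h2] at h1
    exact_mod_cast h1
  have habs : |LinearMap.det (Matrix.toLin' (A.map (Int.cast : ℤ → ℝ)))| = 1 := by
    rw [LinearMap.det_toLin', show (A.map (Int.cast : ℤ → ℝ)).det = (A.det : ℝ) from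
      ((Int.castRingHom ℝ).map_det A).symm]
    rcases Int.eq_one_or_neg_one_of_mul_eq_one hdet with h | h <;> simp [h]
  have hdet0 : LinearMap.det (Matrix.toLin' (A.map (Int.cast : ℤ → ℝ))) ≠ 0 := by
    intro h0
    simp [h0] at habs
  have hmapψ : μ.map ψ = c • (volume : Measure (Fin d → ℝ)) := by
    have h1 : (ψ : StrongDual ℝ t → (Fin d → ℝ)) =
        Matrix.toLin' (A.map (Int.cast : ℤ → ℝ)) ∘ φ := by
      ext1 x
      simp [hAlin]
    rw [h1, ← Measure.map_map (LinearMap.continuous_of_finiteDimensional _).measurable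
      φ.continuous.measurable, hc, Measure.map_smul,
      Real.map_linearMap_volume_pi_eq_smul_volume_pi hdet0, abs_inv, habs]
    simp
  have hset : {x : StrongDual ℝ t | ∀ n, lo n < x (w n) ∧ x (w n) ≤ hi n} =
      ψ ⁻¹' (Set.univ.pi fun n => Ioc (lo n) (hi n)) := by
    ext x
    simp [hψw]
  rw [hset, Measure.real, ← Measure.map_apply ψ.continuous.measurable
    (MeasurableSet.univ_pi fun n => measurableSet_Ioc), hmapψ, Measure.smul_apply, smul_eq_mul,
    ENNReal.toReal_mul, Real.volume_pi_Ioc_toReal hle]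

omit [FiniteDimensional ℝ t] in
theorem continuous_apply_const (H : t) : Continuous fun x : StrongDual ℝ t => x H :=
  (ContinuousLinearMap.apply ℝ ℝ H).continuous

theorem IsNondegenerate.moment_one_pos [Fintype ι] (h : IsNondegenerate η κ) :
    0 < moment η (fun _ => (1 : ℝ)) κ := by
  obtain ⟨x, hx⟩ := h.nonempty
  obtain ⟨y, -, hy⟩ := h.exists_active_eq hx (I := ∅) (by simp)
  have hopen : IsOpen {x : StrongDual ℝ t | ∀ i, x (η i) < κ i} := by
    simp only [ofPred_forall]
    exact isOpen_iInter_of_finite fun i => isOpen_lt (continuous_apply_const (η i)) continuous_const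
  have h1 : 0 < (Measure.addHaar : Measure (StrongDual ℝ t)) (polytope η κ) :=
    (hopen.measure_pos _ ⟨y, fun i => hy i (by simp)⟩).trans_le
      (measure_mono fun x hx i => (hx i).le)
  simp only [moment, integral_const, smul_eq_mul, mul_one, Measure.real,
    Measure.restrict_apply_univ]
  exact ENNReal.toReal_pos h1.ne' h.bounded.measure_lt_top.ne

end Moments

/-! ### Mixed differences of moments near a given polytope. -/

section Local

variable {t : Type*} [NormedAddCommGroup t] [NormedSpace ℝ t] [FiniteDimensional ℝ t]
variable {ι : Type*} {L : Submodule ℤ t} {η : ι → t} {κ : ι → ℝ}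

/-- The support numbers `κ'` differ from `κ` by at most `ρ`. -/
def Near (κ : ι → ℝ) (ρ : ℝ) (κ' : ι → ℝ) : Prop := ∀ i, |κ' i - κ i| ≤ ρ

/-- The radius `ρ` is so small that the combinatorial type of the polytope does not change within
this distance, and mixed differences of the volume and other moments have their generic values; `c`
is the volume of the unit cell of the lattice. -/
structure IsRegularRadius [DecidableEq ι] (η : ι → t) (κ : ι → ℝ) (ρ c : ℝ) : Prop where
  pos : 0 < ρ
  cell_pos : 0 < c
  mem_chamber : ∀ κ', Near κ ρ κ' → κ' ∈ chamber η κ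
  diff₂_eq_zero : ∀ f : StrongDual ℝ t → ℝ, Continuous f → ∀ κ' i j a a' b b', i ≠ j →
    (∀ k, ¬ IsVertex η κ i j k) → a ≤ a' → b ≤ b' →
    Near κ ρ (κ' + (Pi.single i a + Pi.single j b)) →
    Near κ ρ (κ' + (Pi.single i a' + Pi.single j b')) →
    diff₂ (moment η f) κ' i j a a' b b' = 0
  diff₃_eq_zero : ∀ f : StrongDual ℝ t → ℝ, Continuous f → ∀ κ' i j k a a' b b' c c',
    (i ≠ j ∧ i ≠ k ∧ j ≠ k) → ¬ IsVertex η κ i j k → a ≤ a' → b ≤ b' → c ≤ c' →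
    Near κ ρ (κ' + (Pi.single i a + Pi.single j b + Pi.single k c)) →
    Near κ ρ (κ' + (Pi.single i a' + Pi.single j b' + Pi.single k c')) →
    diff₃ (moment η f) κ' i j k a a' b b' c c' = 0
  diff₃_congr : ∀ f : StrongDual ℝ t → ℝ, Continuous f → ∀ κ' κ'' i j k a a' b b' c c',
    IsVertex η κ i j k → a ≤ a' → b ≤ b' → c ≤ c' →
    κ' i = κ'' i → κ' j = κ'' j → κ' k = κ'' k →
    Near κ ρ (κ' + (Pi.single i a + Pi.single j b + Pi.single k c)) →
    Near κ ρ (κ' + (Pi.single i a' + Pi.single j b' + Pi.single k c')) →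
    Near κ ρ (κ'' + (Pi.single i a + Pi.single j b + Pi.single k c)) →
    Near κ ρ (κ'' + (Pi.single i a' + Pi.single j b' + Pi.single k c')) →
    diff₃ (moment η f) κ' i j k a a' b b' c c' = diff₃ (moment η f) κ'' i j k a a' b b' c c'
  diff₃_volume : ∀ κ' i j k a a' b b' c' c'', IsVertex η κ i j k → a ≤ a' → b ≤ b' → c' ≤ c'' →
    Near κ ρ (κ' + (Pi.single i a + Pi.single j b + Pi.single k c')) →
    Near κ ρ (κ' + (Pi.single i a' + Pi.single j b' + Pi.single k c'')) →
    diff₃ (moment η fun _ => 1) κ' i j k a a' b b' c' c'' = c * ((a' - a) * (b' - b) * (c'' - c'))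

/-- For small `ρ`, facets without a common point do not acquire one (`hface`), and near the
hyperplanes of the three facets at a vertex all other inequalities are strict (`hvert`). So an
intersection of slabs is either empty or a full parallelepiped, in whose description no other
support number occurs. -/
theorem IsSmooth.exists_isRegularRadius [Fintype ι] [DecidableEq ι] (h : IsSmooth L η κ)
    (h3 : finrank ℝ t = 3) : ∃ ρ c, IsRegularRadius η κ ρ c := by
  have hnd := h.isNondegenerate
  obtain ⟨c, hc, hvol⟩ := exists_box_volume L 3 h3
  have hface : ∀ᶠ ρ in 𝓝[>] (0 : ℝ), ∀ I : Set ι, (∀ x ∈ polytope η κ, ∃ i ∈ I, x (η i) ≠ κ i) →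
      ∀ x : StrongDual ℝ t, (∀ i, x (η i) ≤ κ i + ρ) → (∀ i ∈ I, κ i - ρ ≤ x (η i)) → False :=
    eventually_all.2 fun I => by
      by_cases hI : ∀ x ∈ polytope η κ, ∃ i ∈ I, x (η i) ≠ κ i
      · filter_upwards [eventually_face_eq_empty hnd.bounded hnd.nonempty I hI] with ρ hρ _
        exact hρ
      · exact Eventually.of_forall fun _ h => absurd h hI
  have hvert : ∀ᶠ ρ in 𝓝[>] (0 : ℝ), ∀ w : ι × ι × ι, IsVertex η κ w.1 w.2.1 w.2.2 →
      ∀ x : StrongDual ℝ t, |x (η w.1) - κ w.1| ≤ ρ → |x (η w.2.1) - κ w.2.1| ≤ ρ →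
        |x (η w.2.2) - κ w.2.2| ≤ ρ →
        ∀ n, n ≠ w.1 → n ≠ w.2.1 → n ≠ w.2.2 → x (η n) < κ n - ρ := by
    refine eventually_all.2 fun ⟨i, j, k⟩ => ?_
    by_cases hv : IsVertex η κ i j k
    swap
    · exact Eventually.of_forall fun _ h => absurd h hv
    have hv' := hv
    obtain ⟨hne, v, hvP, hvi, hvj, hvk⟩ := hv'
    have hlt : ∀ n, n ≠ i → n ≠ j → n ≠ k → v (η n) < κ n := fun n h1 h2 h4 =>
      lt_of_le_of_ne (hvP n) fun heq => by
        have : n ∈ ({i, j, k} : Set ι) := by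
          rw [← (h.active_eq h3 hne hvP hvi hvj hvk).1]
          exact heq
        rcases this with rfl | rfl | rfl <;> contradiction
    -- `K` is the sum of the absolute values of the coefficients of `η n` in the basis at the
    -- vertex; it bounds how far `η n` can change over the parallelepiped.
    have hcoef : ∀ n, ∃ K : ℝ, ∀ (ρ : ℝ) (w : StrongDual ℝ t), |w (η i)| ≤ ρ → |w (η j)| ≤ ρ →
        |w (η k)| ≤ ρ → w (η n) ≤ K * ρ := by
      intro n
      obtain ⟨p, q, r, hn⟩ := hv.exists_int h h3 (h.mem_lattice n)
      refine ⟨|(p : ℝ)| + |(q : ℝ)| + |(r : ℝ)|, fun ρ w h1 h2 h4 => ?_⟩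
      rw [hn]
      simp only [map_add, map_smul, smul_eq_mul]
      have e : ∀ a b : ℝ, |b| ≤ ρ → a * b ≤ |a| * ρ := fun a b hb =>
        (le_abs_self _).trans (by rw [abs_mul]; gcongr)
      have := e p _ h1
      have := e q _ h2
      have := e r _ h4
      linarith
    choose K hK using hcoef
    have : ∀ᶠ ρ in 𝓝[>] (0 : ℝ), ∀ n, n ≠ i → n ≠ j → n ≠ k → v (η n) + K n * ρ < κ n - ρ := by
      refine eventually_all.2 fun n => ?_
      by_cases hn : n ≠ i ∧ n ≠ j ∧ n ≠ k
      · have hc1 : Continuous fun ρ : ℝ => v (η n) + K n * ρ := by fun_prop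
        have hc2 : Continuous fun ρ : ℝ => κ n - ρ := by fun_prop
        filter_upwards [nhdsWithin_le_nhds (hc1.continuousAt.eventually_lt hc2.continuousAt
          (by simpa using hlt n hn.1 hn.2.1 hn.2.2))] with ρ hρ _ _ _
        exact hρ
      · exact Eventually.of_forall fun _ h1 h2 h4 => absurd ⟨h1, h2, h4⟩ hn
    filter_upwards [this] with ρ hρ _ x h1 h2 h4 n hn1 hn2 hn3
    have h5 := hK n ρ (x - v) (by simpa [hvi] using h1) (by simpa [hvj] using h2)
      (by simpa [hvk] using h4)
    have h6 := hρ n hn1 hn2 hn3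
    simp only [sub_apply] at h5
    linarith
  obtain ⟨ρ, ⟨⟨hface, hvert⟩, hch⟩, hρ⟩ :=
    (((hface.and hvert).and hnd.eventually_mem_chamber).and self_mem_nhdsWithin).exists
  have hρ : 0 < ρ := hρ
  have hbd : ∀ κ' : ι → ℝ, Bornology.IsBounded (polytope η κ') :=
    isBounded_polytope hnd.bounded hnd.nonempty
  have hbox : ∀ {f : StrongDual ℝ t → ℝ}, Continuous f → ∀ {κ' i j k a a' b b' c c'},
      IsVertex η κ i j k → a ≤ a' → b ≤ b' → c ≤ c' →
      Near κ ρ (κ' + (Pi.single i a + Pi.single j b + Pi.single k c)) →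
      Near κ ρ (κ' + (Pi.single i a' + Pi.single j b' + Pi.single k c')) →
      diff₃ (moment η f) κ' i j k a a' b b' c c' =
        ∫ x in {x : StrongDual ℝ t | ∀ n : Fin 3,
          (![κ' i + a, κ' j + b, κ' k + c] : Fin 3 → ℝ) n < x ((![η i, η j, η k] : Fin 3 → t) n) ∧
          x ((![η i, η j, η k] : Fin 3 → t) n) ≤
            (![κ' i + a', κ' j + b', κ' k + c'] : Fin 3 → ℝ) n},
          f x ∂(Measure.addHaar : Measure (StrongDual ℝ t)) := by
    intro f hf κ' i j k a a' b b' c c' hv ha hb hc hlo hhi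
    rw [diff₃_moment hf hbd κ' hv.1 ha hb hc]
    congr 2
    obtain ⟨hij, hik, hjk⟩ := hv.1
    have hlo' := fun n => abs_le.1 (hlo n)
    have hhi' := fun n => abs_le.1 (hhi n)
    have lo1 := hlo' i
    have lo2 := hlo' j
    have lo3 := hlo' k
    have hi1 := hhi' i
    have hi2 := hhi' j
    have hi3 := hhi' k
    simp only [Pi.add_apply, Pi.single_eq_same, Pi.single_eq_of_ne hij, Pi.single_eq_of_ne hik,
      Pi.single_eq_of_ne hjk, Pi.single_eq_of_ne hij.symm, Pi.single_eq_of_ne hik.symm,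
      Pi.single_eq_of_ne hjk.symm, add_zero, zero_add] at lo1 lo2 lo3 hi1 hi2 hi3
    ext x
    simp only [mem_inter_iff, mem_ofPred_eq, Fin.forall_fin_succ, Matrix.cons_val_zero,
      Matrix.cons_val_succ, IsEmpty.forall_iff, and_true]
    constructor
    · rintro ⟨hx, h1, h2, h4⟩
      have e1 := hx i
      have e2 := hx j
      have e3 := hx k
      simp only [Pi.add_apply, Pi.single_eq_same, Pi.single_eq_of_ne hij, Pi.single_eq_of_ne hik,
        Pi.single_eq_of_ne hjk, Pi.single_eq_of_ne hij.symm, Pi.single_eq_of_ne hik.symm,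
        Pi.single_eq_of_ne hjk.symm, add_zero, zero_add] at e1 e2 e3
      exact ⟨⟨h1, e1⟩, ⟨h2, e2⟩, ⟨h4, e3⟩⟩
    · rintro ⟨⟨h1, e1⟩, ⟨h2, e2⟩, ⟨h4, e3⟩⟩
      refine ⟨fun n => ?_, h1, h2, h4⟩
      by_cases hni : n = i
      · subst hni
        simpa [hij, hik] using e1
      by_cases hnj : n = j
      · subst hnj
        simpa [hni, hjk] using e2
      by_cases hnk : n = k
      · subst hnk
        simpa [hni, hnj] using e3
      have e4 := hvert (i, j, k) hv x (abs_le.2 ⟨by linarith, by linarith⟩)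
        (abs_le.2 ⟨by linarith, by linarith⟩) (abs_le.2 ⟨by linarith, by linarith⟩) n hni hnj hnk
      have e5 := (hlo' n).1
      simp only [Pi.add_apply, Pi.single_eq_of_ne hni, Pi.single_eq_of_ne hnj,
        Pi.single_eq_of_ne hnk, add_zero] at e5 ⊢
      linarith
  refine ⟨ρ, c, hρ, hc, hch, ?_, ?_, ?_, ?_⟩
  · intro f hf κ' i j a a' b b' hij hno ha hb hlo hhi
    have h1 := diff₂_moment hf hbd κ' hij ha hb (Q := univ) .univ
    simp only [inter_univ] at h1
    rw [show moment η f = fun κ => ∫ x in polytope η κ, f x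
      ∂(Measure.addHaar : Measure (StrongDual ℝ t)) from rfl, h1]
    have hemp : polytope η (κ' + (Pi.single i a' + Pi.single j b')) ∩
        ({x | κ' i + a < x (η i)} ∩ {x | κ' j + b < x (η j)}) = ∅ := by
      refine eq_empty_of_forall_notMem fun x hx => ?_
      refine hface {i, j} (fun y hy => ?_) x (fun n => ?_) fun n hn => ?_
      · by_contra! hcon
        obtain ⟨k, hk⟩ := h.exists_isVertex_of_mem h3 hij hy (hcon i (by simp)) (hcon j (by simp))
        exact hno k hk
      · linarith [hx.1 n, (abs_le.1 (hhi n)).2]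
      · rcases hn with rfl | rfl
        · have e1 := (abs_le.1 (hlo n)).1
          have e2 := hx.2.1
          simp only [Pi.add_apply, Pi.single_eq_same, Pi.single_eq_of_ne hij, mem_ofPred_eq,
            add_zero] at e1 e2
          linarith
        · have e1 := (abs_le.1 (hlo n)).1
          have e2 := hx.2.2
          simp only [Pi.add_apply, Pi.single_eq_same, Pi.single_eq_of_ne hij.symm, mem_ofPred_eq,
            zero_add] at e1 e2
          linarith
    rw [hemp, Measure.restrict_empty, integral_zero_measure]
  · intro f hf κ' i j k a a' b b' c c' hne hno ha hb hc hlo hhi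
    rw [diff₃_moment hf hbd κ' hne ha hb hc]
    have hemp : polytope η (κ' + (Pi.single i a' + Pi.single j b' + Pi.single k c')) ∩
        ({x | κ' i + a < x (η i)} ∩ ({x | κ' j + b < x (η j)} ∩ {x | κ' k + c < x (η k)})) = ∅ := by
      refine eq_empty_of_forall_notMem fun x hx => ?_
      obtain ⟨hij, hik, hjk⟩ := hne
      refine hface {i, j, k} (fun y hy => ?_) x (fun n => ?_) fun n hn => ?_
      · by_contra! hcon
        exact hno ⟨⟨hij, hik, hjk⟩, y, hy, hcon i (by simp), hcon j (by simp), hcon k (by simp)⟩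
      · linarith [hx.1 n, (abs_le.1 (hhi n)).2]
      · have e1 := (abs_le.1 (hlo n)).1
        obtain ⟨-, e2, e3, e4⟩ := hx
        rcases hn with rfl | rfl | rfl
        · simp only [Pi.add_apply, Pi.single_eq_same, Pi.single_eq_of_ne hij,
            Pi.single_eq_of_ne hik, mem_ofPred_eq, add_zero] at e1 e2
          linarith
        · simp only [Pi.add_apply, Pi.single_eq_same, Pi.single_eq_of_ne hij.symm,
            Pi.single_eq_of_ne hjk, mem_ofPred_eq, add_zero, zero_add] at e1 e3
          linarith
        · simp only [Pi.add_apply, Pi.single_eq_same, Pi.single_eq_of_ne hik.symm,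
            Pi.single_eq_of_ne hjk.symm, mem_ofPred_eq, zero_add] at e1 e4
          linarith
    rw [hemp, Measure.restrict_empty, integral_zero_measure]
  · intro f hf κ' κ'' i j k a a' b b' c c' hv ha hb hc h1 h2 h4 n1 n2 n3 n4
    rw [hbox hf hv ha hb hc n1 n2, hbox hf hv ha hb hc n3 n4, h1, h2, h4]
  · intro κ' i j k a a' b b' c' c'' hv ha hb hc hlo hhi
    rw [hbox continuous_const hv ha hb hc hlo hhi]
    have := hvol _ (hv.linearIndependent h) (hv.span_int h h3)
      ![κ' i + a, κ' j + b, κ' k + c'] ![κ' i + a', κ' j + b', κ' k + c'']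
      (by intro n; fin_cases n <;> simpa)
    rw [setIntegral_const, smul_eq_mul, mul_one, this, Fin.prod_univ_three]
    simp

end Local

/-! ### Coefficients of a mass linear function: translations and the four-facet relation. -/

section Relations

variable {t : Type*} [NormedAddCommGroup t] [NormedSpace ℝ t] [FiniteDimensional ℝ t]
variable {ι : Type*} [Fintype ι] {L : Submodule ℤ t} {η : ι → t} {κ : ι → ℝ}

/-- `H` is mass linear with coefficients `γ` and constant term `C`. -/
def IsMassLinearWith (η : ι → t) (κ : ι → ℝ) (H : t) (γ : ι → ℝ) (C : ℝ) : Prop :=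
  ∀ κ' ∈ chamber η κ, centerOfMass (polytope η κ') H = ∑ i, γ i * κ' i + C

theorem IsMassLinearWith.moment_eq {H : t} {γ : ι → ℝ} {C : ℝ}
    (hH : IsMassLinearWith η κ H γ C) {κ' : ι → ℝ} (hκ' : κ' ∈ chamber η κ) :
    moment η (fun x => x H) κ' = (∑ i, γ i * κ' i + C) * moment η (fun _ => 1) κ' :=
  moment_eq_of_centerOfMass (isSimple_of_mem_chamber hκ').bounded (hH κ' hκ')

omit [FiniteDimensional ℝ t] in
theorem sum_mul_add_single [DecidableEq ι] (γ κ' : ι → ℝ) (i : ι) (a : ℝ) :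
    ∑ m, γ m * (κ' + (Pi.single i a : ι → ℝ)) m = ∑ m, γ m * κ' m + γ i * a := by
  simp [mul_add, Finset.sum_add_distrib, Pi.single_apply]

/-- A mass linear function is the combination of the conormals with its own coefficients. -/
theorem IsMassLinearWith.eq_sum [DecidableEq ι] (h : IsSmooth L η κ) {ρ c : ℝ}
    (hρ : IsRegularRadius η κ ρ c) {H : t} {γ : ι → ℝ} {C : ℝ} (hH : IsMassLinearWith η κ H γ C) :
    H = ∑ i, γ i • η i := by
  have hb := h.simple.bounded
  have hnd := h.isNondegenerate
  have hV := hnd.moment_one_pos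
  rw [← sub_eq_zero]
  refine eq_zero_of_forall_dual fun x => ?_
  -- Translation by `τ • x` changes the support numbers by `τ * x (η i)` and moves the center of
  -- mass by `τ • x`. Comparing the values of `H` gives `x H = ∑ i, γ i * x (η i)`; `τ` only keeps
  -- the translate within the radius.
  obtain ⟨τ, hτ, hτx⟩ : ∃ τ : ℝ, 0 < τ ∧ ∀ i, |τ * x (η i)| ≤ ρ := by
    have : ∀ᶠ τ in 𝓝[>] (0 : ℝ), ∀ i, |τ * x (η i)| < ρ := by
      refine eventually_all.2 fun i => nhdsWithin_le_nhds ?_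
      have hc : Continuous fun τ : ℝ => |τ * x (η i)| := by fun_prop
      exact hc.continuousAt.eventually_lt_const (by simpa using hρ.pos)
    obtain ⟨τ, h1, h2⟩ := (this.and self_mem_nhdsWithin).exists
    exact ⟨τ, h2, fun i => (h1 i).le⟩
  have hmem : (κ + fun i => (τ • x) (η i)) ∈ chamber η κ :=
    hρ.mem_chamber _ fun i => by simpa using hτx i
  have hmem0 : κ ∈ chamber η κ := hρ.mem_chamber _ fun i => by simpa using hρ.pos.le
  have h1 := hH.moment_eq hmem
  have h2 := hH.moment_eq hmem0
  rw [moment_translate, moment_translate] at h1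
  have h4 : moment η (fun y => (y + τ • x) H) κ =
      moment η (fun y => y H) κ + τ * x H * moment η (fun _ => 1) κ := by
    simp only [moment, add_apply, FunLike.coe_smul, Pi.smul_apply, smul_eq_mul]
    rw [integral_add (integrableOn_of_isBounded (continuous_apply_const H) hb)
      (integrableOn_of_isBounded continuous_const hb)]
    simp only [integral_const, smul_eq_mul]
    ring
  have h5 : ∑ i, γ i * (κ + fun i => (τ • x) (η i)) i =
      ∑ i, γ i * κ i + τ * ∑ i, γ i * x (η i) := by
    simp only [Pi.add_apply, FunLike.coe_smul, Pi.smul_apply, smul_eq_mul, mul_add,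
      Finset.sum_add_distrib, Finset.mul_sum]
    congr 1
    exact Finset.sum_congr rfl fun i _ => by ring
  rw [h4, h2, h5] at h1
  have h6 : τ * moment η (fun _ => (1 : ℝ)) κ * (x H - ∑ i, γ i * x (η i)) = 0 := by linarith
  have h7 := (mul_eq_zero.1 h6).resolve_left (mul_pos hτ hV).ne'
  simpa [map_sub, map_sum] using h7

/-- The four-facet relation: the coefficient of each of four facets counts with the intersection
number of the other three. -/
theorem IsMassLinearWith.four_facets [DecidableEq ι] {ρ c : ℝ} (hρ : IsRegularRadius η κ ρ c)
    {H : t} {γ : ι → ℝ} {C : ℝ} (hH : IsMassLinearWith η κ H γ C) {e : ι → ι → ι → ℝ}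
    (he : ∀ i j k, IsVertex η κ i j k → e i j k = 1)
    (he' : ∀ i j k, ¬ IsVertex η κ i j k → e i j k = 0) {i j k l : ι}
    (hij : i ≠ j) (hik : i ≠ k) (hil : i ≠ l) (hjk : j ≠ k) (hjl : j ≠ l) (hkl : k ≠ l) :
    γ i * e j k l + γ j * e i k l + γ k * e i j l + γ l * e i j k = 0 := by
  have hpos := hρ.pos
  have hnear : ∀ a b c d : ℝ, 0 ≤ a → a ≤ ρ → 0 ≤ b → b ≤ ρ → 0 ≤ c → c ≤ ρ → 0 ≤ d → d ≤ ρ →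
      Near κ ρ (κ + (Pi.single i a + (Pi.single j b + (Pi.single k c + Pi.single l d)))) := by
    intro a b c d ha ha' hb hb' hc hc' hd hd' n
    simp only [Pi.add_apply, add_sub_cancel_left, Pi.single_apply]
    by_cases h1 : n = i
    · subst h1
      simpa [hij, hik, hil, abs_of_nonneg ha] using ha'
    by_cases h2 : n = j
    · subst h2
      simpa [h1, hjk, hjl, abs_of_nonneg hb] using hb'
    by_cases h3 : n = k
    · subst h3
      simpa [h1, h2, hkl, abs_of_nonneg hc] using hc'
    by_cases h4 : n = l
    · subst h4
      simpa [h1, h2, h3, abs_of_nonneg hd] using hd'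
    · simpa [h1, h2, h3, h4] using hpos.le
  set V := moment η (fun _ => (1 : ℝ)) with hVdef
  set M := moment η (fun x => x H) with hMdef
  have hM : ∀ a b c d : ℝ, 0 ≤ a → a ≤ ρ → 0 ≤ b → b ≤ ρ → 0 ≤ c → c ≤ ρ → 0 ≤ d → d ≤ ρ →
      M (κ + (Pi.single i a + (Pi.single j b + (Pi.single k c + Pi.single l d)))) =
      (∑ m, γ m * κ m + C + γ i * a + γ j * b + γ k * c + γ l * d) *
      V (κ + (Pi.single i a + (Pi.single j b + (Pi.single k c + Pi.single l d)))) := by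
    intro a b c d ha ha' hb hb' hc hc' hd hd'
    refine (hH.moment_eq
      (hρ.mem_chamber _ (hnear a b c d ha ha' hb hb' hc hc' hd hd'))).trans ?_
    simp only [← add_assoc, sum_mul_add_single]
    ring
  have hV : ∀ (κ' : ι → ℝ) (i j k : ι), (i ≠ j ∧ i ≠ k ∧ j ≠ k) →
      Near κ ρ (κ' + (Pi.single i 0 + Pi.single j 0 + Pi.single k 0)) →
      Near κ ρ (κ' + (Pi.single i ρ + Pi.single j ρ + Pi.single k ρ)) →
      diff₃ V κ' i j k 0 ρ 0 ρ 0 ρ = c * ρ ^ 3 * e i j k := by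
    intro κ' i j k hne h1 h2
    by_cases hv : IsVertex η κ i j k
    · rw [hρ.diff₃_volume κ' i j k 0 ρ 0 ρ 0 ρ hv hpos.le hpos.le hpos.le h1 h2, he _ _ _ hv]
      ring
    · rw [hρ.diff₃_eq_zero _ continuous_const κ' i j k 0 ρ 0 ρ 0 ρ hne hv hpos.le hpos.le hpos.le
        h1 h2, he' _ _ _ hv]
      ring
  have hn : ∀ a b c d : ℝ, a = 0 ∨ a = ρ → b = 0 ∨ b = ρ → c = 0 ∨ c = ρ → d = 0 ∨ d = ρ →
      Near κ ρ (κ + (Pi.single i a + (Pi.single j b + (Pi.single k c + Pi.single l d)))) := by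
    intro a b c d ha hb hc hd
    have : ∀ {a : ℝ}, a = 0 ∨ a = ρ → 0 ≤ a ∧ a ≤ ρ := by
      rintro a (rfl | rfl)
      · exact ⟨le_rfl, hpos.le⟩
      · exact ⟨hpos.le, le_rfl⟩
    exact hnear a b c d (this ha).1 (this ha).2 (this hb).1 (this hb).2 (this hc).1 (this hc).2
      (this hd).1 (this hd).2
  -- The parallelepiped at the vertex of `i`, `j`, `k` does not change when `l` is moved, so the
  -- fourth difference of `M` vanishes.
  have hMl : diff₃ M (κ + Pi.single l ρ) i j k 0 ρ 0 ρ 0 ρ =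
      diff₃ M (κ + Pi.single l 0) i j k 0 ρ 0 ρ 0 ρ := by
    have n1 := hn 0 0 0 ρ (by simp) (by simp) (by simp) (by simp)
    have n2 := hn ρ ρ ρ ρ (by simp) (by simp) (by simp) (by simp)
    have n3 := hn 0 0 0 0 (by simp) (by simp) (by simp) (by simp)
    have n4 := hn ρ ρ ρ 0 (by simp) (by simp) (by simp) (by simp)
    have e1 : ∀ a d : ℝ, κ + (Pi.single i a + (Pi.single j a + (Pi.single k a + Pi.single l d))) =
        κ + Pi.single l d + (Pi.single i a + Pi.single j a + Pi.single k a) := fun a d => by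
      ac_rfl
    rw [e1] at n1 n2 n3 n4
    by_cases hv : IsVertex η κ i j k
    · exact hρ.diff₃_congr _ (continuous_apply_const H) _ _ i j k 0 ρ 0 ρ 0 ρ hv hpos.le hpos.le
        hpos.le (by simp [hil]) (by simp [hjl]) (by simp [hkl]) n1 n2 n3 n4
    · exact (hρ.diff₃_eq_zero _ (continuous_apply_const H) _ i j k 0 ρ 0 ρ 0 ρ ⟨hij, hik, hjk⟩ hv
        hpos.le hpos.le hpos.le n1 n2).trans (hρ.diff₃_eq_zero _ (continuous_apply_const H) _ i j k
        0 ρ 0 ρ 0 ρ ⟨hij, hik, hjk⟩ hv hpos.le hpos.le hpos.le n3 n4).symm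
  have vl : ∀ d : ℝ, d = 0 ∨ d = ρ → _ := fun d hd => hV (κ + Pi.single l d) i j k ⟨hij, hik, hjk⟩
    (by convert hn 0 0 0 d (by simp) (by simp) (by simp) hd using 1; ac_rfl)
    (by convert hn ρ ρ ρ d (by simp) (by simp) (by simp) hd using 1; ac_rfl)
  have vl0 := vl 0 (by simp)
  have vl1 := vl ρ (by simp)
  have vk1 := hV (κ + Pi.single k ρ) i j l ⟨hij, hil, hjl⟩
    (by convert hn 0 0 ρ 0 (by simp) (by simp) (by simp) (by simp) using 1; ac_rfl)
    (by convert hn ρ ρ ρ ρ (by simp) (by simp) (by simp) (by simp) using 1; ac_rfl)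
  have vj1 := hV (κ + Pi.single j ρ) i k l ⟨hik, hil, hkl⟩
    (by convert hn 0 ρ 0 0 (by simp) (by simp) (by simp) (by simp) using 1; ac_rfl)
    (by convert hn ρ ρ ρ ρ (by simp) (by simp) (by simp) (by simp) using 1; ac_rfl)
  have vi1 := hV (κ + Pi.single i ρ) j k l ⟨hjk, hjl, hkl⟩
    (by convert hn ρ 0 0 0 (by simp) (by simp) (by simp) (by simp) using 1; ac_rfl)
    (by convert hn ρ ρ ρ ρ (by simp) (by simp) (by simp) (by simp) using 1; ac_rfl)
  have sl : ∀ x y z w : ι → ℝ, κ + w + z + (x + y) = κ + (x + (y + (z + w))) :=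
    fun x y z w => by ac_rfl
  have sk : ∀ x y z w : ι → ℝ, κ + z + w + (x + y) = κ + (x + (y + (z + w))) :=
    fun x y z w => by ac_rfl
  have sj : ∀ x y z w : ι → ℝ, κ + y + w + (x + z) = κ + (x + (y + (z + w))) :=
    fun x y z w => by ac_rfl
  have si : ∀ x y z w : ι → ℝ, κ + x + w + (y + z) = κ + (x + (y + (z + w))) :=
    fun x y z w => by ac_rfl
  simp only [diff₃, diff₂, sl _ _ (Pi.single k _) (Pi.single l _)] at vl0 vl1 hMl
  simp only [diff₃, diff₂, sk _ _ (Pi.single k _) (Pi.single l _)] at vk1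
  simp only [diff₃, diff₂, sj _ (Pi.single j _) _ (Pi.single l _)] at vj1
  simp only [diff₃, diff₂, si (Pi.single i _) _ _ (Pi.single l _)] at vi1
  have hr0 : (0 : ℝ) ≤ 0 := le_rfl
  have hrr : ρ ≤ ρ := le_rfl
  have hr1 := hpos.le
  simp only [hM _ _ _ _ hr0 hr1 hr0 hr1 hr0 hr1 hr0 hr1, hM _ _ _ _ hr1 hrr hr0 hr1 hr0 hr1 hr0 hr1,
    hM _ _ _ _ hr0 hr1 hr1 hrr hr0 hr1 hr0 hr1, hM _ _ _ _ hr0 hr1 hr0 hr1 hr1 hrr hr0 hr1,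
    hM _ _ _ _ hr0 hr1 hr0 hr1 hr0 hr1 hr1 hrr, hM _ _ _ _ hr1 hrr hr1 hrr hr0 hr1 hr0 hr1,
    hM _ _ _ _ hr1 hrr hr0 hr1 hr1 hrr hr0 hr1, hM _ _ _ _ hr1 hrr hr0 hr1 hr0 hr1 hr1 hrr,
    hM _ _ _ _ hr0 hr1 hr1 hrr hr1 hrr hr0 hr1, hM _ _ _ _ hr0 hr1 hr1 hrr hr0 hr1 hr1 hrr,
    hM _ _ _ _ hr0 hr1 hr0 hr1 hr1 hrr hr1 hrr, hM _ _ _ _ hr1 hrr hr1 hrr hr1 hrr hr0 hr1,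
    hM _ _ _ _ hr1 hrr hr1 hrr hr0 hr1 hr1 hrr, hM _ _ _ _ hr1 hrr hr0 hr1 hr1 hrr hr1 hrr,
    hM _ _ _ _ hr0 hr1 hr1 hrr hr1 hrr hr1 hrr, hM _ _ _ _ hr1 hrr hr1 hrr hr1 hrr hr1 hrr] at hMl
  have hc : c * ρ ^ 4 ≠ 0 := (mul_pos hρ.cell_pos (pow_pos hpos 4)).ne'
  refine (mul_eq_zero.1 (?_ : c * ρ ^ 4 *
    (γ i * e j k l + γ j * e i k l + γ k * e i j l + γ l * e i j k) = 0)).resolve_left hc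
  -- The discrete product rule for an affine function times `V`: the fourth difference of `V` is
  -- zero, and what remains is each coefficient times the third difference of `V` in the other three
  -- directions.
  linear_combination hMl - (∑ m, γ m * κ m + C) * (vl1 - vl0) - γ l * ρ * vl1 - γ k * ρ * vk1 -
    γ j * ρ * vj1 - γ i * ρ * vi1

end Relations

/-! ### Vanishing of self-intersection numbers along an edge. -/

section SelfIntersection

variable {t : Type*} [NormedAddCommGroup t] [NormedSpace ℝ t] [FiniteDimensional ℝ t]
variable {ι : Type*} [Fintype ι] {L : Submodule ℤ t} {η : ι → t} {κ : ι → ℝ}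

/-- The relation between the second differences of the volume for three facets without a common
vertex. -/
theorem IsMassLinearWith.three_facets [DecidableEq ι] {ρ c : ℝ} (hρ : IsRegularRadius η κ ρ c)
    {H : t} {γ : ι → ℝ} {C : ℝ} (hH : IsMassLinearWith η κ H γ C) {i j k : ι}
    (hne : i ≠ j ∧ i ≠ k ∧ j ≠ k) (hno : ¬ IsVertex η κ i j k) {κ' : ι → ℝ} {s : ℝ} (hs : 0 < s)
    (hnear : ∀ a b d : ℝ, |a| ≤ s → |b| ≤ s → |d| ≤ s →
      Near κ ρ (κ' + (Pi.single i a + (Pi.single j b + Pi.single k d)))) :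
    γ k * diff₂ (moment η fun _ => 1) (κ' + Pi.single k s) i j 0 s 0 s +
      γ i * diff₂ (moment η fun _ => 1) (κ' + Pi.single i s) j k 0 s 0 s +
      γ j * diff₂ (moment η fun _ => 1) (κ' + Pi.single j s) i k 0 s 0 s = 0 := by
  set V := moment η (fun _ => (1 : ℝ)) with hVdef
  set M := moment η (fun x => x H) with hMdef
  have hM : ∀ a b d : ℝ, |a| ≤ s → |b| ≤ s → |d| ≤ s →
      M (κ' + (Pi.single i a + (Pi.single j b + Pi.single k d))) =
      (∑ m, γ m * κ' m + C + γ i * a + γ j * b + γ k * d) *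
      V (κ' + (Pi.single i a + (Pi.single j b + Pi.single k d))) := by
    intro a b d ha hb hd
    refine (hH.moment_eq (hρ.mem_chamber _ (hnear a b d ha hb hd))).trans ?_
    simp only [← add_assoc, sum_mul_add_single]
    ring
  have h0 : |(0 : ℝ)| ≤ s := by simpa using hs.le
  have h1 : |s| ≤ s := (abs_of_pos hs).le
  have n1 := hnear 0 0 0 h0 h0 h0
  have n2 := hnear s s s h1 h1 h1
  rw [← add_assoc (Pi.single i _)] at n1 n2
  have v := hρ.diff₃_eq_zero _ (continuous_const (y := 1)) κ' i j k 0 s 0 s 0 s hne hno hs.le hs.le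
    hs.le n1 n2
  have m := hρ.diff₃_eq_zero _ (continuous_apply_const H) κ' i j k 0 s 0 s 0 s hne hno hs.le hs.le
    hs.le n1 n2
  rw [← hVdef] at v
  rw [← hMdef] at m
  have sk : ∀ x y z : ι → ℝ, κ' + z + (x + y) = κ' + (x + (y + z)) := fun x y z => by ac_rfl
  have sj : ∀ x y z : ι → ℝ, κ' + y + (x + z) = κ' + (x + (y + z)) := fun x y z => by ac_rfl
  have si : ∀ x y z : ι → ℝ, κ' + x + (y + z) = κ' + (x + (y + z)) := fun x y z => by ac_rfl
  simp only [diff₃, diff₂, sk _ _ (Pi.single k _)] at v m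
  simp only [diff₂, sk _ _ (Pi.single k _), sj _ (Pi.single j _), si (Pi.single i _)]
  simp only [hM _ _ _ h0 h0 h0, hM _ _ _ h0 h0 h1, hM _ _ _ h0 h1 h0, hM _ _ _ h0 h1 h1,
    hM _ _ _ h1 h0 h0, hM _ _ _ h1 h0 h1, hM _ _ _ h1 h1 h0, hM _ _ _ h1 h1 h1] at m
  refine (mul_eq_zero.1 (?_ : s * _ = 0)).resolve_left hs.ne'
  -- The product rule again, now for third differences; those of `V` and of `M` both vanish since
  -- there is no common vertex.
  linear_combination m - (∑ m, γ m * κ' m + C) * v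

/-- Let `l` be a facet with nonzero coefficient that does not meet the edge of the facets `i` and
`a`.  If `a` has coefficient zero or `l` does not meet `i`, then the conormals at the two ends of
this edge add up to a multiple of `η a`. -/
theorem IsMassLinearWith.edge_coefficient_eq_zero [DecidableEq ι] (h : IsSmooth L η κ)
    (h3 : finrank ℝ t = 3) {ρ c : ℝ} (hρ : IsRegularRadius η κ ρ c) {H : t} {γ : ι → ℝ} {C : ℝ}
    (hH : IsMassLinearWith η κ H γ C) {i l a b m : ι} {q r : ℝ} (hil : i ≠ l) (hal : a ≠ l)
    (hb : IsVertex η κ b i a) (hm : IsVertex η κ m i a) (hmb : m ≠ b)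
    (hrel : η m = -η b + q • η i + r • η a) (hno : ¬ IsVertex η κ i a l) (hγ : γ l ≠ 0)
    (hor : γ a = 0 ∨ ∀ n, ¬ IsVertex η κ i l n) : q = 0 := by
  obtain ⟨hbi, hba, hia⟩ := hb.1
  obtain ⟨hmi, hma, -⟩ := hm.1
  -- Translation along `x` fixes the hyperplanes of `a` and `b`, moves that of `i` at unit speed and
  -- that of `m` at speed `q`.
  obtain ⟨x, hxb, hxi, hxa⟩ := hb.exists_dual h 0 1 0
  have hxm : x (η m) = q := by rw [hrel]; simp [hxb, hxi, hxa]
  -- Up to four displacements of size at most `s` are combined.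
  set s := ρ / 4 with hs_def
  have hs : 0 < s := by have := hρ.pos; positivity
  obtain ⟨τ, hτ, hτs, hτx⟩ : ∃ τ : ℝ, 0 < τ ∧ τ ≤ s ∧ ∀ n, |τ * x (η n)| ≤ s := by
    have h1 : ∀ᶠ τ in 𝓝[>] (0 : ℝ), ∀ n, |τ * x (η n)| < s := by
      refine eventually_all.2 fun n => nhdsWithin_le_nhds ?_
      have hc : Continuous fun τ : ℝ => |τ * x (η n)| := by fun_prop
      exact hc.continuousAt.eventually_lt_const (by simpa using hs)
    obtain ⟨τ, h1, h2⟩ := (h1.and (Ioo_mem_nhdsGT hs)).exists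
    exact ⟨τ, h2.1, h2.2.le, fun n => (h1 n).le⟩
  set V := moment η (fun _ => (1 : ℝ)) with hVdef
  have hsingle : ∀ (n : ι) {y : ℝ}, |y| ≤ s → ∀ n', |(Pi.single n y : ι → ℝ) n'| ≤ s := by
    intro n y hy n'
    by_cases hn : n' = n
    · subst hn; simpa using hy
    · simpa [hn] using hs.le
  have hnear : ∀ w₁ w₂ w₃ w₄ : ι → ℝ, (∀ n, |w₁ n| ≤ s) → (∀ n, |w₂ n| ≤ s) → (∀ n, |w₃ n| ≤ s) →
      (∀ n, |w₄ n| ≤ s) → Near κ ρ (κ + (w₁ + w₂ + w₃ + w₄)) := by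
    intro w₁ w₂ w₃ w₄ h1 h2 h4 h5 n
    have e1 := abs_le.1 (h1 n)
    have e2 := abs_le.1 (h2 n)
    have e3 := abs_le.1 (h4 n)
    have e4 := abs_le.1 (h5 n)
    simp only [Pi.add_apply, add_sub_cancel_left]
    rw [abs_le]
    constructor <;> linarith
  have h0s : |(0 : ℝ)| ≤ s := by simpa using hs.le
  have hss : |s| ≤ s := (abs_of_pos hs).le
  have hτs' : |τ| ≤ s := by rwa [abs_of_pos hτ]
  set G : (ι → ℝ) → ℝ := fun κ' => diff₂ V κ' i a 0 s 0 s with hG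
  -- `G` does not change when the facet `i` is moved
  have hGi : G (κ + Pi.single l s + Pi.single i τ) = G (κ + Pi.single l s) := by
    have key : ∀ u : ℝ, |u| ≤ s → γ l * G (κ + Pi.single l s + Pi.single i u) +
        γ i * diff₂ V (κ + Pi.single i u + Pi.single i s) a l 0 s 0 s = 0 := by
      intro u hu
      have h1 := hH.three_facets hρ ⟨hia, hil, hal⟩ hno (κ' := κ + Pi.single i u) hs
        fun a' b' d ha hb hd => by
          convert hnear _ _ _ _ (hsingle i hu) (hsingle i ha) (hsingle a hb) (hsingle l hd) using 1
          ac_rfl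
      -- The hypothesis `hor` removes one of the three terms. The term in `a` and `l` does not
      -- change when `i` moves, because `i`, `a`, `l` have no common vertex; so the term with the
      -- factor `γ l` does not change either.
      have h2 : γ a * diff₂ V (κ + Pi.single i u + Pi.single a s) i l 0 s 0 s = 0 := by
        rcases hor with h2 | h2
        · rw [h2, zero_mul]
        · rw [hρ.diff₂_eq_zero _ continuous_const _ i l 0 s 0 s hil h2 hs.le hs.le, mul_zero]
          · convert hnear _ _ _ _ (hsingle i hu) (hsingle a hss) (hsingle i h0s) (hsingle l h0s)
              using 1
            ac_rfl
          · convert hnear _ _ _ _ (hsingle i hu) (hsingle a hss) (hsingle i hss) (hsingle l hss)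
              using 1
            ac_rfl
      rw [h2, add_zero, add_right_comm] at h1
      exact h1
    have hsame : diff₂ V (κ + Pi.single i τ + Pi.single i s) a l 0 s 0 s =
        diff₂ V (κ + Pi.single i 0 + Pi.single i s) a l 0 s 0 s := by
      rw [← sub_eq_zero]
      have h1 := hρ.diff₃_eq_zero _ (continuous_const (y := 1)) (κ + Pi.single i s) a l i
        0 s 0 s 0 τ ⟨hal, hia.symm, hil.symm⟩ (fun hv => hno hv.swap₂₃.swap₁₂) hs.le hs.le hτ.le
        (by convert hnear _ _ _ _ (hsingle i hss) (hsingle a h0s) (hsingle l h0s) (hsingle i h0s)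
              using 1
            ac_rfl)
        (by convert hnear _ _ _ _ (hsingle i hss) (hsingle a hss) (hsingle l hss) (hsingle i hτs')
              using 1
            ac_rfl)
      rw [diff₃, add_right_comm κ _ (Pi.single i τ), add_right_comm κ _ (Pi.single i 0)] at h1
      exact h1
    have k1 := key τ hτs'
    have k2 := key 0 h0s
    rw [hsame] at k1
    simp only [Pi.single_zero, add_zero] at k1 k2
    exact mul_left_cancel₀ hγ (by linarith)
  -- moving a further facet `n` changes `G` by the intersection number of `i`, `a` and `n`
  have hedge : ∀ n, IsVertex η κ n i a → n = b ∨ n = m := by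
    obtain ⟨m', hm'b, -, -, huniq⟩ := hb.exists_edge h h3
    intro n hn
    rcases huniq n hn with h1 | h1
    · exact Or.inl h1
    · rcases huniq m hm with h2 | h2
      · exact absurd h2 hmb
      · exact Or.inr (h1.trans h2.symm)
  -- `G` measures the length of the edge of `i` and `a`, which depends only on these two facets and
  -- on the facets `b` and `m` at its ends.
  have hGn : ∀ (w : ι → ℝ) (n : ι) (y : ℝ), n ≠ i → n ≠ a → n ≠ b → n ≠ m →
      (∀ n, |w n| ≤ s) → (∀ n', |(w + (Pi.single n y : ι → ℝ)) n'| ≤ s) →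
      G (κ + Pi.single l s + (w + Pi.single n y)) = G (κ + Pi.single l s + w) := by
    intro w n y hni hna hnb hnm hw hwy
    have hnv : ¬ IsVertex η κ i a n := fun hv => by
      rcases hedge n hv.swap₂₃.swap₁₂ with h1 | h1 <;> contradiction
    have n1 : ∀ w : ι → ℝ, (∀ n, |w n| ≤ s) → ∀ u v : ℝ, |u| ≤ s → |v| ≤ s →
        Near κ ρ (κ + Pi.single l s + w + (Pi.single i u + Pi.single a v)) := by
      intro w hw u v hu hv
      convert hnear _ _ _ _ (hsingle l hss) hw (hsingle i hu) (hsingle a hv) using 1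
      ac_rfl
    have e1 : ∀ u v y : ℝ, κ + Pi.single l s + w + (Pi.single i u + Pi.single a v + Pi.single n y) =
        κ + Pi.single l s + (w + Pi.single n y) + (Pi.single i u + Pi.single a v) := fun u v y => by
      ac_rfl
    rw [← sub_eq_zero]
    rcases le_total 0 y with hy | hy
    · have h1 := hρ.diff₃_eq_zero _ (continuous_const (y := 1)) (κ + Pi.single l s + w) i a n
        0 s 0 s 0 y ⟨hia, hni.symm, hna.symm⟩ hnv hs.le hs.le hy
        (by rw [e1]; simpa using n1 w hw 0 0 h0s h0s) (by rw [e1]; exact n1 _ hwy _ _ hss hss)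
      simp only [diff₃, Pi.single_zero, add_zero, add_assoc _ w] at h1
      exact h1
    · have h1 := hρ.diff₃_eq_zero _ (continuous_const (y := 1)) (κ + Pi.single l s + w) i a n
        0 s 0 s y 0 ⟨hia, hni.symm, hna.symm⟩ hnv hs.le hs.le hy
        (by rw [e1]; exact n1 _ hwy _ _ h0s h0s) (by rw [e1]; simpa using n1 w hw s s hss hss)
      simp only [diff₃, Pi.single_zero, add_zero, add_assoc _ w] at h1
      rw [← neg_eq_zero, neg_sub]
      exact h1
  have hGm : ∀ y : ℝ, |y| ≤ s →
      G (κ + Pi.single l s + Pi.single m y) - G (κ + Pi.single l s) = c * s ^ 2 * y := by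
    intro y hy
    have hv : IsVertex η κ i a m := hm.swap₁₂.swap₂₃
    have n1 : ∀ u v : ℝ, |u| ≤ s → |v| ≤ s → ∀ y, |y| ≤ s →
        Near κ ρ (κ + Pi.single l s + (Pi.single i u + Pi.single a v + Pi.single m y)) := by
      intro u v hu hv y hy
      convert hnear _ _ _ _ (hsingle l hss) (hsingle i hu) (hsingle a hv) (hsingle m hy) using 1
      ac_rfl
    rcases le_total 0 y with hy0 | hy0
    · have h1 := hρ.diff₃_volume (κ + Pi.single l s) i a m 0 s 0 s 0 y hv hs.le hs.le hy0
        (n1 _ _ h0s h0s _ h0s) (n1 _ _ hss hss _ hy)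
      simp only [diff₃, Pi.single_zero, add_zero] at h1
      rw [show c * s ^ 2 * y = c * ((s - 0) * (s - 0) * (y - 0)) by ring]
      exact h1
    · have h1 := hρ.diff₃_volume (κ + Pi.single l s) i a m 0 s 0 s y 0 hv hs.le hs.le hy0
        (n1 _ _ h0s h0s _ hy) (n1 _ _ hss hss _ h0s)
      simp only [diff₃, Pi.single_zero, add_zero] at h1
      rw [show c * s ^ 2 * y = -(c * ((s - 0) * (s - 0) * (0 - y))) by ring, ← h1, neg_sub]
  -- compare with a translate
  set z : ι → ℝ := fun n => (if n = i then τ else 0) - τ * x (η n) with hz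
  have hzi : z i = 0 := by simp [hz, hxi]
  have hza : z a = 0 := by simp [hz, hxa, hia.symm]
  have hzb : z b = 0 := by simp [hz, hxb, hbi]
  have hzm : z m = -(τ * q) := by simp [hz, hxm, hmi]
  have hzs : ∀ n, |z n| ≤ s := fun n => by
    by_cases hn : n = i
    · rw [hn, hzi]; simpa using hs.le
    · simpa [hz, hn] using hτx n
  -- `z` trades the displacement of `i` for displacements of the other facets by translating back
  -- along `τ • x`. Of these only the displacement `-(τ * q)` of `m` can affect `G`, so invariance
  -- of `G` forces `q = 0`.
  have htrans : G (κ + Pi.single l s + z) = G (κ + Pi.single l s + Pi.single i τ) := by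
    have hVt : ∀ κ' : ι → ℝ, V (κ' + fun n => (-(τ • x)) (η n)) = V κ' := fun κ' => by
      rw [hVdef, moment_translate]
    have e1 : ∀ w : ι → ℝ, κ + Pi.single l s + z + w =
        κ + Pi.single l s + Pi.single i τ + w + fun n => (-(τ • x)) (η n) := fun w => by
      ext n
      simp [hz, Pi.single_apply]
      ring
    simp only [hG, diff₂, e1, hVt]
  have hsum : ∀ S : Finset ι, m ∉ S →
      G (κ + Pi.single l s + (Pi.single m (z m) + ∑ n ∈ S, Pi.single n (z n))) =
        G (κ + Pi.single l s + Pi.single m (z m)) := by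
    have hval : ∀ S : Finset ι, m ∉ S → ∀ n',
        |(Pi.single m (z m) + ∑ n ∈ S, Pi.single n (z n) : ι → ℝ) n'| ≤ s := by
      intro S hS n'
      simp only [Pi.add_apply, Finset.sum_apply, Pi.single_apply, Finset.sum_ite_eq]
      by_cases hn : n' = m
      · subst hn
        simpa [hS] using hzs n'
      · by_cases hn' : n' ∈ S
        · simpa [hn, hn'] using hzs n'
        · simpa [hn, hn'] using hs.le
    intro S
    induction S using Finset.induction_on with
    | empty => simp
    | insert n S hn ih =>
      intro hmS
      rw [Finset.mem_insert, not_or] at hmS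
      rw [← ih hmS.2, Finset.sum_insert hn, add_comm (Pi.single n (z n) : ι → ℝ), ← add_assoc
        (Pi.single m (z m) : ι → ℝ)]
      by_cases hzero : n = i ∨ n = a ∨ n = b
      · have : z n = 0 := by rcases hzero with rfl | rfl | rfl <;> assumption
        rw [this, Pi.single_zero, add_zero]
      · simp only [not_or] at hzero
        refine hGn _ n _ hzero.1 hzero.2.1 hzero.2.2 (Ne.symm hmS.1) (hval S hmS.2) ?_
        have := hval (insert n S) (by simp [hmS.1, hmS.2])
        rwa [Finset.sum_insert hn, add_comm (Pi.single n (z n) : ι → ℝ), ← add_assoc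
          (Pi.single m (z m) : ι → ℝ)] at this
  have hzsum : z = Pi.single m (z m) + ∑ n ∈ Finset.univ.erase m, Pi.single n (z n) := by
    rw [Finset.add_sum_erase _ (fun n => (Pi.single n (z n) : ι → ℝ)) (Finset.mem_univ m)]
    ext n
    simp [Finset.sum_apply, Pi.single_apply]
  have h1 := hsum (Finset.univ.erase m) (by simp)
  rw [← hzsum, htrans, hGi] at h1
  have h2 := hGm (z m) (hzs m)
  rw [← h1, sub_self, hzm] at h2
  have hcs : c * s ^ 2 * τ ≠ 0 :=
    (mul_pos (mul_pos hρ.cell_pos (pow_pos hs 2)) hτ).ne'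
  exact (mul_eq_zero.1 (show c * s ^ 2 * τ * q = 0 by linarith)).resolve_left hcs

end SelfIntersection

/-! ### Combinatorics of the relations: facets and their partners. -/

section Classification

variable {t : Type*} [NormedAddCommGroup t] [NormedSpace ℝ t]
variable {ι : Type*} {L : Submodule ℤ t} {η : ι → t} {κ : ι → ℝ}

theorem IsVertex.rotate {i j k : ι} (h : IsVertex η κ i j k) : IsVertex η κ j k i :=
  h.swap₁₂.swap₂₃

theorem IsVertex.rotate' {i j k : ι} (h : IsVertex η κ i j k) : IsVertex η κ k i j :=
  h.swap₂₃.swap₁₂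

theorem IsVertex.swap₁₃ {i j k : ι} (h : IsVertex η κ i j k) : IsVertex η κ k j i :=
  h.rotate.swap₁₂

/-- The intersection number of three distinct facets: `1` if they have a common vertex and `0`
otherwise. -/
noncomputable def vertexIndicator (η : ι → t) (κ : ι → ℝ) (i j k : ι) : ℝ :=
  open Classical in if IsVertex η κ i j k then 1 else 0

theorem vertexIndicator_of_isVertex {i j k : ι} (h : IsVertex η κ i j k) :
    vertexIndicator η κ i j k = 1 := if_pos h

theorem vertexIndicator_of_not {i j k : ι} (h : ¬ IsVertex η κ i j k) :
    vertexIndicator η κ i j k = 0 := if_neg h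

theorem vertexIndicator_congr {i j k i' j' k' : ι}
    (h : IsVertex η κ i j k ↔ IsVertex η κ i' j' k') :
    vertexIndicator η κ i j k = vertexIndicator η κ i' j' k' := by
  unfold vertexIndicator
  split_ifs <;> tauto

theorem vertexIndicator_nonneg (i j k : ι) : 0 ≤ vertexIndicator η κ i j k := by
  unfold vertexIndicator
  split_ifs <;> norm_num

/-- The relations between the coefficients of a mass linear function. -/
structure IsBalanced (η : ι → t) (κ : ι → ℝ) (γ : ι → ℝ) : Prop where
  four_facets : ∀ i j k l : ι, i ≠ j → i ≠ k → i ≠ l → j ≠ k → j ≠ l → k ≠ l →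
    γ i * vertexIndicator η κ j k l + γ j * vertexIndicator η κ i k l +
      γ k * vertexIndicator η κ i j l + γ l * vertexIndicator η κ i j k = 0
  edge_coefficient : ∀ (i l a b m : ι) (q r : ℝ), i ≠ l → a ≠ l → IsVertex η κ b i a →
    IsVertex η κ m i a → m ≠ b → η m = -η b + q • η i + r • η a → ¬ IsVertex η κ i a l → γ l ≠ 0 →
    (γ a = 0 ∨ ∀ n, ¬ IsVertex η κ i l n) → q = 0

/-- Here the analysis ends: besides `H = ∑ i, γ i • η i`, the classification uses mass linearity
only through these relations. -/
theorem IsMassLinearWith.isBalanced [FiniteDimensional ℝ t] [Fintype ι] (h : IsSmooth L η κ)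
    (h3 : finrank ℝ t = 3) {H : t} {γ : ι → ℝ} {C : ℝ} (hH : IsMassLinearWith η κ H γ C) :
    IsBalanced η κ γ := by
  classical
  obtain ⟨ρ, c, hρ⟩ := h.exists_isRegularRadius h3
  exact ⟨fun i j k l h1 h2 h3 h4 h5 h6 => hH.four_facets hρ
    (fun _ _ _ => vertexIndicator_of_isVertex) (fun _ _ _ => vertexIndicator_of_not) h1 h2 h3 h4 h5
    h6, fun i l a b m q r => hH.edge_coefficient_eq_zero h h3 hρ⟩

/-- The facets `i` and `l` have opposite nonzero coefficients, every vertex lies on one of them, and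
they have the same neighbours. -/
structure IsPartner (η : ι → t) (κ : ι → ℝ) (γ : ι → ℝ) (l i : ι) : Prop where
  ne : i ≠ l
  ne_zero : γ l ≠ 0
  eq_neg : γ i = -γ l
  cover : ∀ a b c, IsVertex η κ a b c → (l = a ∨ l = b ∨ l = c) ∨ (i = a ∨ i = b ∨ i = c)
  left : ∀ a b, IsVertex η κ i a b → a ≠ l → b ≠ l → IsVertex η κ l a b
  right : ∀ a b, IsVertex η κ l a b → a ≠ i → b ≠ i → IsVertex η κ i a b
  simple_vertex : ∃ j k, IsVertex η κ i j k ∧ IsVertex η κ l j k ∧ ¬ IsVertex η κ i j l ∧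
    ¬ IsVertex η κ i k l

theorem IsPartner.symm {γ : ι → ℝ} {l i : ι} (h : IsPartner η κ γ l i) : IsPartner η κ γ i l where
  ne := h.ne.symm
  ne_zero := by rw [h.eq_neg]; exact neg_ne_zero.2 h.ne_zero
  eq_neg := by rw [h.eq_neg, neg_neg]
  cover a b c habc := (h.cover a b c habc).symm
  left := h.right
  right := h.left
  simple_vertex := by
    obtain ⟨j, k, h1, h2, h3, h4⟩ := h.simple_vertex
    exact ⟨j, k, h2, h1, fun h' => h3 h'.swap₁₃, fun h' => h4 h'.swap₁₃⟩

variable [FiniteDimensional ℝ t] [Fintype ι]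

/-- An edge has no other ends than two given ones. -/
theorem IsVertex.end_eq (h : IsSmooth L η κ) (h3 : finrank ℝ t = 3) {a b j k n : ι}
    (ha : IsVertex η κ a j k) (hb : IsVertex η κ b j k) (hab : b ≠ a) (hn : IsVertex η κ n j k) :
    n = a ∨ n = b := by
  obtain ⟨m, -, -, -, huniq⟩ := ha.exists_edge h h3
  rcases huniq n hn with h1 | h1
  · exact Or.inl h1
  · rcases huniq b hb with h2 | h2
    · exact absurd h2 hab
    · exact Or.inr (h1.trans h2.symm)

theorem IsVertex.exists_relation (h : IsSmooth L η κ) (h3 : finrank ℝ t = 3) {a b j k : ι}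
    (ha : IsVertex η κ a j k) (hb : IsVertex η κ b j k) (hab : b ≠ a) :
    ∃ q r : ℤ, η b = -η a + (q : ℝ) • η j + (r : ℝ) • η k := by
  obtain ⟨m, -, -, hrel, huniq⟩ := ha.exists_edge h h3
  rcases huniq b hb with h2 | h2
  · exact absurd h2 hab
  · rw [h2]
    exact hrel

/-- Every facet other than `l` has a vertex off `l`. -/
theorem IsSmooth.exists_vertex_off (h : IsSmooth L η κ) (h3 : finrank ℝ t = 3) {l n : ι}
    (hn : n ≠ l) : ∃ a b, IsVertex η κ n a b ∧ a ≠ l ∧ b ≠ l := by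
  obtain ⟨a, b, hab⟩ := h.exists_isVertex h3 n
  by_cases ha : a = l
  · subst ha
    obtain ⟨x, hx, hxv, -, -⟩ := hab.rotate.swap₂₃.exists_edge h h3
    exact ⟨b, x, hxv.rotate, hab.1.2.2.symm, hx⟩
  by_cases hb : b = l
  · subst hb
    obtain ⟨x, hx, hxv, -, -⟩ := hab.rotate'.exists_edge h h3
    exact ⟨a, x, hxv.rotate, ha, hx⟩
  exact ⟨a, b, hab, ha, hb⟩

/-- This carries the parallelism of `i` and `l` across an edge of `i`. If it failed, the four-facet
relation for `i`, `j`, `m`, `l` would give `γ j = -γ l = γ i`. The relation for `i`, `j`, `l` and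
the next facet `m'` along the edge of `l` and `j` would then be a positive multiple of `γ i`, which
is not zero. -/
theorem IsBalanced.adjacent_step (h : IsSmooth L η κ) (h3 : finrank ℝ t = 3) {γ : ι → ℝ}
    (hγ : IsBalanced η κ γ) {i j k l m : ι} (hl : γ l ≠ 0) (hil : γ i = -γ l)
    (hijk : IsVertex η κ i j k) (hljk : IsVertex η κ l j k) (hijm : IsVertex η κ i j m)
    (hmk : m ≠ k) (hml : m ≠ l) (hli : i ≠ l) : IsVertex η κ j m l := by
  obtain ⟨hij, hik, hjk⟩ := hijk.1
  obtain ⟨hlj, hlk, -⟩ := hljk.1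
  obtain ⟨-, him, hjm⟩ := hijm.1
  have hends : ∀ n, IsVertex η κ i j n → n = k ∨ n = m := fun n hn =>
    hijk.rotate'.end_eq h h3 hijm.rotate' hmk hn.rotate'
  have hijl : ¬ IsVertex η κ i j l := fun hv => by
    rcases hends l hv with h1 | h1
    · exact hlk h1
    · exact hml h1.symm
  by_contra hjml
  have h1 := hγ.four_facets i j m l hij him hli hjm hlj.symm hml
  rw [vertexIndicator_of_not hjml, vertexIndicator_of_not hijl,
    vertexIndicator_of_isVertex hijm] at h1
  have h2 := hγ.four_facets i j k l hij hik hli hjk hlj.symm hlk.symm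
  rw [vertexIndicator_of_isVertex hljk.rotate, vertexIndicator_of_not hijl,
    vertexIndicator_of_isVertex hijk] at h2
  have himl : IsVertex η κ i m l := by
    by_contra himl
    rw [vertexIndicator_of_not himl] at h1
    exact hl (by linarith)
  rw [vertexIndicator_of_isVertex himl] at h1
  obtain ⟨m', hm'k, hm', -, -⟩ := hljk.swap₁₃.exists_edge h h3
  have hm'i : m' ≠ i := by
    rintro rfl
    exact hijl hm'
  have hm'm : m' ≠ m := by
    rintro rfl
    exact hjml hm'.swap₁₂
  have hijm' : ¬ IsVertex η κ i j m' := fun hv => by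
    rcases hends m' hv with h4 | h4
    · exact hm'k h4
    · exact hm'm h4
  have h4 := hγ.four_facets i j l m' hij hli hm'i.symm hlj.symm hm'.1.1.symm hm'.1.2.1.symm
  rw [vertexIndicator_of_isVertex hm'.rotate, vertexIndicator_of_not hijm',
    vertexIndicator_of_not hijl] at h4
  have h5 := vertexIndicator_nonneg (η := η) (κ := κ) i l m'
  have h6 : γ j = γ i := by linarith
  rw [h6] at h4
  have h7 : γ i * (1 + vertexIndicator η κ i l m') = 0 := by linarith
  rcases mul_eq_zero.1 h7 with h8 | h8
  · exact hl (by linarith)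
  · linarith

/-- If only one of the edges at some vertex off the facet `l` leads to this facet, then the opposite
facet is a partner of `l`. -/
theorem IsBalanced.isPartner (h : IsSmooth L η κ) (h3 : finrank ℝ t = 3) {γ : ι → ℝ}
    (hγ : IsBalanced η κ γ) {i j k l : ι} (hl : γ l ≠ 0) (hijk : IsVertex η κ i j k)
    (hli : i ≠ l) (hljk : IsVertex η κ l j k) (hijl : ¬ IsVertex η κ i j l)
    (hikl : ¬ IsVertex η κ i k l) : IsPartner η κ γ l i := by
  obtain ⟨hij, hik, hjk⟩ := hijk.1
  obtain ⟨hlj, hlk, -⟩ := hljk.1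
  have hil : γ i = -γ l := by
    have h2 := hγ.four_facets i j k l hij hik hli hjk hlj.symm hlk.symm
    rw [vertexIndicator_of_isVertex hljk.rotate, vertexIndicator_of_not hijl,
      vertexIndicator_of_isVertex hijk, vertexIndicator_of_not hikl] at h2
    linarith
  -- The property that a vertex lies on `i` and its other two facets also meet on `l`. It spreads
  -- along the edges off `l`: the edge of `a` and `b` ends on `l`, so it is not one of them, and the
  -- other two edges are covered by `IsBalanced.adjacent_step`.
  let P : Set ι → Prop := fun w => ∃ a b, w = {i, a, b} ∧ IsVertex η κ i a b ∧ IsVertex η κ l a b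
  have key : ∀ {a b c}, IsVertex η κ a b c → l ≠ a ∧ l ≠ b ∧ l ≠ c → P {a, b, c} := by
    intro a b c habc hlabc
    refine h.off_facet_connected h3 l P ?_ hijk ⟨hli.symm, hlj, hlk⟩ ⟨j, k, rfl, hijk, hljk⟩ habc
      hlabc
    rintro p q r m hp hm hlp hlq hlr hlm ⟨a, b, hset, hiab, hlab⟩
    have hpm : ∀ x, x ∈ ({p, q, r} : Set ι) ↔ x = i ∨ x = a ∨ x = b := fun x => by
      rw [hset]; simp
    have e1 := (hpm p).1 (by simp)
    have e2 := (hpm q).1 (by simp)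
    have e3 := (hpm r).1 (by simp)
    obtain ⟨hpq, hpr, hqr⟩ := hp.1
    by_cases hmp : m = p
    · rw [hmp]
      exact ⟨a, b, hset, hiab, hlab⟩
    have step : ∀ {a b}, IsVertex η κ i a b → IsVertex η κ l a b → IsVertex η κ m i b → m ≠ a →
        P {m, i, b} := by
      intro a b hiab hlab hmib hma
      refine ⟨m, b, insert_comm _ _ _, hmib.swap₁₂, ?_⟩
      exact (hγ.adjacent_step h h3 hl hil hiab.swap₂₃ hlab.swap₂₃ hmib.rotate hma hlm.symm
        hli).swap₁₃.swap₂₃.swap₂₃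
    have done : ∀ {a b}, IsVertex η κ i a b → IsVertex η κ l a b → IsVertex η κ m a b → m ≠ i →
        P {m, a, b} := by
      intro a b hiab hlab hmab hmi
      rcases hiab.end_eq h h3 hlab hli.symm hmab with h4 | h4
      · exact absurd h4 hmi
      · exact absurd h4.symm hlm
    rcases e1 with rfl | rfl | rfl <;> rcases e2 with rfl | rfl | rfl <;>
      rcases e3 with rfl | rfl | rfl <;>
      (first | exact absurd rfl hpq | exact absurd rfl hpr | exact absurd rfl hqr | skip)
    · exact done hiab hlab hm hmp
    · exact done hiab.swap₂₃ hlab.swap₂₃ hm hmp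
    · exact step hiab hlab hm hmp
    · rw [show ({m, q, r} : Set ι) = {m, r, q} by rw [pair_comm]]
      exact step hiab hlab hm.swap₂₃ hmp
    · exact step hiab.swap₂₃ hlab.swap₂₃ hm hmp
    · rw [show ({m, q, r} : Set ι) = {m, r, q} by rw [pair_comm]]
      exact step hiab.swap₂₃ hlab.swap₂₃ hm.swap₂₃ hmp
  have hcover : ∀ a b c, IsVertex η κ a b c →
      (l = a ∨ l = b ∨ l = c) ∨ (i = a ∨ i = b ∨ i = c) := by
    intro a b c habc
    by_cases hlabc : l = a ∨ l = b ∨ l = c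
    · exact Or.inl hlabc
    · simp only [not_or] at hlabc
      obtain ⟨a', b', hset, -, -⟩ := key habc hlabc
      have : i ∈ ({a, b, c} : Set ι) := by rw [hset]; simp
      exact Or.inr (by simpa using this)
  have hleft : ∀ a b, IsVertex η κ i a b → a ≠ l → b ≠ l → IsVertex η κ l a b := by
    intro a b hiab hal hbl
    obtain ⟨a', b', hset, -, hlab⟩ := key hiab ⟨hli.symm, hal.symm, hbl.symm⟩
    have hpm : ∀ x, x ∈ ({i, a, b} : Set ι) ↔ x = i ∨ x = a' ∨ x = b' := fun x => by
      rw [hset]; simp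
    obtain ⟨hia, hib, hab⟩ := hiab.1
    rcases ((hpm a).1 (by simp)).resolve_left hia.symm with rfl | rfl <;>
      rcases ((hpm b).1 (by simp)).resolve_left hib.symm with rfl | rfl
    · exact absurd rfl hab
    · exact hlab
    · exact hlab.swap₂₃
    · exact absurd rfl hab
  refine ⟨hli, hl, hil, hcover, hleft, ?_, j, k, hijk, hljk, hijl, hikl⟩
  intro a b hlab hai hbi
  obtain ⟨x, hxl, hxab, -, -⟩ := hlab.exists_edge h h3
  obtain ⟨hla, hlb, -⟩ := hlab.1
  have hix : i = x := by
    rcases hcover x a b hxab with (h1 | h1 | h1) | (h1 | h1 | h1)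
    · exact absurd h1.symm hxl
    · exact absurd h1 hla
    · exact absurd h1 hlb
    · exact h1
    · exact absurd h1.symm hai
    · exact absurd h1.symm hbi
  rw [hix]
  exact hxab

/-- A second partner `i'` would pass through the vertex in `simple_vertex` of the first. The edge of
`i` leaving `i'` there would end at a vertex on neither `l` nor `i'`. -/
theorem IsPartner.unique (h : IsSmooth L η κ) (h3 : finrank ℝ t = 3) {γ : ι → ℝ} {l i i' : ι}
    (hi : IsPartner η κ γ l i) (hi' : IsPartner η κ γ l i') : i = i' := by
  by_contra hne
  obtain ⟨j, k, hijk, hljk, hijl, hikl⟩ := hi.simple_vertex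
  obtain ⟨hlj, hlk, -⟩ := hljk.1
  have aux : ∀ {j}, IsVertex η κ i j i' → ¬ IsVertex η κ i j l → l ≠ j → False := by
    intro j hv hno hlj
    obtain ⟨x, hx, hxv, -, -⟩ := hv.rotate'.exists_edge h h3
    rcases hi'.cover x i j hxv with (h1 | h1 | h1) | (h1 | h1 | h1)
    · subst h1
      exact hno hxv.rotate
    · exact hi.ne h1.symm
    · exact hlj h1
    · exact hx h1.symm
    · exact hne h1.symm
    · exact hv.1.2.2 h1.symm
  rcases hi'.cover i j k hijk with (h1 | h1 | h1) | (h1 | h1 | h1)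
  · exact hi.ne h1.symm
  · exact hlj h1
  · exact hlk h1
  · exact hne h1.symm
  · subst h1
    exact aux hijk.swap₂₃ hikl hlk
  · subst h1
    exact aux hijk hijl hlj

end Classification

/-! ### Reflections exchanging partners. -/

section Partners

variable {t : Type*} [NormedAddCommGroup t] [NormedSpace ℝ t] [FiniteDimensional ℝ t]
variable {ι : Type*} [Fintype ι] {L : Submodule ℤ t} {η : ι → t} {κ : ι → ℝ}

omit [FiniteDimensional ℝ t] [Fintype ι] in
/-- If partners have a common vertex, then all the other coefficients vanish. -/
theorem IsPartner.eq_zero {γ : ι → ℝ} (hγ : IsBalanced η κ γ) {l i p : ι}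
    (hi : IsPartner η κ γ l i) (hp : IsVertex η κ i l p) {k : ι} (hki : k ≠ i) (hkl : k ≠ l) :
    γ k = 0 := by
  have hil := hi.ne
  obtain ⟨-, hip, hlp⟩ := hp.1
  -- In the four-facet relation for `n`, `i`, `l`, `p` the terms of `i` and `l` cancel: their
  -- coefficients are opposite and partners have the same neighbours.
  have aux : ∀ n, n ≠ i → n ≠ l → ¬ IsVertex η κ n i l → γ n = 0 := by
    intro n hni hnl hno
    have hnp : n ≠ p := by
      rintro rfl
      exact hno hp.rotate'
    have h1 := hγ.four_facets n i l p hni hnl hnp hil hip hlp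
    have h2 : vertexIndicator η κ n l p = vertexIndicator η κ n i p :=
      vertexIndicator_congr ⟨fun hv => (hi.right n p hv.swap₁₂ hni hip.symm).swap₁₂,
        fun hv => (hi.left n p hv.swap₁₂ hnl hlp.symm).swap₁₂⟩
    rw [vertexIndicator_of_isVertex hp, vertexIndicator_of_not hno, h2, hi.eq_neg] at h1
    linarith
  -- Both `j` and `j'` have coefficient zero by `aux`, and by `cover` their edge has no end other
  -- than `i` and `l`. The relation for `k`, `i`, `j`, `j'` then leaves `γ k` alone.
  obtain ⟨j, j', hij, hlj, hno, hno'⟩ := hi.simple_vertex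
  have hj := aux j hij.1.1.symm hlj.1.1.symm fun hv => hno hv.swap₁₂
  have hj' := aux j' hij.1.2.1.symm hlj.1.2.1.symm fun hv => hno' hv.swap₁₂
  by_cases hkj : k = j
  · rw [hkj, hj]
  by_cases hkj' : k = j'
  · rw [hkj', hj']
  have hnv : ¬ IsVertex η κ k j j' := fun hv => by
    rcases hi.cover _ _ _ hv with (h1 | h1 | h1) | (h1 | h1 | h1)
    · exact hkl h1.symm
    · exact hlj.1.1 h1
    · exact hlj.1.2.1 h1
    · exact hki h1.symm
    · exact hij.1.1 h1
    · exact hij.1.2.1 h1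
  have h1 := hγ.four_facets k i j j' hki hkj hkj' hij.1.1 hij.1.2.1 hij.1.2.2
  rw [vertexIndicator_of_isVertex hij, vertexIndicator_of_not hnv, hj, hj'] at h1
  linarith

/-- The reflecting functional `ξ` is dual to `η i` at the vertex in `simple_vertex`. It stays zero
on the remaining conormals along every edge of `i` off `l`, because the coefficient of `η i` in the
edge relation vanishes. The condition for that holds either because partners that meet leave no
other nonzero coefficients, or because they do not meet. -/
theorem IsPartner.facetEquiv (h : IsSmooth L η κ) (h3 : finrank ℝ t = 3) {γ : ι → ℝ}
    (hγ : IsBalanced η κ γ) {l i : ι} (hi : IsPartner η κ γ l i) : FacetEquiv L η κ i l := by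
  obtain ⟨j, k, hij, hlj, hno, hno'⟩ := hi.simple_vertex
  obtain ⟨ξ, hξi, hξj, hξk⟩ := hij.exists_dual h 1 0 0
  have hstep : ∀ {p r m}, IsVertex η κ p i r → IsVertex η κ m i r → l ≠ p → l ≠ r → l ≠ m →
      ξ (η p) = 0 → ξ (η r) = 0 → ξ (η m) = 0 := by
    intro p r m hp hm hlp hlr hlm h1 h2
    by_cases hmp : m = p
    · rwa [hmp]
    obtain ⟨q, q', hrel⟩ := hp.exists_relation h h3 hm hmp
    have hor : γ r = 0 ∨ ∀ n, ¬ IsVertex η κ i l n := by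
      by_cases hex : ∃ n, IsVertex η κ i l n
      · obtain ⟨n, hn⟩ := hex
        exact Or.inl (hi.eq_zero hγ hn hp.1.2.2.symm hlr.symm)
      · exact Or.inr (not_exists.1 hex)
    have hirl : ¬ IsVertex η κ i r l := fun hv => by
      rcases hp.end_eq h h3 hm hmp hv.rotate' with h4 | h4
      · exact hlp h4
      · exact hlm h4
    have hq := hγ.edge_coefficient i l r p m q q' hi.ne hlr.symm hp hm hmp hrel hirl hi.ne_zero hor
    rw [hrel]
    simp [h1, h2, hq]
  have hall : ∀ n, n ≠ i → n ≠ l → ξ (η n) = 0 := by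
    intro n hni hnl
    obtain ⟨a, b, hnab, ha, hb⟩ := h.exists_vertex_off h3 hnl
    have := h.off_facet_connected h3 l (fun w => ∀ a ∈ w, a ≠ i → ξ (η a) = 0) ?_ hij
      ⟨hi.ne.symm, hlj.1.1, hlj.1.2.1⟩ ?_ hnab ⟨hnl.symm, ha.symm, hb.symm⟩
    · exact this n (by simp) hni
    · intro p q r m hp hm hlp hlq hlr hlm hP x hx hxi
      have hPq := hP q (by simp)
      have hPr := hP r (by simp)
      rcases hx with rfl | rfl | rfl
      · rcases hi.cover _ _ _ hm with (h1 | h1 | h1) | (h1 | h1 | h1)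
        · exact absurd h1 hlm
        · exact absurd h1 hlq
        · exact absurd h1 hlr
        · exact absurd h1.symm hxi
        · subst h1
          exact hstep hp hm hlp hlr hlm (hP p (by simp) hp.1.1) (hPr hp.1.2.2.symm)
        · subst h1
          exact hstep hp.swap₂₃ hm.swap₂₃ hlp hlq hlm (hP p (by simp) hp.1.2.1) (hPq hp.1.2.2)
      · exact hPq hxi
      · exact hPr hxi
    · rintro x (rfl | rfl | rfl) hx
      · exact absurd rfl hx
      · exact hξj
      · exact hξk
  refine facetEquiv_of_dual (h.mem_lattice i) (h.mem_lattice l) (fun ζ hζ => ?_) hξi ?_ hall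
  · obtain ⟨p, q, r, rfl⟩ := hij.exists_int h h3 hζ
    exact ⟨p, by simp [hξi, hξj, hξk]⟩
  · obtain ⟨q, r, hrel⟩ := hij.exists_relation h h3 hlj hi.ne.symm
    rw [hrel]
    simp [hξi, hξj, hξk]

/-- Partners form an involution `σ` with `γ (σ l) = -γ l`, so `H` is half the sum of `γ l • (η l - η
(σ l))`, and each difference is inessential. -/
theorem isInessential_of_forall_isPartner (h : IsSmooth L η κ) (h3 : finrank ℝ t = 3) {γ : ι → ℝ}
    (hγ : IsBalanced η κ γ) (hp : ∀ l, γ l ≠ 0 → ∃ i, IsPartner η κ γ l i) :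
    IsInessential L η κ (∑ i, γ i • η i) := by
  have hex : ∀ l, ∃ i, (γ l ≠ 0 → IsPartner η κ γ l i) ∧ (γ l = 0 → i = l) := by
    intro l
    by_cases hl : γ l = 0
    · exact ⟨l, fun h' => absurd hl h', fun _ => rfl⟩
    · obtain ⟨i, hi⟩ := hp l hl
      exact ⟨i, fun _ => hi, fun h' => absurd h' hl⟩
  choose σ hσ hσ' using hex
  have hneg : ∀ l, γ (σ l) = -γ l := by
    intro l
    by_cases hl : γ l = 0
    · rw [hσ' l hl, hl, neg_zero]
    · exact (hσ l hl).eq_neg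
  have hinv : Function.Involutive σ := by
    intro l
    by_cases hl : γ l = 0
    · rw [hσ' l hl, hσ' l hl]
    · exact (hσ (σ l) (by rw [hneg]; exact neg_ne_zero.2 hl)).unique h h3 (hσ l hl).symm
  have hsum : ∑ l, γ l • η (σ l) = -∑ l, γ l • η l := by
    rw [← Equiv.sum_comp hinv.toPerm, ← Finset.sum_neg_distrib]
    refine Finset.sum_congr rfl fun l _ => ?_
    simp only [Function.Involutive.coe_toPerm]
    rw [hneg, hinv l, neg_smul]
  have hH : ∑ l, γ l • η l = ∑ l, (γ l / 2) • (η l - η (σ l)) := by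
    have : ∑ l, (γ l / 2) • (η l - η (σ l)) =
        (2⁻¹ : ℝ) • (∑ l, γ l • η l - ∑ l, γ l • η (σ l)) := by
      rw [← Finset.sum_sub_distrib, Finset.smul_sum]
      refine Finset.sum_congr rfl fun l _ => ?_
      rw [← smul_sub, smul_smul]
      congr 1
      ring
    rw [this, hsum]
    module
  rw [hH]
  refine IsInessential.sum _ fun l _ => IsInessential.smul _ ?_
  by_cases hl : γ l = 0
  · rw [hσ' l hl]
    exact (FacetEquiv.refl l).isInessential_sub
  · exact ((hσ l hl).facetEquiv h h3 hγ).symm.isInessential_sub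

end Partners

/-! ### Simplices and triangular prisms. -/

section Prisms

variable {t : Type*} [NormedAddCommGroup t] [NormedSpace ℝ t]
variable {ι : Type*} [Fintype ι] {L : Submodule ℤ t} {η : ι → t} {κ : ι → ℝ}

theorem isInessential_of_facetEquiv {γ : ι → ℝ} (i : ι) (hs : ∑ n, γ n = 0)
    (hi : ∀ n, γ n ≠ 0 → FacetEquiv L η κ n i) : IsInessential L η κ (∑ n, γ n • η n) := by
  have hH : ∑ n, γ n • η n = ∑ n, γ n • (η n - η i) := by
    simp only [smul_sub, Finset.sum_sub_distrib, ← Finset.sum_smul, hs, zero_smul, sub_zero]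
  rw [hH]
  refine IsInessential.sum _ fun n _ => ?_
  by_cases hn : γ n = 0
  · rw [hn, zero_smul]
    exact IsInessential.zero
  · exact IsInessential.smul _ (hi n hn).isInessential_sub

variable [FiniteDimensional ℝ t]

/-- If the ends of the edge `ij` off the facet `l` are connected to `l` by their other edges, then
all facets off `l` pass through ends of this edge. -/
theorem IsVertex.isVertex_of_edge (h : IsSmooth L η κ) (h3 : finrank ℝ t = 3) {i j k l : ι}
    (hv : IsVertex η κ i j k) (hl : l ≠ i ∧ l ≠ j ∧ l ≠ k)
    (hij : ∀ n, IsVertex η κ i j n → n ≠ l → IsVertex η κ l j n ∧ IsVertex η κ l i n) {n : ι}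
    (hni : n ≠ i) (hnj : n ≠ j) (hnl : n ≠ l) : IsVertex η κ i j n := by
  obtain ⟨a, b, hnab, ha, hb⟩ := h.exists_vertex_off h3 hnl
  have hconn := h.off_facet_connected h3 l (fun w => i ∈ w ∧ j ∈ w) ?_ hv hl (by simp) hnab
    ⟨hnl.symm, ha.symm, hb.symm⟩
  · obtain ⟨h1, h2⟩ := hconn
    rcases h1.resolve_left hni.symm with rfl | rfl <;>
      rcases h2.resolve_left hnj.symm with rfl | rfl
    · exact absurd rfl hv.1.1
    · exact hnab.rotate
    · exact hnab.rotate.swap₁₂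
    · exact absurd rfl hv.1.1
  · have aux : ∀ {i j q r m : ι}, (∀ n, IsVertex η κ i j n → n ≠ l → IsVertex η κ l j n) → l ≠ i →
        IsVertex η κ i q r → IsVertex η κ m q r → l ≠ q → l ≠ r → l ≠ m →
        j ∈ ({i, q, r} : Set ι) → i ≠ j → i = m := by
      intro i j q r m hij hli hp hm hlq hlr hlm hj hne
      rcases hj with rfl | rfl | rfl
      · exact absurd rfl hne
      · have h1 := hij r hp hlr.symm
        exact ((hp.end_eq h h3 h1 hli hm).resolve_right hlm.symm).symm
      · have h1 := hij q hp.swap₂₃ hlq.symm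
        exact ((hp.end_eq h h3 h1.swap₂₃ hli hm).resolve_right hlm.symm).symm
    rintro p q r m hp hm hlp hlq hlr hlm ⟨h1, h2⟩
    constructor
    · rcases h1 with rfl | h1
      · exact Or.inl (aux (fun n hn hnl => (hij n hn hnl).1) hl.1 hp hm hlq hlr hlm h2 hv.1.1)
      · exact Or.inr h1
    · rcases h2 with rfl | h2
      · exact Or.inl (aux (fun n hn hnl => (hij n hn.swap₁₂ hnl).2) hl.2.1 hp hm hlq hlr hlm h1
          hv.1.1.symm)
      · exact Or.inr h2

/-- The triangular prism in which the facets `k` and `m` are triangles and the conormals of the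
other three facets sum to zero. -/
structure IsBundle (η : ι → t) (κ : ι → ℝ) (i j k l m : ι) : Prop where
  cover : ∀ n, n = i ∨ n = j ∨ n = k ∨ n = l ∨ n = m
  ne_m : m ≠ i ∧ m ≠ j ∧ m ≠ k ∧ m ≠ l
  vertex₁ : IsVertex η κ i j k
  vertex₂ : IsVertex η κ l j k
  vertex₃ : IsVertex η κ l i k
  eq_l : η l = -η i - η j
  eq_m : ∃ α β : ℤ, η m = -η k + (α : ℝ) • η i + (β : ℝ) • η j

/-- The conormals of the three facets which with `k` bound a triangle. -/
theorem IsVertex.triangle_relation (h : IsSmooth L η κ) (h3 : finrank ℝ t = 3) {i j k l : ι}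
    (hijk : IsVertex η κ i j k) (hljk : IsVertex η κ l j k) (hlik : IsVertex η κ l i k) :
    ∃ r : ℤ, η l = -η i - η j + (r : ℝ) • η k := by
  have hli := hlik.1.1
  have hlj := hljk.1.1
  obtain ⟨q, r, hq⟩ := hijk.exists_relation h h3 hljk hli
  obtain ⟨q', r', hq'⟩ := hijk.swap₁₂.exists_relation h h3 hlik hlj
  have h0 : ((-1 : ℝ) - q') • η i + ((q : ℝ) - (-1)) • η j + ((r : ℝ) - r') • η k = 0 := by
    have : η l - η l = 0 := sub_self _
    nth_rewrite 1 [hq] at this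
    rw [hq'] at this
    rw [← this]
    module
  have h1 := (hijk.eq_zero_of_smul h h0).2.1
  refine ⟨r, ?_⟩
  have h2 : (q : ℝ) = -1 := by linarith
  rw [hq, h2]
  module

theorem IsVertex.facetEquiv (h : IsSmooth L η κ) (h3 : finrank ℝ t = 3) {i j k : ι}
    (hijk : IsVertex η κ i j k) (hn : ∀ ξ : StrongDual ℝ t, ξ (η i) = 1 → ξ (η j) = -1 →
      ξ (η k) = 0 → ∀ n, n ≠ i → n ≠ j → ξ (η n) = 0) : FacetEquiv L η κ i j := by
  obtain ⟨ξ, h1, h2, h4⟩ := hijk.exists_dual h 1 (-1) 0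
  refine facetEquiv_of_dual (h.mem_lattice i) (h.mem_lattice j) (fun ζ hζ => ?_) h1 h2
    (hn ξ h1 h2 h4)
  obtain ⟨p, q, r, rfl⟩ := hijk.exists_int h h3 hζ
  exact ⟨p - q, by simp [h1, h2, h4]; ring⟩

/-- There are no further facets and the four conormals sum to zero, so any two facets are exchanged
by a reflection; the four-facet relation says that the coefficients sum to zero. -/
theorem isInessential_of_simplex (h : IsSmooth L η κ) (h3 : finrank ℝ t = 3) {γ : ι → ℝ}
    (hγ : IsBalanced η κ γ) {i j k l : ι} (hijk : IsVertex η κ i j k) (hljk : IsVertex η κ l j k)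
    (hlik : IsVertex η κ l i k) (hlij : IsVertex η κ l i j) :
    IsInessential L η κ (∑ n, γ n • η n) := by
  classical
  obtain ⟨hij, hik, hjk⟩ := hijk.1
  obtain ⟨hli, hlj, -⟩ := hlij.1
  have hlk := hlik.1.2.1
  have hcov : ∀ n, n = i ∨ n = j ∨ n = k ∨ n = l := by
    by_contra! hex
    obtain ⟨n, hni, hnj, hnk, hnl⟩ := hex
    have hends : ∀ n, IsVertex η κ i j n → n = k ∨ n = l := fun n hn =>
      hijk.rotate'.end_eq h h3 hlij hlk hn.rotate'
    have := hijk.isVertex_of_edge h h3 ⟨hli, hlj, hlk⟩ (fun n hn hnl => by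
      rcases hends n hn with rfl | rfl
      · exact ⟨hljk, hlik⟩
      · exact absurd rfl hnl) hni hnj hnl
    rcases hends n this with h1 | h1
    · exact hnk h1
    · exact hnl h1
  have huniv : (Finset.univ : Finset ι) = {i, j, k, l} := by
    ext n
    simpa using hcov n
  obtain ⟨r, hr⟩ := hijk.triangle_relation h h3 hljk hlik
  obtain ⟨q, hq⟩ := hijk.swap₂₃.triangle_relation h h3 hljk.swap₂₃ hlij
  have hl : η l = -η i - η j - η k := by
    have h0 : (0 : ℝ) • η i + ((-1 : ℝ) - q) • η j + ((r : ℝ) - (-1)) • η k = 0 := by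
      have : η l - η l = 0 := sub_self _
      nth_rewrite 1 [hr] at this
      rw [hq] at this
      rw [← this]
      module
    have h1 := (hijk.eq_zero_of_smul h h0).2.2
    have h2 : (r : ℝ) = -1 := by linarith
    rw [hr, h2]
    module
  refine isInessential_of_facetEquiv i ?_ fun n _ => ?_
  · have h1 := hγ.four_facets i j k l hij hik hli.symm hjk hlj.symm hlk.symm
    rw [vertexIndicator_of_isVertex hljk.rotate, vertexIndicator_of_isVertex hlik.rotate,
      vertexIndicator_of_isVertex hlij.rotate, vertexIndicator_of_isVertex hijk] at h1
    rw [huniv, Finset.sum_insert (by simp [hij, hik, hli.symm]),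
      Finset.sum_insert (by simp [hjk, hlj.symm]), Finset.sum_pair hlk.symm]
    linarith
  · rcases hcov n with rfl | rfl | rfl | rfl
    · exact FacetEquiv.refl _
    · refine FacetEquiv.symm (hijk.facetEquiv h h3 fun ξ h1 h2 h4 n' hn hn' => ?_)
      rcases hcov n' with rfl | rfl | rfl | rfl <;>
        first | exact absurd rfl hn | exact absurd rfl hn' | assumption | simp [hl, h1, h2, h4]
    · refine FacetEquiv.symm (hijk.swap₂₃.facetEquiv h h3 fun ξ h1 h2 h4 n' hn hn' => ?_)
      rcases hcov n' with rfl | rfl | rfl | rfl <;>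
        first | exact absurd rfl hn | exact absurd rfl hn' | assumption | simp [hl, h1, h2, h4]
    · refine FacetEquiv.symm (hlij.swap₁₂.facetEquiv h h3 fun ξ h1 h2 h4 n' hn hn' => ?_)
      have h5 : ξ (η k) = 0 := by
        have : η k = -η i - η j - η n := by rw [hl]; module
        simp [this, h1, h2, h4]
      rcases hcov n' with rfl | rfl | rfl | rfl <;>
        first | exact absurd rfl hn | exact absurd rfl hn' | assumption

/-- A mass linear function in dimension three is inessential or the polytope is a bundle of
triangles over a segment. -/
theorem IsBalanced.isInessential_or_isBundle (h : IsSmooth L η κ) (h3 : finrank ℝ t = 3)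
    {γ : ι → ℝ} (hγ : IsBalanced η κ γ) :
    IsInessential L η κ (∑ n, γ n • η n) ∨ ∃ i j k l m, IsBundle η κ i j k l m := by
  classical
  by_cases hp : ∀ l, γ l ≠ 0 → ∃ i, IsPartner η κ γ l i
  · exact Or.inl (isInessential_of_forall_isPartner h h3 hγ hp)
  push Not at hp
  obtain ⟨l, hl, hnp⟩ := hp
  -- Follow an edge leaving `l`. Since `l` has no partner, a second edge at its far end also leads
  -- to `l`; these edges bound a triangular facet `k`.
  obtain ⟨i, j, k, hijk, hljk, hlik, hli⟩ : ∃ i j k, IsVertex η κ i j k ∧ IsVertex η κ l j k ∧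
      IsVertex η κ l i k ∧ i ≠ l := by
    obtain ⟨j, k, hljk⟩ := h.exists_isVertex h3 l
    obtain ⟨i, hil, hijk, -, -⟩ := hljk.exists_edge h h3
    by_cases h1 : IsVertex η κ i k l
    · exact ⟨i, j, k, hijk, hljk, h1.rotate', hil⟩
    by_cases h2 : IsVertex η κ i j l
    · exact ⟨i, k, j, hijk.swap₂₃, hljk.swap₂₃, h2.rotate', hil⟩
    exact absurd (hγ.isPartner h h3 hl hijk hil hljk h2 h1) (hnp i)
  by_cases hlij : IsVertex η κ l i j
  · exact Or.inl (isInessential_of_simplex h h3 hγ hijk hljk hlik hlij)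
  have hijl : ¬ IsVertex η κ i j l := fun hv => hlij hv.rotate'
  obtain ⟨hij, hik, hjk⟩ := hijk.1
  obtain ⟨hlj, hlk, -⟩ := hljk.1
  obtain ⟨m, hmk, hmij, -, -⟩ := hijk.rotate'.exists_edge h h3
  obtain ⟨hmi, hmj, -⟩ := hmij.1
  have hml : m ≠ l := by
    rintro rfl
    exact hlij hmij
  -- The four-facet relation excludes that neither is a vertex. If exactly one were, only one edge
  -- at the vertex of `i`, `j`, `m` would lead to `l`, and `l` would have a partner.
  have hboth : IsVertex η κ j m l ∧ IsVertex η κ i m l := by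
    have h1 := hγ.four_facets i j m l hij hmi.symm hli hmj.symm hlj.symm hml
    rw [vertexIndicator_of_not hijl, vertexIndicator_of_isVertex hmij.rotate] at h1
    by_cases h2 : IsVertex η κ j m l <;> by_cases h4 : IsVertex η κ i m l
    · exact ⟨h2, h4⟩
    · exact absurd (hγ.isPartner h h3 hl hmij.rotate hli h2.rotate' hijl h4) (hnp i)
    · exact absurd (hγ.isPartner h h3 hl hmij.swap₁₃ hlj.symm h4.rotate' (fun hv => hijl hv.swap₁₂)
        h2) (hnp j)
    · rw [vertexIndicator_of_not h2, vertexIndicator_of_not h4] at h1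
      exact absurd (by linarith) hl
  obtain ⟨hjml, himl⟩ := hboth
  have hljm := hjml.rotate'
  have hlim := himl.rotate'
  have hends : ∀ n, IsVertex η κ i j n → n = k ∨ n = m := fun n hn =>
    hijk.rotate'.end_eq h h3 hmij hmk hn.rotate'
  have hcov : ∀ n, n = i ∨ n = j ∨ n = k ∨ n = l ∨ n = m := by
    by_contra! hex
    obtain ⟨n, hni, hnj, hnk, hnl, hnm⟩ := hex
    have := hijk.isVertex_of_edge h h3 ⟨hli.symm, hlj, hlk⟩ (fun n hn hnl => by
      rcases hends n hn with rfl | rfl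
      · exact ⟨hljk, hlik⟩
      · exact ⟨hljm, hlim⟩) hni hnj hnl
    rcases hends n this with h1 | h1
    · exact hnk h1
    · exact hnm h1
  obtain ⟨α, β, hm⟩ := hijk.rotate'.exists_relation h h3 hmij hmk
  obtain ⟨r, hr⟩ := hijk.triangle_relation h h3 hljk hlik
  -- The polytope is now a prism with triangles `k` and `m`, and `r` is the obstruction to its being
  -- a bundle over a segment.
  by_cases hr0 : (r : ℝ) = 0
  · refine Or.inr ⟨i, j, k, l, m, hcov, ⟨hmi, hmj, hmk, hml⟩, hijk, hljk, hlik, ?_, α, β, hm⟩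
    rw [hr, hr0]
    module
  left
  obtain ⟨s, hs⟩ := hmij.rotate.triangle_relation h h3 hljm hlim
  have hjkm : ¬ IsVertex η κ m j k := fun hv => by
    rcases hijk.end_eq h h3 hljk hli.symm hv with h1 | h1
    · exact hmi h1
    · exact hml h1
  have hikm : ¬ IsVertex η κ m i k := fun hv => by
    rcases hijk.swap₁₂.end_eq h h3 hlik hlj hv with h1 | h1
    · exact hmj h1
    · exact hml h1
  have hlkm : ¬ IsVertex η κ m l k := fun hv => by
    rcases hlik.swap₁₂.end_eq h h3 hljk.swap₁₂ hij.symm hv with h1 | h1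
    · exact hmi h1
    · exact hmj h1
  have hkm : ∀ n, ¬ IsVertex η κ k m n := by
    intro n hv
    rcases hcov n with rfl | rfl | rfl | rfl | rfl
    · exact hikm hv.rotate
    · exact hjkm hv.rotate
    · exact hv.1.2.1 rfl
    · exact hlkm hv.rotate
    · exact hv.1.2.2 rfl
  -- The triangles do not meet, and `r` is the coefficient of `η k` along the edge of `j` and `k`; a
  -- nonzero `γ m` would make it vanish.
  have hγm : γ m = 0 := by
    by_contra hγm
    exact hr0 (hγ.edge_coefficient k m j i l r (-1) hmk.symm hmj.symm hijk.swap₂₃ hljk.swap₂₃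
      hli.symm (by rw [hr]; module) (fun hv => hkm j hv.swap₂₃) hγm (Or.inr hkm))
  have hγk : γ k = 0 := by
    have h1 := hγ.four_facets k m i j hmk.symm hik.symm hjk.symm hmi hmj hij
    rw [vertexIndicator_of_isVertex hmij, vertexIndicator_of_not (hkm j),
      vertexIndicator_of_not (hkm i), hγm] at h1
    linarith
  -- The triangle relations at `k` and at `m` give `r • η k = s • η m`, with `r ≠ 0`.
  have hηm : η m = -η k := by
    have h0 : ((s : ℝ) * α) • η i + ((s : ℝ) * β) • η j + (-(s : ℝ) - r) • η k = 0 := by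
      have : η l - η l = 0 := sub_self _
      nth_rewrite 1 [hs] at this
      rw [hr, hm] at this
      rw [← this]
      module
    obtain ⟨h1, h2, h4⟩ := hijk.eq_zero_of_smul h h0
    have hs0 : (s : ℝ) ≠ 0 := fun h5 => hr0 (by rw [h5] at h4; linarith)
    rw [hm, (mul_eq_zero.1 h1).resolve_left hs0, (mul_eq_zero.1 h2).resolve_left hs0]
    module
  have huniv : (Finset.univ : Finset ι) = {i, j, k, l, m} := by
    ext n
    simpa using hcov n
  -- Only `i`, `j`, `l` can have nonzero coefficients. A functional vanishing on `η k` also vanishes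
  -- on `η m = -η k`, so reflections exchange these three sides.
  refine isInessential_of_facetEquiv i ?_ fun n hn => ?_
  · have h1 := hγ.four_facets i j l k hij hli hik hlj.symm hjk hlk
    rw [vertexIndicator_of_isVertex hljk.swap₁₂, vertexIndicator_of_isVertex hlik.swap₁₂,
      vertexIndicator_of_isVertex hijk, hγk] at h1
    rw [huniv, Finset.sum_insert (by simp [hij, hik, hli, hmi.symm]),
      Finset.sum_insert (by simp [hjk, hlj.symm, hmj.symm]),
      Finset.sum_insert (by simp [hlk.symm, hmk.symm]), Finset.sum_pair hml.symm, hγk, hγm]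
    linarith
  · rcases hcov n with rfl | rfl | rfl | rfl | rfl
    · exact FacetEquiv.refl _
    · refine FacetEquiv.symm (hijk.facetEquiv h h3 fun ξ h1 h2 h4 n' hn1 hn2 => ?_)
      rcases hcov n' with rfl | rfl | rfl | rfl | rfl <;>
        first | exact absurd rfl hn1 | exact absurd rfl hn2 | assumption |
          simp [hηm, hr, h1, h2, h4]
    · exact absurd hγk hn
    · refine FacetEquiv.symm (hlik.swap₁₂.facetEquiv h h3 fun ξ h1 h2 h4 n' hn1 hn2 => ?_)
      have h5 : ξ (η j) = 0 := by
        have : η j = -η i - η n + (r : ℝ) • η k := by rw [hr]; module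
        simp [this, h1, h2, h4]
      rcases hcov n' with rfl | rfl | rfl | rfl | rfl <;>
        first | exact absurd rfl hn1 | exact absurd rfl hn2 | assumption |
          simp [hηm, h4]
    · exact absurd hγm hn

end Prisms

/-! ### The standard lattice and its dual. -/

theorem single_mem_latticeZ3 (i : Fin 3) : (Pi.single i 1 : Fin 3 → ℝ) ∈ latticeZ3 :=
  Submodule.subset_span ⟨i, rfl⟩

theorem mem_latticeZ3_iff {v : Fin 3 → ℝ} : v ∈ latticeZ3 ↔ ∀ i, ∃ m : ℤ, v i = m := by
  constructor
  · intro hv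
    induction hv using Submodule.span_induction with
    | mem x hx =>
      obtain ⟨j, rfl⟩ := hx
      intro i
      by_cases hij : i = j
      · exact ⟨1, by simp [hij]⟩
      · exact ⟨0, by simp [hij]⟩
    | zero => exact fun i => ⟨0, by simp⟩
    | add x y _ _ hx hy =>
      intro i
      obtain ⟨p, hp⟩ := hx i
      obtain ⟨q, hq⟩ := hy i
      exact ⟨p + q, by simp [hp, hq]⟩
    | smul c x _ hx =>
      intro i
      obtain ⟨p, hp⟩ := hx i
      exact ⟨c * p, by simp [hp]⟩
  · intro hv
    choose m hm using hv
    have : v = ∑ i, m i • (Pi.single i 1 : Fin 3 → ℝ) := by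
      ext i
      simp [Finset.sum_apply, Pi.single_apply, hm]
    rw [this]
    exact Submodule.sum_mem _ fun i _ => Submodule.smul_mem _ _ (single_mem_latticeZ3 i)

theorem mem_dualLattice_latticeZ3_iff {x : StrongDual ℝ (Fin 3 → ℝ)} :
    x ∈ dualLattice latticeZ3 ↔ ∀ i, ∃ m : ℤ, x (Pi.single i 1) = m := by
  refine ⟨fun hx i => hx _ (single_mem_latticeZ3 i), fun hx ζ hζ => ?_⟩
  choose m hm using hx
  choose p hp using mem_latticeZ3_iff.1 hζ
  refine ⟨∑ i, p i * m i, ?_⟩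
  have : ζ = ∑ i, ζ i • (Pi.single i 1 : Fin 3 → ℝ) := by
    ext i
    simp [Finset.sum_apply, Pi.single_apply]
  rw [this]
  simp [hm, hp]

theorem exists_strict_of_isSmooth {t : Type*} [NormedAddCommGroup t] [NormedSpace ℝ t]
    [FiniteDimensional ℝ t] {ι : Type*} [Fintype ι] {L : Submodule ℤ t} {η : ι → t} {κ : ι → ℝ}
    (h : IsSmooth L η κ) : ∃ y : StrongDual ℝ t, ∀ i, y (η i) < κ i := by
  obtain ⟨x, hx⟩ := h.isNondegenerate.nonempty
  obtain ⟨y, -, hy⟩ := h.isNondegenerate.exists_active_eq hx (I := ∅) (by simp)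
  exact ⟨y, fun i => hy i (by simp)⟩

/-! ### Bundles of triangles as polytopes `Y_a`; part (1). -/

section Bundles

variable {t : Type*} [NormedAddCommGroup t] [NormedSpace ℝ t] [FiniteDimensional ℝ t]
variable {ι : Type*} [Fintype ι] {L : Submodule ℤ t} {η : ι → t} {κ : ι → ℝ}

theorem IsVertex.exists_lt (h : IsSmooth L η κ) (h3 : finrank ℝ t = 3) {i j k m : ι}
    (hv : IsVertex η κ i j k) (hm : m ≠ i ∧ m ≠ j ∧ m ≠ k) :
    ∃ x : StrongDual ℝ t, x (η i) = κ i ∧ x (η j) = κ j ∧ x (η k) = κ k ∧ x (η m) < κ m := by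
  obtain ⟨hne, x, hx, hi, hj, hk⟩ := hv
  refine ⟨x, hi, hj, hk, (hx m).lt_of_ne fun hxm => ?_⟩
  have : m ∈ ({i, j, k} : Set ι) := by
    rw [← (h.active_eq h3 hne hx hi hj hk).1]
    exact hxm
  rcases this with h1 | h1 | h1
  exacts [hm.1 h1, hm.2.1 h1, hm.2.2 h1]

/-- A bundle of triangles over a segment is one of the polytopes `Y_a`. -/
theorem IsBundle.affineEquivalent (h : IsSmooth L η κ) (h3 : finrank ℝ t = 3) {i j k l m : ι}
    (hb : IsBundle η κ i j k l m) :
    ∃ a : Fin 2 → ℤ, ∃ κ' ∈ chamberY (fun i => (a i : ℝ)),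
      AffineEquivalent L latticeZ3 (polytope η κ)
        (polytope (conormalY fun i => (a i : ℝ)) κ') := by
  obtain ⟨α, β, hm⟩ := hb.eq_m
  have hl := hb.eq_l
  have hcov := hb.cover
  -- The standard basis corresponds to `-η i`, `-η j`, `-η k`, whence the signs in `a`; the facets
  -- are listed in the order of `conormalY`, the three sides before the two triangles.
  refine ⟨![-α, -β], ![κ i, κ j, κ l, κ k, κ m], ?_, ?_⟩
  · obtain ⟨y, hy⟩ := exists_strict_of_isSmooth h
    -- The three corners of the triangle `k` lie strictly inside the half-space of `m`; the
    -- resulting inequalities are the three cases of the maximum in `chamberY`.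
    obtain ⟨x₁, h1i, h1j, h1k, h1m⟩ := hb.vertex₁.exists_lt h h3
      ⟨hb.ne_m.1, hb.ne_m.2.1, hb.ne_m.2.2.1⟩
    obtain ⟨x₂, h2l, h2j, h2k, h2m⟩ := hb.vertex₂.exists_lt h h3
      ⟨hb.ne_m.2.2.2, hb.ne_m.2.1, hb.ne_m.2.2.1⟩
    obtain ⟨x₃, h3l, h3i, h3k, h3m⟩ := hb.vertex₃.exists_lt h h3
      ⟨hb.ne_m.2.2.2, hb.ne_m.1, hb.ne_m.2.2.1⟩
    have hK : 0 < κ i + κ j + κ l := by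
      have h4 := hy i
      have h5 := hy j
      have h6 := hy l
      rw [hl] at h6
      simp only [map_sub, map_neg] at h6
      linarith
    rw [hm] at h1m h2m h3m
    rw [hl] at h2l h3l
    simp only [map_sub, map_neg, map_add, map_smul, smul_eq_mul] at h1m h2m h3m h2l h3l
    have h2i : x₂ (η i) = -κ l - κ j := by linarith
    have h3j : x₃ (η j) = -κ l - κ i := by linarith
    rw [h1i, h1j, h1k] at h1m
    rw [h2i, h2j, h2k] at h2m
    rw [h3j, h3i, h3k] at h3m
    refine ⟨by simpa using hK, ?_⟩
    simp only [Matrix.cons_val]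
    push_cast
    rcases max_choice (0 : ℝ) (max (-(α : ℝ)) (-(β : ℝ))) with h4 | h4
    · rw [h4]
      linarith
    · rw [h4]
      rcases max_choice (-(α : ℝ)) (-(β : ℝ)) with h5 | h5
      · rw [h5]
        linarith
      · rw [h5]
        linarith
  · have hli := hb.vertex₁.linearIndependent h
    let b : Basis (Fin 3) ℝ t := basisOfLinearIndependentOfCardEqFinrank hli (by simp [h3])
    have hbv : ∀ p, b p = ![η i, η j, η k] p := fun p => by
      simp [b]
    let e : (Fin 3 → ℝ) ≃L[ℝ] t :=
      ((LinearEquiv.neg ℝ).trans b.equivFun.symm).toContinuousLinearEquiv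
    have he : ∀ v : Fin 3 → ℝ, e v = -(v 0 • η i) - v 1 • η j - v 2 • η k := fun v => by
      simp [e, Basis.equivFun_symm_apply, Fin.sum_univ_three, hbv]
      module
    let f : StrongDual ℝ t ≃ₗ[ℝ] StrongDual ℝ (Fin 3 → ℝ) :=
      (e.symm.arrowCongr (ContinuousLinearEquiv.refl ℝ ℝ)).toLinearEquiv
    have hf : ∀ x v, f x v = -(v 0 * x (η i)) - v 1 * x (η j) - v 2 * x (η k) := fun x v => by
      have : f x v = x (e v) := rfl
      rw [this, he]
      simp
    have hc : ∀ x, ∀ p, f x (conormalY (fun n => ((![-α, -β] : Fin 2 → ℤ) n : ℝ)) p) =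
        x (η (![i, j, l, k, m] p)) := by
      intro x p
      rw [hf]
      fin_cases p <;> simp [conormalY, hl, hm]
      ring
    refine ⟨f.toAffineEquiv, ?_, ?_⟩
    · have : ∀ x, x ∈ polytope η κ ↔ f x ∈ polytope
          (conormalY fun n => ((![-α, -β] : Fin 2 → ℤ) n : ℝ)) ![κ i, κ j, κ l, κ k, κ m] := by
        intro x
        constructor
        · intro hx p
          rw [hc]
          fin_cases p <;> exact hx _
        · intro hx n
          rcases hcov n with rfl | rfl | rfl | rfl | rfl
          · have := hx 0
            rwa [hc] at this
          · have := hx 1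
            rwa [hc] at this
          · have := hx 3
            rwa [hc] at this
          · have := hx 2
            rwa [hc] at this
          · have := hx 4
            rwa [hc] at this
      ext y
      constructor
      · rintro ⟨x, hx, rfl⟩
        exact (this x).1 hx
      · intro hy
        refine ⟨f.symm y, (this _).2 ?_, f.apply_symm_apply y⟩
        rwa [f.apply_symm_apply]
    · have hdual : ∀ x, x ∈ dualLattice L ↔ f x ∈ dualLattice latticeZ3 := by
        intro x
        rw [mem_dualLattice_latticeZ3_iff]
        constructor
        · intro hx p
          obtain ⟨q₁, h1⟩ := hx _ (h.mem_lattice i)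
          obtain ⟨q₂, h2⟩ := hx _ (h.mem_lattice j)
          obtain ⟨q₃, h4⟩ := hx _ (h.mem_lattice k)
          refine ⟨![-q₁, -q₂, -q₃] p, ?_⟩
          rw [hf, h1, h2, h4]
          fin_cases p <;> simp
        · intro hx ζ hζ
          obtain ⟨q₁, h1⟩ := hx 0
          obtain ⟨q₂, h2⟩ := hx 1
          obtain ⟨q₃, h4⟩ := hx 2
          rw [hf] at h1 h2 h4
          simp at h1 h2 h4
          obtain ⟨p, q, r, rfl⟩ := hb.vertex₁.exists_int h h3 hζ
          have h5 : x (η i) = -q₁ := by linarith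
          have h6 : x (η j) = -q₂ := by linarith
          have h7 : x (η k) = -q₃ := by linarith
          exact ⟨-p * q₁ - q * q₂ - r * q₃, by simp [h5, h6, h7]; ring⟩
      ext y
      constructor
      · rintro ⟨x, hx, rfl⟩
        exact (hdual x).1 hx
      · intro hy
        refine ⟨f.symm y, (hdual _).2 ?_, f.apply_symm_apply y⟩
        rwa [f.apply_symm_apply]

theorem IsSmooth.affineEquivalent_of_hasEssentialMassLinear (h : IsSmooth L η κ)
    (h3 : finrank ℝ t = 3) (hess : HasEssentialMassLinear L η κ) :
    ∃ a : Fin 2 → ℤ, ∃ κ' ∈ chamberY (fun i => (a i : ℝ)),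
      AffineEquivalent L latticeZ3 (polytope η κ)
        (polytope (conormalY fun i => (a i : ℝ)) κ') := by
  classical
  obtain ⟨H, ⟨γ, C, hH⟩, hne⟩ := hess
  have hH : IsMassLinearWith η κ H γ C := hH
  obtain ⟨ρ, c, hρ⟩ := h.exists_isRegularRadius h3
  rcases (hH.isBalanced h h3).isInessential_or_isBundle h h3 with h1 | ⟨i, j, k, l, m, hb⟩
  · rw [← hH.eq_sum h hρ] at h1
    exact absurd h1 hne
  · exact hb.affineEquivalent h h3

end Bundles

/-! ### Equivalent facets and the center of mass. -/

section Centers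

variable {t : Type*} [NormedAddCommGroup t] [NormedSpace ℝ t] [FiniteDimensional ℝ t]
variable {ι : Type*} [Fintype ι] {L : Submodule ℤ t} {η : ι → t} {κ : ι → ℝ}

omit [FiniteDimensional ℝ t] in
theorem affineEquiv_apply_eq (a : StrongDual ℝ t ≃ᵃ[ℝ] StrongDual ℝ t) (x : StrongDual ℝ t) :
    a x = a.linear x + a 0 := by
  have := a.map_vadd 0 x
  simpa using this

/-- A symmetry that takes a facet to another one takes the lattice distance from the first facet to
that from the second one. -/
theorem IsSymmetry.distance_eq (h : IsNondegenerate η κ)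
    {a : StrongDual ℝ t ≃ᵃ[ℝ] StrongDual ℝ t} (ha : IsSymmetry L (polytope η κ) a) {i j : ι}
    (hi : η i ∈ L) (hj : η j ∈ L) (hξi : ∃ ξ ∈ dualLattice L, ξ (η i) = 1)
    (hξj : ∃ ξ ∈ dualLattice L, ξ (η j) = 1) (hF : a '' facet η κ i = facet η κ j)
    (x : StrongDual ℝ t) : κ j - (a x) (η j) = κ i - x (η i) := by
  obtain ⟨y₀, hy₀, hy₀i⟩ := h.facet_nonempty i
  have hy₀i : y₀ (η i) = κ i := hy₀i
  obtain ⟨y, hyi, hylt⟩ := h.exists_active_eq hy₀ (I := {i}) (by simpa using hy₀i)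
  have hyi : y (η i) = κ i := hyi i rfl
  have hyP : y ∈ polytope η κ := fun n => by
    by_cases hn : n = i
    · rw [hn, hyi]
    · exact (hylt n hn).le
  have hface : ∀ z ∈ polytope η κ, z (η i) = κ i → (a z) (η j) = κ j := fun z hz hzi => by
    have : a z ∈ facet η κ j := hF ▸ mem_image_of_mem a ⟨hz, hzi⟩
    exact this.2
  -- Directions tangent to `F i` at a point on no other facet are taken to directions tangent to `F
  -- j`. Hence the distance to `F j` after the symmetry is a fixed multiple `r` of the distance to
  -- `F i` before it.
  have hker : ∀ w : StrongDual ℝ t, w (η i) = 0 → (a.linear w) (η j) = 0 := by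
    intro w hw
    have h1 := eventually_add_smul_mem (w := w) hyP fun n hn => by
      by_cases hni : n = i
      · rw [hni, hw]
      · exact absurd hn (hylt n hni).ne
    obtain ⟨ε, hε, hpos⟩ := (h1.and self_mem_nhdsWithin).exists
    have hpos : 0 < ε := hpos
    have h2 := hface _ hε (by simp [hw, hyi])
    have h3 := hface _ hyP hyi
    rw [affineEquiv_apply_eq] at h2 h3
    simp only [map_add, map_smul, add_apply, FunLike.coe_smul, Pi.smul_apply, smul_eq_mul]
      at h2 h3
    have h4 : ε * (a.linear w) (η j) = 0 := by linarith
    exact (mul_eq_zero.1 h4).resolve_left hpos.ne'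
  obtain ⟨ξ, hξL, hξ⟩ := hξi
  set r := (a.linear ξ) (η j) with hr
  have hlin : ∀ w : StrongDual ℝ t, (a.linear w) (η j) = r * w (η i) := by
    intro w
    have h1 := hker (w - w (η i) • ξ) (by simp [hξ])
    simp only [map_sub, map_smul, sub_apply, FunLike.coe_smul, Pi.smul_apply, smul_eq_mul] at h1
    rw [← hr] at h1
    linarith
  have hdist : ∀ z, κ j - (a z) (η j) = r * (κ i - z (η i)) := by
    intro z
    have h1 := hface y hyP hyi
    have h2 := hlin (y - z)
    rw [affineEquiv_apply_eq] at h1 ⊢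
    simp only [map_sub, sub_apply, add_apply] at h1 h2 ⊢
    rw [hyi] at h2
    linarith
  obtain ⟨z, -, hz⟩ := h.exists_active_eq hyP (I := ∅) (by simp)
  have hz : ∀ n, z (η n) < κ n := fun n => hz n (by simp)
  have hr0 : 0 ≤ r := by
    have h1 : a z ∈ polytope η κ := ha.1 ▸ mem_image_of_mem a fun n => (hz n).le
    have h2 := hdist z
    by_contra hneg
    have h3 := mul_neg_of_neg_of_pos (not_le.1 hneg) (sub_pos.2 (hz i))
    have h4 := h1 j
    linarith
  -- The linear part and its inverse preserve the lattice, and both conormals take the value `1` on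
  -- it, so `r` is an invertible integer; being nonnegative, it is `1`.
  obtain ⟨p, hp⟩ : ∃ p : ℤ, r = p :=
    (ha.2 ▸ mem_image_of_mem a.linear hξL : a.linear ξ ∈ dualLattice L) _ hj
  obtain ⟨ζ, hζL, hζ⟩ := hξj
  obtain ⟨w, hwL, rfl⟩ : ζ ∈ a.linear '' dualLattice L := ha.2.symm ▸ hζL
  obtain ⟨q, hq⟩ := hwL _ hi
  have hpq : p * q = 1 := by
    have := hlin w
    have hζ : (a.linear w) (η j) = 1 := hζ
    rw [hζ, hp, hq] at this
    exact_mod_cast this.symm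
  have hp1 : p = 1 := by
    rcases Int.mul_eq_one_iff_eq_one_or_neg_one.1 hpq with h1 | h1
    · exact h1.1
    · rw [hp, h1.1] at hr0
      norm_num at hr0
  rw [hdist, hp, hp1]
  simp

/-- A map of `Δ` onto itself preserves the volume of `Δ`, which is positive, so the determinant has
absolute value `1`. -/
theorem IsSymmetry.integral_comp {Δ : Set (StrongDual ℝ t)} (hΔ : MeasurableSet Δ)
    (hpos : 0 < ∫ _ in Δ, (1 : ℝ) ∂(Measure.addHaar : Measure (StrongDual ℝ t)))
    {a : StrongDual ℝ t ≃ᵃ[ℝ] StrongDual ℝ t} (ha : IsSymmetry L Δ a) (g : StrongDual ℝ t → ℝ) :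
    ∫ x in Δ, g (a x) ∂(Measure.addHaar : Measure (StrongDual ℝ t)) =
      ∫ x in Δ, g x ∂(Measure.addHaar : Measure (StrongDual ℝ t)) := by
  set A : StrongDual ℝ t →L[ℝ] StrongDual ℝ t :=
    LinearMap.toContinuousLinearMap (a.linear : StrongDual ℝ t →ₗ[ℝ] StrongDual ℝ t) with hA
  have hder : ∀ x ∈ Δ, HasFDerivWithinAt a A Δ x := by
    intro x _
    have h1 : (a : StrongDual ℝ t → StrongDual ℝ t) = fun x => A x + a 0 :=
      funext fun x => affineEquiv_apply_eq a x
    rw [h1]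
    exact (A.hasFDerivAt.add_const _).hasFDerivWithinAt
  have key : ∀ g : StrongDual ℝ t → ℝ,
      ∫ x in Δ, g x ∂(Measure.addHaar : Measure (StrongDual ℝ t)) =
        |A.det| * ∫ x in Δ, g (a x) ∂(Measure.addHaar : Measure (StrongDual ℝ t)) := by
    intro g
    have := integral_image_eq_integral_abs_det_fderiv_smul
      (Measure.addHaar : Measure (StrongDual ℝ t)) hΔ hder a.injective.injOn g
    rw [ha.1] at this
    rw [this, ← integral_const_mul]
    rfl
  have h1 := key fun _ => 1
  have hdet : |A.det| = 1 := by
    have : (|A.det| - 1) *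
      ∫ _ in Δ, (1 : ℝ) ∂(Measure.addHaar : Measure (StrongDual ℝ t)) = 0 := by linarith
    have := (mul_eq_zero.1 this).resolve_right hpos.ne'
    linarith
  rw [key g, hdet, one_mul]

/-- The distance of the center of mass from a facet as a quotient of moments. -/
theorem IsNondegenerate.sub_centerOfMass (h : IsNondegenerate η κ) (i : ι) :
    κ i - centerOfMass (polytope η κ) (η i) =
      (moment η (fun _ => 1) κ)⁻¹ * moment η (fun x => κ i - x (η i)) κ := by
  have hV := h.moment_one_pos
  have h1 : moment η (fun x => κ i - x (η i)) κ =
      κ i * moment η (fun _ => 1) κ - moment η (fun x => x (η i)) κ := by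
    unfold moment
    rw [integral_sub (integrableOn_of_isBounded continuous_const h.bounded)
      (integrableOn_of_isBounded (continuous_apply_const _) h.bounded), ← integral_const_mul]
    simp
  rw [centerOfMass_apply h.bounded, h1]
  unfold moment at hV ⊢
  field_simp

/-- The symmetry preserves volume and matches the two lattice distances pointwise, so their averages
agree. This invariant tells facets of `Y_a` apart. -/
theorem FacetEquiv.sub_centerOfMass {i j : ι} (h : FacetEquiv L η κ i j) {κ' : ι → ℝ}
    (hκ' : κ' ∈ chamber η κ) (hnd : IsNondegenerate η κ') (hi : η i ∈ L) (hj : η j ∈ L)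
    (hξi : ∃ ξ ∈ dualLattice L, ξ (η i) = 1) (hξj : ∃ ξ ∈ dualLattice L, ξ (η j) = 1) :
    κ' i - centerOfMass (polytope η κ') (η i) = κ' j - centerOfMass (polytope η κ') (η j) := by
  obtain ⟨A, hA, hij⟩ := h
  obtain ⟨a, ha, hlin⟩ := hA κ' hκ'
  have h1 := ha.distance_eq hnd hi hj hξi hξj (hij κ' hκ' a ha hlin)
  rw [hnd.sub_centerOfMass, hnd.sub_centerOfMass]
  congr 1
  have h2 := ha.integral_comp (isClosed_polytope η κ').measurableSet hnd.moment_one_pos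
    fun x => κ' j - x (η j)
  unfold moment
  rw [← h2]
  simp only [h1]

end Centers

/-! ### The polytopes `Y_a(κ)` and their chamber. -/

section ChamberY

/-- The lattice length of the sides of the triangles in `Y_a(κ)`. -/
def sideY (κ : Fin 5 → ℝ) : ℝ := κ 0 + κ 1 + κ 2

/-- The lattice length of the edge of `Y_a(κ)` over the first vertex of the triangle. -/
def heightY (a : Fin 2 → ℝ) (κ : Fin 5 → ℝ) : ℝ := κ 3 + κ 4 + a 0 * κ 0 + a 1 * κ 1

/-- Geometrically: the base triangle is nondegenerate and the fibre over each of its three corners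
has positive length. -/
theorem mem_chamberY_iff {a : Fin 2 → ℝ} {κ : Fin 5 → ℝ} :
    κ ∈ chamberY a ↔ 0 < sideY κ ∧ 0 < heightY a κ ∧ a 0 * sideY κ < heightY a κ ∧
      a 1 * sideY κ < heightY a κ := by
  have hdef : κ ∈ chamberY a ↔ 0 < sideY κ ∧
      -(a 0) * κ 0 - a 1 * κ 1 + max 0 (max (a 0) (a 1)) * sideY κ < κ 3 + κ 4 := Iff.rfl
  rw [hdef]
  refine and_congr_right fun hK => ?_
  have hmul : max 0 (max (a 0) (a 1)) * sideY κ =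
      max 0 (max (a 0 * sideY κ) (a 1 * sideY κ)) := by
    rw [max_mul_of_nonneg _ _ hK.le, max_mul_of_nonneg _ _ hK.le, zero_mul]
  have h1 : -(a 0) * κ 0 - a 1 * κ 1 + max 0 (max (a 0) (a 1)) * sideY κ < κ 3 + κ 4 ↔
      max 0 (max (a 0) (a 1)) * sideY κ < heightY a κ := by
    unfold heightY
    constructor <;> intro h <;> linarith
  rw [h1, hmul, max_lt_iff, max_lt_iff]

/-- The coordinates of a point of `(ℝ³)*`. -/
noncomputable def coordinates : StrongDual ℝ (Fin 3 → ℝ) ≃L[ℝ] (ℝ × ℝ) × ℝ :=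
  LinearEquiv.toContinuousLinearEquiv
    { toFun := fun x => ((x (Pi.single 0 1), x (Pi.single 1 1)), x (Pi.single 2 1))
      map_add' := fun x y => rfl
      map_smul' := fun c x => rfl
      invFun := fun p => p.1.1 • ContinuousLinearMap.proj 0 + p.1.2 • ContinuousLinearMap.proj 1 +
        p.2 • ContinuousLinearMap.proj 2
      left_inv := fun x => by
        ext v
        have : v = v 0 • (Pi.single 0 1 : Fin 3 → ℝ) + v 1 • (Pi.single 1 1 : Fin 3 → ℝ) +
            v 2 • (Pi.single 2 1 : Fin 3 → ℝ) := by
          ext i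
          fin_cases i <;> simp
        conv_rhs => rw [this]
        simp
        ring
      right_inv := fun p => by
        simp }

theorem apply_eq_coordinates (x : StrongDual ℝ (Fin 3 → ℝ)) (v : Fin 3 → ℝ) :
    x v = v 0 * (coordinates x).1.1 + v 1 * (coordinates x).1.2 + v 2 * (coordinates x).2 := by
  conv_lhs => rw [← coordinates.symm_apply_apply x]
  change (coordinates x).1.1 * v 0 + (coordinates x).1.2 * v 1 + (coordinates x).2 * v 2 = _
  ring

theorem mem_polytope_conormalY_iff {a : Fin 2 → ℝ} {κ : Fin 5 → ℝ}
    {x : StrongDual ℝ (Fin 3 → ℝ)} :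
    x ∈ polytope (conormalY a) κ ↔ -(coordinates x).1.1 ≤ κ 0 ∧ -(coordinates x).1.2 ≤ κ 1 ∧
      (coordinates x).1.1 + (coordinates x).1.2 ≤ κ 2 ∧ -(coordinates x).2 ≤ κ 3 ∧
      a 0 * (coordinates x).1.1 + a 1 * (coordinates x).1.2 + (coordinates x).2 ≤ κ 4 := by
  simp [polytope, Fin.forall_fin_succ, apply_eq_coordinates x, conormalY]

theorem apply_conormalY (a : Fin 2 → ℝ) (x : StrongDual ℝ (Fin 3 → ℝ)) :
    x (conormalY a 0) = -(coordinates x).1.1 ∧ x (conormalY a 1) = -(coordinates x).1.2 ∧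
    x (conormalY a 2) = (coordinates x).1.1 + (coordinates x).1.2 ∧
    x (conormalY a 3) = -(coordinates x).2 ∧ x (conormalY a 4) =
      a 0 * (coordinates x).1.1 + a 1 * (coordinates x).1.2 + (coordinates x).2 := by
  simp [apply_eq_coordinates x, conormalY]

theorem sum_smul_conormalY (a : Fin 2 → ℝ) (c : Fin 5 → ℝ) :
    ∑ i, c i • conormalY a i = ![-c 0 + c 2 + a 0 * c 4, -c 1 + c 2 + a 1 * c 4, -c 3 + c 4] := by
  ext i
  fin_cases i <;> simp [Fin.sum_univ_five, conormalY] <;> ring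

/-- For `κ = 0` the polytope is the recession cone, which is the single point `0`; boundedness then
passes to all support numbers. -/
theorem isBounded_polytope_conormalY (a : Fin 2 → ℝ) (κ : Fin 5 → ℝ) :
    Bornology.IsBounded (polytope (conormalY a) κ) := by
  refine isBounded_polytope (κ := 0) ?_ ⟨0, fun i => by simp⟩ κ
  refine Bornology.isBounded_singleton (x := (0 : StrongDual ℝ (Fin 3 → ℝ))) |>.subset ?_
  intro x hx
  obtain ⟨h0, h1, h2, h3, h4⟩ := mem_polytope_conormalY_iff.1 hx
  simp only [Pi.zero_apply] at h0 h1 h2 h3 h4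
  have e0 : (coordinates x).1.1 = 0 := by linarith
  have e1 : (coordinates x).1.2 = 0 := by linarith
  rw [e0, e1] at h4
  have e2 : (coordinates x).2 = 0 := by linarith
  have : coordinates x = 0 := Prod.ext (Prod.ext e0 e1) e2
  simpa using this

/-- The point of `Y_a(κ)` over a point of the triangle, at a given height. -/
noncomputable def pointY (κ : Fin 5 → ℝ) (u v w : ℝ) : StrongDual ℝ (Fin 3 → ℝ) :=
  coordinates.symm ((u - κ 0, v - κ 1), w - κ 3)

theorem coordinates_pointY (κ : Fin 5 → ℝ) (u v w : ℝ) :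
    coordinates (pointY κ u v w) = ((u - κ 0, v - κ 1), w - κ 3) :=
  coordinates.apply_symm_apply _

/-- The parameters `u`, `v`, `w` are the distances to facets `0`, `1` and `3`; in them the polytope
has one corner at the origin. -/
theorem pointY_apply (a : Fin 2 → ℝ) (κ : Fin 5 → ℝ) (u v w : ℝ) :
    pointY κ u v w (conormalY a 0) = κ 0 - u ∧ pointY κ u v w (conormalY a 1) = κ 1 - v ∧
    pointY κ u v w (conormalY a 2) = κ 2 - (sideY κ - u - v) ∧
    pointY κ u v w (conormalY a 3) = κ 3 - w ∧
    pointY κ u v w (conormalY a 4) = κ 4 - (heightY a κ - a 0 * u - a 1 * v - w) := by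
  obtain ⟨h0, h1, h2, h3, h4⟩ := apply_conormalY a (pointY κ u v w)
  rw [h0, h1, h2, h3, h4, coordinates_pointY]
  unfold sideY heightY
  refine ⟨?_, ?_, ?_, ?_, ?_⟩ <;> ring

theorem pointY_mem_iff {a : Fin 2 → ℝ} {κ : Fin 5 → ℝ} {u v w : ℝ} :
    pointY κ u v w ∈ polytope (conormalY a) κ ↔ 0 ≤ u ∧ 0 ≤ v ∧ u + v ≤ sideY κ ∧ 0 ≤ w ∧
      w ≤ heightY a κ - a 0 * u - a 1 * v := by
  obtain ⟨h0, h1, h2, h3, h4⟩ := pointY_apply a κ u v w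
  constructor
  · intro h
    have g0 := h 0
    have g1 := h 1
    have g2 := h 2
    have g3 := h 3
    have g4 := h 4
    rw [h0] at g0
    rw [h1] at g1
    rw [h2] at g2
    rw [h3] at g3
    rw [h4] at g4
    refine ⟨?_, ?_, ?_, ?_, ?_⟩ <;> linarith
  · rintro ⟨g0, g1, g2, g3, g4⟩ i
    fin_cases i
    · exact h0.trans_le (show κ 0 - u ≤ κ 0 by linarith)
    · exact h1.trans_le (show κ 1 - v ≤ κ 1 by linarith)
    · exact h2.trans_le (show κ 2 - (sideY κ - u - v) ≤ κ 2 by linarith)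
    · exact h3.trans_le (show κ 3 - w ≤ κ 3 by linarith)
    · exact h4.trans_le (show κ 4 - (heightY a κ - a 0 * u - a 1 * v - w) ≤ κ 4 by linarith)

theorem height_pos {a : Fin 2 → ℝ} {κ : Fin 5 → ℝ} (hκ : κ ∈ chamberY a) {u v : ℝ} (hu : 0 ≤ u)
    (hv : 0 ≤ v) (huv : u + v ≤ sideY κ) : 0 < heightY a κ - a 0 * u - a 1 * v := by
  obtain ⟨hK, h0, h1, h2⟩ := mem_chamberY_iff.1 hκ
  have h3 : 0 < sideY κ * (heightY a κ - a 0 * u - a 1 * v) := by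
    -- The fibre length is a barycentric combination of the lengths over the three corners.
    have e : sideY κ * (heightY a κ - a 0 * u - a 1 * v) =
        (sideY κ - u - v) * heightY a κ + u * (heightY a κ - a 0 * sideY κ) +
          v * (heightY a κ - a 1 * sideY κ) := by ring
    rw [e]
    rcases hu.lt_or_eq with hu' | hu'
    · have := mul_pos hu' (sub_pos.2 h1)
      have := mul_nonneg hv (sub_pos.2 h2).le
      have := mul_nonneg (by linarith : 0 ≤ sideY κ - u - v) h0.le
      linarith
    · rcases hv.lt_or_eq with hv' | hv'
      · have := mul_nonneg hu (sub_pos.2 h1).le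
        have := mul_pos hv' (sub_pos.2 h2)
        have := mul_nonneg (by linarith : 0 ≤ sideY κ - u - v) h0.le
        linarith
      · rw [← hu', ← hv']
        have := mul_pos hK h0
        linarith
  exact (mul_pos_iff_of_pos_left hK).1 h3

theorem exists_pointY (κ : Fin 5 → ℝ) (x : StrongDual ℝ (Fin 3 → ℝ)) :
    ∃ u v w, x = pointY κ u v w := by
  refine ⟨(coordinates x).1.1 + κ 0, (coordinates x).1.2 + κ 1, (coordinates x).2 + κ 3, ?_⟩
  simp [pointY]

/-- Base and fibre separate: positive fibre length prevents facets `3` and `4` from meeting, a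
positive side prevents `0`, `1` and `2` from having a common point, and any dependence among the
remaining conormals is trivial. -/
theorem isNondegenerate_conormalY {a : Fin 2 → ℝ} {κ : Fin 5 → ℝ} (hκ : κ ∈ chamberY a) :
    IsNondegenerate (conormalY a) κ := by
  obtain ⟨hK, h0, h1, h2⟩ := mem_chamberY_iff.1 hκ
  have hface : ∀ i u v w, 0 ≤ u → 0 ≤ v → u + v ≤ sideY κ → 0 ≤ w →
      w ≤ heightY a κ - a 0 * u - a 1 * v → pointY κ u v w (conormalY a i) = κ i →
      (facet (conormalY a) κ i).Nonempty := fun i u v w g0 g1 g2 g3 g4 hi =>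
    ⟨_, pointY_mem_iff.2 ⟨g0, g1, g2, g3, g4⟩, hi⟩
  refine ⟨isBounded_polytope_conormalY a κ, ⟨pointY κ 0 0 0, pointY_mem_iff.2 ?_⟩, ?_, ?_⟩
  · simp [hK.le, h0.le]
  · intro x hx c hc hsum
    obtain ⟨u, v, w, rfl⟩ := exists_pointY κ x
    obtain ⟨g0, g1, g2, g3, g4⟩ := pointY_mem_iff.1 hx
    have hpos := height_pos hκ g0 g1 g2
    obtain ⟨e0, e1, e2, e3, e4⟩ := pointY_apply a κ u v w
    rw [sum_smul_conormalY] at hsum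
    have s0 := congrFun hsum 0
    have s1 := congrFun hsum 1
    have s2 := congrFun hsum 2
    simp only [Matrix.cons_val, Pi.zero_apply] at s0 s1 s2
    have h34 : c 3 = 0 ∧ c 4 = 0 := by
      by_cases hw : w = 0
      · have := hc 4 (by rw [e4]; intro h; linarith)
        exact ⟨by linarith, this⟩
      · have := hc 3 (by rw [e3]; intro h; exact hw (by linarith))
        exact ⟨this, by linarith⟩
    rw [h34.2] at s0 s1
    have h012 : c 0 = 0 ∧ c 1 = 0 ∧ c 2 = 0 := by
      by_cases hu : u = 0
      · by_cases hv : v = 0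
        · have := hc 2 (by rw [e2, hu, hv]; intro h; linarith)
          exact ⟨by linarith, by linarith, this⟩
        · have := hc 1 (by rw [e1]; intro h; exact hv (by linarith))
          exact ⟨by linarith, this, by linarith⟩
      · have := hc 0 (by rw [e0]; intro h; exact hu (by linarith))
        exact ⟨this, by linarith, by linarith⟩
    ext i
    fin_cases i
    · exact h012.1
    · exact h012.2.1
    · exact h012.2.2
    · exact h34.1
    · exact h34.2
  · intro i
    fin_cases i
    · exact hface 0 0 0 0 le_rfl le_rfl (by linarith) le_rfl (by linarith)
        (by rw [(pointY_apply a κ 0 0 0).1]; ring)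
    · exact hface 1 0 0 0 le_rfl le_rfl (by linarith) le_rfl (by linarith)
        (by rw [(pointY_apply a κ 0 0 0).2.1]; ring)
    · exact hface 2 (sideY κ) 0 0 hK.le le_rfl (by linarith) le_rfl (by linarith)
        (by rw [(pointY_apply a κ (sideY κ) 0 0).2.2.1]; ring)
    · exact hface 3 0 0 0 le_rfl le_rfl (by linarith) le_rfl (by linarith)
        (by rw [(pointY_apply a κ 0 0 0).2.2.2.1]; ring)
    · exact hface 4 0 0 (heightY a κ) le_rfl le_rfl (by linarith) h0.le (by linarith)
        (by rw [(pointY_apply a κ 0 0 (heightY a κ)).2.2.2.2]; ring)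

theorem continuous_sideY : Continuous sideY := by
  unfold sideY
  fun_prop

theorem continuous_heightY (a : Fin 2 → ℝ) : Continuous (heightY a) := by
  unfold heightY
  fun_prop

theorem chamberY_eq (a : Fin 2 → ℝ) : chamberY a = {κ | 0 < sideY κ} ∩ ({κ | 0 < heightY a κ} ∩
    ({κ | a 0 * sideY κ < heightY a κ} ∩ {κ | a 1 * sideY κ < heightY a κ})) :=
  Set.ext fun _ => mem_chamberY_iff

theorem isOpen_chamberY (a : Fin 2 → ℝ) : IsOpen (chamberY a) := by
  rw [chamberY_eq]
  have h1 := continuous_sideY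
  have h2 := continuous_heightY a
  exact (isOpen_lt continuous_const h1).inter ((isOpen_lt continuous_const h2).inter
    ((isOpen_lt (h1.const_mul _) h2).inter (isOpen_lt (h1.const_mul _) h2)))

theorem convex_chamberY (a : Fin 2 → ℝ) : Convex ℝ (chamberY a) := by
  intro κ hκ κ' hκ' s r hs hr hsr
  rw [mem_chamberY_iff] at hκ hκ' ⊢
  obtain ⟨h0, h1, h2, h3⟩ := hκ
  obtain ⟨g0, g1, g2, g3⟩ := hκ'
  have e1 : sideY (s • κ + r • κ') = s * sideY κ + r * sideY κ' := by
    simp [sideY]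
    ring
  have e2 : heightY a (s • κ + r • κ') = s * heightY a κ + r * heightY a κ' := by
    simp [heightY]
    ring
  have comb : ∀ {p q : ℝ}, 0 < p → 0 < q → 0 < s * p + r * q := by
    intro p q hp hq
    rcases hs.lt_or_eq with hs' | hs'
    · have := mul_pos hs' hp
      have := mul_nonneg hr hq.le
      linarith
    · have : r = 1 := by linarith
      rw [← hs', this]
      linarith
  rw [e1, e2]
  refine ⟨comb h0 g0, comb h1 g1, ?_, ?_⟩
  · have := comb (sub_pos.2 h2) (sub_pos.2 g2)
    linarith
  · have := comb (sub_pos.2 h3) (sub_pos.2 g3)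
    linarith

theorem closure_chamberY_subset (a : Fin 2 → ℝ) {κ : Fin 5 → ℝ} (hκ : κ ∈ closure (chamberY a)) :
    0 ≤ sideY κ ∧ 0 ≤ heightY a κ ∧ a 0 * sideY κ ≤ heightY a κ ∧
      a 1 * sideY κ ≤ heightY a κ := by
  have h1 := continuous_sideY
  have h2 := continuous_heightY a
  have hcl : IsClosed ({κ | 0 ≤ sideY κ} ∩ ({κ | 0 ≤ heightY a κ} ∩
      ({κ | a 0 * sideY κ ≤ heightY a κ} ∩ {κ | a 1 * sideY κ ≤ heightY a κ}))) :=
    (isClosed_le continuous_const h1).inter ((isClosed_le continuous_const h2).inter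
      ((isClosed_le (h1.const_mul _) h2).inter (isClosed_le (h1.const_mul _) h2)))
  refine closure_minimal (fun κ hκ => ?_) hcl hκ
  obtain ⟨h0, h1, h2, h3⟩ := mem_chamberY_iff.1 hκ
  exact ⟨h0.le, h1.le, h2.le, h3.le⟩

/-- No edge of a simple `Y_a(κ)` parallel to the fibres is contracted. -/
theorem ne_zero_of_isSimple {a : Fin 2 → ℝ} {κ : Fin 5 → ℝ} (h : IsSimple (conormalY a) κ)
    {u v : ℝ} (hu : 0 ≤ u) (hv : 0 ≤ v) (huv : u + v ≤ sideY κ)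
    (hvert : (u = 0 ∧ v = 0) ∨ (u = 0 ∧ u + v = sideY κ) ∨ (v = 0 ∧ u + v = sideY κ)) :
    heightY a κ - a 0 * u - a 1 * v ≠ 0 := by
  intro h0
  obtain ⟨e0, e1, e2, e3, e4⟩ := pointY_apply a κ u v 0
  have hmem : pointY κ u v 0 ∈ polytope (conormalY a) κ :=
    pointY_mem_iff.2 ⟨hu, hv, huv, le_rfl, h0.ge⟩
  have h3 : pointY κ u v 0 (conormalY a 3) = κ 3 := by rw [e3, sub_zero]
  have h4 : pointY κ u v 0 (conormalY a 4) = κ 4 := by rw [e4, h0]; ring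
  -- Over a corner of the base two side facets meet. If the fibre there had length zero, these and
  -- facets `3` and `4` would be four facets at one vertex.
  obtain ⟨i, j, hij, hi3, hj3, hi4, hj4, hi, hj, hext⟩ : ∃ i j : Fin 5, i ≠ j ∧ i ≠ 3 ∧ j ≠ 3 ∧
      i ≠ 4 ∧ j ≠ 4 ∧ pointY κ u v 0 (conormalY a i) = κ i ∧
      pointY κ u v 0 (conormalY a j) = κ j ∧ ∀ w : StrongDual ℝ (Fin 3 → ℝ),
        w (conormalY a i) = 0 → w (conormalY a j) = 0 → (coordinates w).1.1 = 0 ∧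
          (coordinates w).1.2 = 0 := by
    rcases hvert with ⟨h1, h2⟩ | ⟨h1, h2⟩ | ⟨h1, h2⟩
    · refine ⟨0, 1, by decide, by decide, by decide, by decide, by decide, by rw [e0, h1, sub_zero],
        by rw [e1, h2, sub_zero], fun w g0 g1 => ?_⟩
      rw [(apply_conormalY a w).1] at g0
      rw [(apply_conormalY a w).2.1] at g1
      exact ⟨by linarith, by linarith⟩
    · refine ⟨0, 2, by decide, by decide, by decide, by decide, by decide, by rw [e0, h1, sub_zero],
        by rw [e2]; linarith, fun w g0 g1 => ?_⟩
      rw [(apply_conormalY a w).1] at g0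
      rw [(apply_conormalY a w).2.2.1] at g1
      exact ⟨by linarith, by linarith⟩
    · refine ⟨1, 2, by decide, by decide, by decide, by decide, by decide, by rw [e1, h1, sub_zero],
        by rw [e2]; linarith, fun w g0 g1 => ?_⟩
      rw [(apply_conormalY a w).2.1] at g0
      rw [(apply_conormalY a w).2.2.1] at g1
      exact ⟨by linarith, by linarith⟩
  have hv := h.vertex _ (mem_extremePoints_of_active hmem fun w hw => by
    obtain ⟨g0, g1⟩ := hext w (hw i hi) (hw j hj)
    have g2 := hw 3 h3
    rw [(apply_conormalY a w).2.2.2.1] at g2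
    have : coordinates w = 0 := Prod.ext (Prod.ext g0 g1) (by simpa using g2)
    simpa using this)
  rw [setOf_mem_facet hmem] at hv
  have hsub : (({i, j, 3, 4} : Finset (Fin 5)) : Set (Fin 5)) ⊆
      {i | pointY κ u v 0 (conormalY a i) = κ i} := by
    intro n hn
    simp only [Finset.coe_insert, Finset.coe_singleton, mem_insert_iff, mem_singleton_iff] at hn
    rcases hn with rfl | rfl | rfl | rfl
    exacts [hi, hj, h3, h4]
  have hcard := ncard_le_ncard hsub
  rw [hv, ncard_coe_finset, Finset.card_insert_of_notMem (by simp [hij, hi3, hi4]),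
    Finset.card_insert_of_notMem (by simp [hj3, hj4]), Finset.card_pair (by decide)] at hcard
  simp at hcard

/-- The chamber of `Y_a(κ)` is the set `C_a`. -/
theorem chamber_conormalY {a : Fin 2 → ℝ} {κ : Fin 5 → ℝ} (hκ : κ ∈ chamberY a) :
    chamber (conormalY a) κ = chamberY a := by
  have hsub : chamberY a ⊆ {κ' | IsSimple (conormalY a) κ'} := fun κ' hκ' =>
    (isNondegenerate_conormalY hκ').isSimple
  refine Subset.antisymm ?_
    ((convex_chamberY a).isPreconnected.subset_connectedComponentIn hκ hsub)
  -- `C_a` is open, and it is also closed among the simple support numbers: at a limit point where a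
  -- strict inequality fails, the polytope is flat or a fibre over a corner is contracted.
  refine isPreconnected_connectedComponentIn.subset_of_closure_inter_subset (isOpen_chamberY a)
    ⟨κ, mem_connectedComponentIn (hsub hκ), hκ⟩ ?_
  rintro κ' ⟨hcl, hκ'⟩
  have hs : IsSimple (conormalY a) κ' := isSimple_of_mem_chamber hκ'
  obtain ⟨h0, h1, h2, h3⟩ := closure_chamberY_subset a hcl
  refine mem_chamberY_iff.2 ⟨h0.lt_of_ne fun hK => ?_, h1.lt_of_ne fun h => ?_,
    h2.lt_of_ne fun h => ?_, h3.lt_of_ne fun h => ?_⟩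
  · have hP : polytope (conormalY a) κ' ⊆ {x | x (conormalY a 0) = κ' 0} := by
      intro x hx
      obtain ⟨u, v, w, rfl⟩ := exists_pointY κ' x
      obtain ⟨g0, g1, g2, -, -⟩ := pointY_mem_iff.1 hx
      have : u = 0 := by linarith
      change pointY κ' u v w (conormalY a 0) = κ' 0
      rw [(pointY_apply a κ' u v w).1, this, sub_zero]
    let S : AffineSubspace ℝ (StrongDual ℝ (Fin 3 → ℝ)) :=
      { carrier := {x | x (conormalY a 0) = κ' 0}
        smul_vsub_vadd_mem' := by
          intro c x y z hx hy hz
          have hx : x (conormalY a 0) = κ' 0 := hx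
          have hy : y (conormalY a 0) = κ' 0 := hy
          have hz : z (conormalY a 0) = κ' 0 := hz
          change (c • (x - y) + z) (conormalY a 0) = κ' 0
          simp [hx, hy, hz] }
    have hle : affineSpan ℝ (polytope (conormalY a) κ') ≤ S := affineSpan_le.2 hP
    rw [hs.span_eq_top] at hle
    have hmem : pointY κ' 1 0 0 ∈ S := hle (AffineSubspace.mem_top ℝ _ _)
    have hmem : pointY κ' 1 0 0 (conormalY a 0) = κ' 0 := hmem
    rw [(pointY_apply a κ' 1 0 0).1] at hmem
    linarith
  · exact ne_zero_of_isSimple hs le_rfl le_rfl (by linarith) (Or.inl ⟨rfl, rfl⟩) (by linarith)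
  · exact ne_zero_of_isSimple hs h0 le_rfl (by linarith) (Or.inr (Or.inr ⟨rfl, by ring⟩))
      (by linarith)
  · exact ne_zero_of_isSimple hs le_rfl h0 (by linarith) (Or.inr (Or.inl ⟨rfl, by ring⟩))
      (by linarith)

end ChamberY

/-! ### The center of mass of `Y_a(κ)`. -/

section Integrals

/-- Integration over the region below the graph of a function. -/
theorem setIntegral_under_graph {X : Type*} [MeasurableSpace X] {μ : Measure X} [SFinite μ]
    {T : Set X} (hT : MeasurableSet T) {Λ : X → ℝ} (hΛ : ∀ x ∈ T, 0 ≤ Λ x) (hΛm : Measurable Λ)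
    {f : X × ℝ → ℝ}
    (hf : IntegrableOn f {p | p.1 ∈ T ∧ 0 ≤ p.2 ∧ p.2 ≤ Λ p.1} (μ.prod volume)) :
    ∫ p in {p | p.1 ∈ T ∧ 0 ≤ p.2 ∧ p.2 ≤ Λ p.1}, f p ∂(μ.prod volume) =
      ∫ x in T, (∫ w in (0 : ℝ)..Λ x, f (x, w)) ∂μ := by
  set R : Set (X × ℝ) := {p | p.1 ∈ T ∧ 0 ≤ p.2 ∧ p.2 ≤ Λ p.1} with hR
  have hRm : MeasurableSet R :=
    (measurable_fst hT).inter ((measurableSet_le measurable_const measurable_snd).inter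
      (measurableSet_le measurable_snd (hΛm.comp measurable_fst)))
  rw [← integral_indicator hRm, integral_prod _ ((integrable_indicator_iff hRm).2 hf),
    ← integral_indicator hT]
  congr 1
  ext x
  by_cases hx : x ∈ T
  · rw [indicator_of_mem hx, intervalIntegral.integral_of_le (hΛ x hx),
      ← integral_Icc_eq_integral_Ioc, ← integral_indicator measurableSet_Icc]
    congr 1
    ext w
    by_cases hw : w ∈ Icc 0 (Λ x)
    · rw [indicator_of_mem hw, indicator_of_mem (show (x, w) ∈ R from ⟨hx, hw⟩)]
    · rw [indicator_of_notMem hw, indicator_of_notMem (fun h : (x, w) ∈ R => hw h.2)]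
  · rw [indicator_of_notMem hx]
    have : ∀ w, R.indicator f (x, w) = 0 := fun w =>
      indicator_of_notMem (fun h : (x, w) ∈ R => hx h.1) f
    simp [this]

theorem integral_cubic (c₁ c₂ c₃ K : ℝ) :
    ∫ y in (0 : ℝ)..K, (c₁ * y + c₂ * y ^ 2 + c₃ * y ^ 3) =
      c₁ * K ^ 2 / 2 + c₂ * K ^ 3 / 3 + c₃ * K ^ 4 / 4 := by
  have hder : ∀ y ∈ uIcc 0 K, HasDerivAt
      (fun y => c₁ * y ^ 2 / 2 + c₂ * y ^ 3 / 3 + c₃ * y ^ 4 / 4)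
      (c₁ * y + c₂ * y ^ 2 + c₃ * y ^ 3) y := by
    intro y _
    have h1 := ((hasDerivAt_pow 2 y).const_mul c₁).div_const 2
    have h2 := ((hasDerivAt_pow 3 y).const_mul c₂).div_const 3
    have h3 := ((hasDerivAt_pow 4 y).const_mul c₃).div_const 4
    refine ((h1.add h2).add h3).congr_deriv ?_
    norm_num
    ring
  rw [intervalIntegral.integral_eq_sub_of_hasDerivAt hder
    (Continuous.intervalIntegrable (by fun_prop) _ _)]
  ring

theorem integral_quadratic (c₀ c₁ c₂ K : ℝ) :
    ∫ y in (0 : ℝ)..K, (c₀ + c₁ * y + c₂ * y ^ 2) =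
      c₀ * K + c₁ * K ^ 2 / 2 + c₂ * K ^ 3 / 3 := by
  have hder : ∀ y ∈ uIcc 0 K, HasDerivAt
      (fun y => c₀ * y + c₁ * y ^ 2 / 2 + c₂ * y ^ 3 / 3) (c₀ + c₁ * y + c₂ * y ^ 2) y := by
    intro y _
    have h0 := (hasDerivAt_id y).const_mul c₀
    have h1 := ((hasDerivAt_pow 2 y).const_mul c₁).div_const 2
    have h2 := ((hasDerivAt_pow 3 y).const_mul c₂).div_const 3
    refine ((h0.add h1).add h2).congr_deriv ?_
    norm_num
    ring
  rw [intervalIntegral.integral_eq_sub_of_hasDerivAt hder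
    (Continuous.intervalIntegrable (by fun_prop) _ _)]
  ring

/-- The product of two affine functions integrated over a triangle. -/
theorem integral_triangle (K h a b p q r : ℝ) :
    ∫ u in (0 : ℝ)..K, ∫ v in (0 : ℝ)..(K - u), (h - a * u - b * v) * (p + q * u + r * v) =
      (h - a * K) * (p + q * K) * K ^ 2 / 2 +
      (a * (p + q * K) - q * (h - a * K) + ((h - a * K) * r - b * (p + q * K)) / 2) * K ^ 3 / 3 +
      (-(a * q) + (a * r + b * q) / 2 - b * r / 3) * K ^ 4 / 4 := by
  rw [← integral_cubic]
  -- In terms of `y = K - u` the inner integral is a cubic polynomial without constant term.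
  have key := intervalIntegral.integral_comp_sub_left (a := 0) (b := K) (fun y =>
    ((h - a * K) * (p + q * K)) * y +
    (a * (p + q * K) - q * (h - a * K) + ((h - a * K) * r - b * (p + q * K)) / 2) * y ^ 2 +
    (-(a * q) + (a * r + b * q) / 2 - b * r / 3) * y ^ 3) K
  rw [sub_self, sub_zero] at key
  rw [← key]
  congr 1
  ext u
  have : ∀ v : ℝ, (h - a * u - b * v) * (p + q * u + r * v) =
      (h - a * u) * (p + q * u) + ((h - a * u) * r - b * (p + q * u)) * v + -(b * r) * v ^ 2 :=
    fun v => by ring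
  simp only [this, integral_quadratic]
  ring

/-- The region in `ℝ³` bounded by a cylinder over a triangle and two planes. -/
def prismRegion (K h a b : ℝ) : Set ((ℝ × ℝ) × ℝ) :=
  {p | p.1 ∈ {q : ℝ × ℝ | q.1 ∈ Icc 0 K ∧ 0 ≤ q.2 ∧ q.2 ≤ K - q.1} ∧ 0 ≤ p.2 ∧
    p.2 ≤ h - a * p.1.1 - b * p.1.2}

/-- The integrand does not depend on the fibre coordinate, so integrating over the fibre multiplies
it by the fibre length. -/
theorem setIntegral_prismRegion {K h a b : ℝ} (hK : 0 ≤ K)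
    (hΛ : ∀ u v, 0 ≤ u → 0 ≤ v → u + v ≤ K → 0 ≤ h - a * u - b * v) (p q r : ℝ) :
    ∫ x in prismRegion K h a b, (p + q * x.1.1 + r * x.1.2) =
      ∫ u in (0 : ℝ)..K, ∫ v in (0 : ℝ)..(K - u), (h - a * u - b * v) * (p + q * u + r * v) := by
  have hT : MeasurableSet {q : ℝ × ℝ | q.1 ∈ Icc 0 K ∧ 0 ≤ q.2 ∧ q.2 ≤ K - q.1} :=
    (measurable_fst measurableSet_Icc).inter
      ((measurableSet_le measurable_const measurable_snd).inter
        (measurableSet_le measurable_snd (by fun_prop)))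
  have hint : IntegrableOn (fun x : (ℝ × ℝ) × ℝ => p + q * x.1.1 + r * x.1.2)
      (prismRegion K h a b) (volume : Measure ((ℝ × ℝ) × ℝ)) := by
    have hc : Continuous fun x : (ℝ × ℝ) × ℝ => p + q * x.1.1 + r * x.1.2 := by fun_prop
    refine (hc.continuousOn.integrableOn_compact (isCompact_Icc
      (a := ((0, 0), 0)) (b := ((K, K), |h| + |a| * K + |b| * K)))).mono_set ?_
    rintro ⟨⟨u, v⟩, w⟩ ⟨⟨⟨h1, h2⟩, h3, h4⟩, h5, h6⟩
    simp only at h1 h2 h3 h4 h5 h6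
    have e1 : -(a * u) ≤ |a| * K := (neg_le_abs _).trans (by
      rw [abs_mul, abs_of_nonneg h1]
      exact mul_le_mul_of_nonneg_left h2 (abs_nonneg _))
    have e2 : -(b * v) ≤ |b| * K := (neg_le_abs _).trans (by
      rw [abs_mul, abs_of_nonneg h3]
      exact mul_le_mul_of_nonneg_left (by linarith) (abs_nonneg _))
    have e3 := le_abs_self h
    exact ⟨⟨⟨h1, h3⟩, h5⟩, ⟨⟨h2, by linarith⟩, by linarith⟩⟩
  have h1 := setIntegral_under_graph (μ := (volume : Measure (ℝ × ℝ))) hT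
    (Λ := fun x => h - a * x.1 - b * x.2) (fun x hx => hΛ _ _ hx.1.1 hx.2.1 (by linarith [hx.2.2]))
    (by fun_prop) hint
  refine h1.trans ?_
  simp only [intervalIntegral.integral_const, smul_eq_mul, sub_zero]
  have hc : Continuous fun x : ℝ × ℝ => (h - a * x.1 - b * x.2) * (p + q * x.1 + r * x.2) := by
    fun_prop
  have h2 := setIntegral_under_graph (μ := (volume : Measure ℝ)) (T := Icc 0 K) measurableSet_Icc
    (Λ := fun x => K - x) (fun x hx => sub_nonneg.2 hx.2) (by fun_prop)
    (f := fun x => (h - a * x.1 - b * x.2) * (p + q * x.1 + r * x.2))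
    ((hc.continuousOn.integrableOn_compact (isCompact_Icc (a := (0, 0)) (b := (K, K)))).mono_set (by
      rintro ⟨u, v⟩ ⟨⟨h1, h2⟩, h3, h4⟩
      simp only at h1 h2 h3 h4
      exact ⟨⟨h1, h3⟩, ⟨h2, by linarith⟩⟩))
  refine h2.trans ?_
  rw [intervalIntegral.integral_of_le hK, integral_Icc_eq_integral_Ioc]

/-- The constant `c` compares the chosen Haar measure with Lebesgue measure. It is the same for all
`p`, `q`, `r`, so it cancels in the center of mass. -/
theorem moment_conormalY (a : Fin 2 → ℝ) (κ : Fin 5 → ℝ) :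
    ∃ c : ℝ, ∀ p q r : ℝ,
      moment (conormalY a)
        (fun x => p + q * (κ 0 - x (conormalY a 0)) + r * (κ 1 - x (conormalY a 1))) κ =
      c * ∫ x in prismRegion (sideY κ) (heightY a κ) (a 0) (a 1), (p + q * x.1.1 + r * x.1.2) := by
  let μ : Measure ((ℝ × ℝ) × ℝ) :=
    (Measure.addHaar : Measure (StrongDual ℝ (Fin 3 → ℝ))).map coordinates
  have hμ : μ.IsAddHaarMeasure := coordinates.isAddHaarMeasure_map _
  have h₂ : (volume : Measure (ℝ × ℝ)).IsAddHaarMeasure :=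
    Measure.prod.instIsAddHaarMeasure volume volume
  have h₃ : (volume : Measure ((ℝ × ℝ) × ℝ)).IsAddHaarMeasure :=
    Measure.prod.instIsAddHaarMeasure volume volume
  obtain ⟨c, hc⟩ : ∃ c : NNReal, μ = c • volume := ⟨_, Measure.isAddLeftInvariant_eq_smul μ volume⟩
  let k : (ℝ × ℝ) × ℝ := ((κ 0, κ 1), κ 3)
  have hmp₁ : MeasurePreserving coordinates
      (Measure.addHaar : Measure (StrongDual ℝ (Fin 3 → ℝ))) μ :=
    ⟨coordinates.continuous.measurable, rfl⟩
  have hmp₂ : MeasurePreserving (fun y => y + k) μ μ := measurePreserving_add_right μ k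
  have hmp := hmp₂.comp hmp₁
  have hemb : MeasurableEmbedding ((fun y => y + k) ∘ coordinates) :=
    (measurableEmbedding_addRight k).comp coordinates.toHomeomorph.measurableEmbedding
  refine ⟨c, fun p q r => ?_⟩
  have hpre : ((fun y => y + k) ∘ coordinates) ⁻¹'
      prismRegion (sideY κ) (heightY a κ) (a 0) (a 1) = polytope (conormalY a) κ := by
    ext x
    obtain ⟨u, v, w, rfl⟩ := exists_pointY κ x
    rw [pointY_mem_iff]
    have : ((fun y => y + k) ∘ coordinates) (pointY κ u v w) = ((u, v), w) := by
      simp [coordinates_pointY, k]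
    rw [mem_preimage, this]
    constructor
    · rintro ⟨⟨⟨h1, h2⟩, h3, h4⟩, h5, h6⟩
      simp only at h1 h2 h3 h4 h5 h6
      exact ⟨h1, h3, by linarith, h5, h6⟩
    · rintro ⟨h1, h2, h3, h4, h5⟩
      exact ⟨⟨⟨h1, by linarith⟩, h2, le_sub_iff_add_le'.2 h3⟩, h4, h5⟩
  have h1 := hmp.setIntegral_preimage_emb hemb (fun x => p + q * x.1.1 + r * x.1.2)
    (prismRegion (sideY κ) (heightY a κ) (a 0) (a 1))
  rw [hpre, hc, Measure.restrict_smul, integral_smul_nnreal_measure, NNReal.smul_def,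
    smul_eq_mul] at h1
  rw [← h1, moment]
  congr 1
  ext x
  rw [(apply_conormalY a x).1, (apply_conormalY a x).2.1]
  simp [k]
  ring

/-- The distance of the center of mass of `Y_a(κ)` from the first two facets. -/
theorem sub_centerOfMass_conormalY {a : Fin 2 → ℝ} {κ : Fin 5 → ℝ} (hκ : κ ∈ chamberY a) :
    0 < 3 * heightY a κ - (a 0 + a 1) * sideY κ ∧
    κ 0 - centerOfMass (polytope (conormalY a) κ) (conormalY a 0) =
      sideY κ * (4 * heightY a κ - (2 * a 0 + a 1) * sideY κ) /
        (4 * (3 * heightY a κ - (a 0 + a 1) * sideY κ)) ∧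
    κ 1 - centerOfMass (polytope (conormalY a) κ) (conormalY a 1) =
      sideY κ * (4 * heightY a κ - (a 0 + 2 * a 1) * sideY κ) /
        (4 * (3 * heightY a κ - (a 0 + a 1) * sideY κ)) := by
  obtain ⟨hK, h0, h1, h2⟩ := mem_chamberY_iff.1 hκ
  have hD : 0 < 3 * heightY a κ - (a 0 + a 1) * sideY κ := by linarith
  have hnd := isNondegenerate_conormalY hκ
  obtain ⟨c, hc⟩ := moment_conormalY a κ
  have hV := hnd.moment_one_pos
  have hform := fun p q r => (hc p q r).trans (congrArg (c * ·) ((setIntegral_prismRegion hK.le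
    (fun u v hu hv huv => (height_pos hκ hu hv huv).le) p q r).trans
      (integral_triangle (sideY κ) (heightY a κ) (a 0) (a 1) p q r)))
  -- The volume and the two first moments are the three unit choices of the integrand.
  have e1 := hform 1 0 0
  have e2 := hform 0 1 0
  have e3 := hform 0 0 1
  simp only [zero_mul, one_mul, add_zero, zero_add] at e1 e2 e3
  have hc0 : c ≠ 0 := by
    rintro rfl
    rw [e1] at hV
    simp at hV
  have hV0 : c * (sideY κ ^ 2 * (3 * heightY a κ - (a 0 + a 1) * sideY κ) / 6) ≠ 0 :=
    mul_ne_zero hc0 (by positivity)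
  have hquot : ∀ m : ℝ,
      (c * (sideY κ ^ 2 * (3 * heightY a κ - (a 0 + a 1) * sideY κ) / 6))⁻¹ *
        (c * (sideY κ ^ 3 * m / 24)) =
      sideY κ * m / (4 * (3 * heightY a κ - (a 0 + a 1) * sideY κ)) := by
    intro m
    rw [inv_mul_eq_div, div_eq_div_iff hV0 (by positivity)]
    ring
  have hvol : moment (conormalY a) (fun _ => 1) κ =
      c * (sideY κ ^ 2 * (3 * heightY a κ - (a 0 + a 1) * sideY κ) / 6) := by
    rw [e1]
    ring
  refine ⟨hD, ?_, ?_⟩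
  · rw [hnd.sub_centerOfMass, hvol, e2, ← hquot]
    ring
  · rw [hnd.sub_centerOfMass, hvol, e3, ← hquot]
    ring

end Integrals

/-! ### Mass linear functions and equivalent facets of `Y_a(κ)`; part (2). -/

section FacetsY

variable {a : Fin 2 → ℝ} {κ : Fin 5 → ℝ}

theorem conormalY_mem_latticeZ3 (ha : ∀ i, ∃ m : ℤ, a i = m) (i : Fin 5) :
    conormalY a i ∈ latticeZ3 := by
  obtain ⟨m, hm⟩ := ha 0
  obtain ⟨n, hn⟩ := ha 1
  have : conormalY a i = fun j =>
      (((![![-1, 0, 0], ![0, -1, 0], ![1, 1, 0], ![0, 0, -1], ![m, n, 1]] :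
        Fin 5 → Fin 3 → ℤ) i j : ℤ) : ℝ) := by
    ext j
    fin_cases i <;> fin_cases j <;> simp [conormalY, hm, hn]
  rw [this]
  exact mem_latticeZ3_iff.2 fun j => ⟨_, rfl⟩

theorem coordinates_symm_mem_dualLattice (p q r : ℤ) :
    coordinates.symm (((p : ℝ), (q : ℝ)), (r : ℝ)) ∈ dualLattice latticeZ3 := by
  refine mem_dualLattice_latticeZ3_iff.2 fun i => ⟨![p, q, r] i, ?_⟩
  rw [apply_eq_coordinates, coordinates.apply_symm_apply]
  fin_cases i <;> simp

theorem coordinates_symm_apply_conormalY (a : Fin 2 → ℝ) (p q r : ℝ) (i : Fin 5) :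
    coordinates.symm ((p, q), r) (conormalY a i) =
      ![-p, -q, p + q, -r, a 0 * p + a 1 * q + r] i := by
  obtain ⟨h0, h1, h2, h3, h4⟩ := apply_conormalY a (coordinates.symm ((p, q), r))
  rw [coordinates.apply_symm_apply] at h0 h1 h2 h3 h4
  fin_cases i
  exacts [h0, h1, h2, h3, h4]

theorem exists_dual_conormalY (a : Fin 2 → ℝ) (i : Fin 5) :
    ∃ ξ ∈ dualLattice latticeZ3, ξ (conormalY a i) = 1 := by
  have key : ∀ p q r : ℤ, (![-p, -q, p + q, -r, a 0 * p + a 1 * q + r] : Fin 5 → ℝ) i = 1 →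
      ∃ ξ ∈ dualLattice latticeZ3, ξ (conormalY a i) = 1 := fun p q r h =>
    ⟨_, coordinates_symm_mem_dualLattice p q r, by rw [coordinates_symm_apply_conormalY, h]⟩
  fin_cases i
  · exact key (-1) 0 0 (by simp)
  · exact key 0 (-1) 0 (by simp)
  · exact key 1 0 0 (by simp)
  · exact key 0 0 (-1) (by simp)
  · exact key 0 0 1 (by simp)

theorem facetEquiv_conormalY (ha : ∀ i, ∃ m : ℤ, a i = m) {i j : Fin 5} (p q r : ℤ)
    (h : ∀ k, (![-p, -q, p + q, -r, a 0 * p + a 1 * q + r] : Fin 5 → ℝ) k =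
      if k = i then 1 else if k = j then -1 else 0) (hij : i ≠ j) :
    FacetEquiv latticeZ3 (conormalY a) κ i j := by
  refine facetEquiv_of_dual (conormalY_mem_latticeZ3 ha i) (conormalY_mem_latticeZ3 ha j)
    (coordinates_symm_mem_dualLattice p q r) ?_ ?_ fun k hki hkj => ?_
  · rw [coordinates_symm_apply_conormalY, h, if_pos rfl]
  · rw [coordinates_symm_apply_conormalY, h, if_neg hij.symm, if_pos rfl]
  · rw [coordinates_symm_apply_conormalY, h, if_neg hki, if_neg hkj]

/-- Every `Y_a` can be reflected along its fibres, whatever `a` is. -/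
theorem facetEquiv_three_four (ha : ∀ i, ∃ m : ℤ, a i = m) :
    FacetEquiv latticeZ3 (conormalY a) κ 3 4 :=
  facetEquiv_conormalY ha 0 0 (-1) (fun k => by fin_cases k <;> simp) (by decide)

theorem facetEquiv_zero_one (ha : ∀ i, ∃ m : ℤ, a i = m) (h : a 0 = a 1) :
    FacetEquiv latticeZ3 (conormalY a) κ 0 1 :=
  facetEquiv_conormalY ha (-1) 1 0 (fun k => by fin_cases k <;> simp [h]) (by decide)

theorem facetEquiv_zero_two (ha : ∀ i, ∃ m : ℤ, a i = m) (h : a 0 = 0) :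
    FacetEquiv latticeZ3 (conormalY a) κ 0 2 :=
  facetEquiv_conormalY ha (-1) 0 0 (fun k => by fin_cases k <;> simp [h]) (by decide)

theorem facetEquiv_one_two (ha : ∀ i, ∃ m : ℤ, a i = m) (h : a 1 = 0) :
    FacetEquiv latticeZ3 (conormalY a) κ 1 2 :=
  facetEquiv_conormalY ha 0 (-1) 0 (fun k => by fin_cases k <;> simp [h]) (by decide)

theorem FacetEquiv.sub_centerOfMass_conormalY (ha : ∀ i, ∃ m : ℤ, a i = m) {i j : Fin 5}
    (h : FacetEquiv latticeZ3 (conormalY a) κ i j) (hκ : κ ∈ chamberY a) {κ' : Fin 5 → ℝ}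
    (hκ' : κ' ∈ chamberY a) :
    κ' i - centerOfMass (polytope (conormalY a) κ') (conormalY a i) =
      κ' j - centerOfMass (polytope (conormalY a) κ') (conormalY a j) :=
  h.sub_centerOfMass (by rwa [chamber_conormalY hκ]) (isNondegenerate_conormalY hκ')
    (conormalY_mem_latticeZ3 ha i) (conormalY_mem_latticeZ3 ha j) (exists_dual_conormalY a i)
    (exists_dual_conormalY a j)

/-- The value of an arbitrary vector at the center of mass in terms of the distances of the center
of mass from the first two facets. -/
theorem centerOfMass_conormalY_apply (ha : ∀ i, ∃ m : ℤ, a i = m) (hκ : κ ∈ chamberY a)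
    (H : Fin 3 → ℝ) :
    centerOfMass (polytope (conormalY a) κ) H =
      (H 0 - a 0 * H 2 / 2) *
        (κ 0 - centerOfMass (polytope (conormalY a) κ) (conormalY a 0) - κ 0) +
      (H 1 - a 1 * H 2 / 2) *
        (κ 1 - centerOfMass (polytope (conormalY a) κ) (conormalY a 1) - κ 1) +
      H 2 * (κ 4 - κ 3) / 2 := by
  -- Equidistance from facets `3` and `4` determines the third coordinate of the center of mass from
  -- the first two.
  have h34 := (facetEquiv_three_four (κ := κ) ha).sub_centerOfMass_conormalY ha hκ hκ
  obtain ⟨h0, h1, -, h3, h4⟩ := apply_conormalY a (centerOfMass (polytope (conormalY a) κ))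
  rw [h3, h4] at h34
  rw [h0, h1, apply_eq_coordinates _ H]
  linear_combination (H 2 / 2) * h34

/-- With `D = 3 * heightY a κ' - (a 0 + a 1) * sideY κ'`, the value at the center of mass is affine
in `κ'` except for the term `e / 12 * (sideY κ' ^ 2 / D)`, where `e` is the expression in the
condition. -/
theorem isMassLinear_conormalY_iff (ha : ∀ i, ∃ m : ℤ, a i = m) (hκ : κ ∈ chamberY a)
    (H : Fin 3 → ℝ) :
    IsMassLinear (conormalY a) κ H ↔
      (H 0 - a 0 * H 2 / 2) * (a 1 - 2 * a 0) + (H 1 - a 1 * H 2 / 2) * (a 0 - 2 * a 1) = 0 := by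
  set P := H 0 - a 0 * H 2 / 2 with hP
  set Q := H 1 - a 1 * H 2 / 2 with hQ
  set e := P * (a 1 - 2 * a 0) + Q * (a 0 - 2 * a 1) with he
  have hform : ∀ κ' ∈ chamberY a, 0 < 3 * heightY a κ' - (a 0 + a 1) * sideY κ' ∧
      centerOfMass (polytope (conormalY a) κ') H =
      (P + Q) / 3 * sideY κ' + e / 12 * (sideY κ' ^ 2 /
        (3 * heightY a κ' - (a 0 + a 1) * sideY κ')) - P * κ' 0 - Q * κ' 1 +
        H 2 * (κ' 4 - κ' 3) / 2 := by
    intro κ' hκ'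
    obtain ⟨hD, h0, h1⟩ := sub_centerOfMass_conormalY hκ'
    refine ⟨hD, ?_⟩
    rw [centerOfMass_conormalY_apply ha hκ', h0, h1, ← hP, ← hQ, he]
    obtain ⟨D, hDe⟩ : ∃ D, D = 3 * heightY a κ' - (a 0 + a 1) * sideY κ' := ⟨_, rfl⟩
    have hh : heightY a κ' = (D + (a 0 + a 1) * sideY κ') / 3 := by linarith
    rw [← hDe] at hD ⊢
    rw [hh]
    field_simp
    ring
  unfold IsMassLinear
  rw [chamber_conormalY hκ]
  constructor
  · rintro ⟨γ, C, hγ⟩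
    -- A line in the chamber along which the side is `1` and the height is `s`.
    have hval : ∀ s, |a 0| + |a 1| < s → 0 < 3 * s - (a 0 + a 1) ∧
        (P + Q) / 3 + e / 12 * (1 / (3 * s - (a 0 + a 1))) + H 2 * s / 2 = γ 2 + γ 4 * s + C := by
      intro s hs
      have e1 : sideY ![0, 0, 1, 0, s] = 1 := by simp [sideY]
      have e2 : heightY a ![0, 0, 1, 0, s] = s := by simp [heightY]
      have hmem : ![0, 0, 1, 0, s] ∈ chamberY a := by
        rw [mem_chamberY_iff, e1, e2]
        have := le_abs_self (a 0)
        have := le_abs_self (a 1)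
        have := abs_nonneg (a 0)
        have := abs_nonneg (a 1)
        refine ⟨one_pos, ?_, ?_, ?_⟩ <;> linarith
      obtain ⟨hD, h1⟩ := hform _ hmem
      rw [hγ _ hmem, e1, e2, Fin.sum_univ_five] at h1
      rw [e1, e2] at hD
      simp only [Matrix.cons_val, mul_one, mul_zero, sub_zero, add_zero, zero_add, one_pow] at h1 hD
      exact ⟨hD, h1.symm⟩
    set s := |a 0| + |a 1| + 1 with hs
    obtain ⟨hd, h0⟩ := hval s (by linarith)
    obtain ⟨-, h1⟩ := hval (s + 1) (by linarith)
    obtain ⟨-, h2⟩ := hval (s + 2) (by linarith)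
    set d := 3 * s - (a 0 + a 1) with hdd
    rw [show 3 * (s + 1) - (a 0 + a 1) = d + 3 by rw [hdd]; ring] at h1
    rw [show 3 * (s + 2) - (a 0 + a 1) = d + 6 by rw [hdd]; ring] at h2
    -- A second difference in `s` removes all affine terms but not the reciprocal.
    have h3 : e * (1 / d - 2 * (1 / (d + 3)) + 1 / (d + 6)) = 0 := by
      linear_combination 12 * h0 - 24 * h1 + 12 * h2
    have h4 : 1 / d - 2 * (1 / (d + 3)) + 1 / (d + 6) = 18 / (d * (d + 3) * (d + 6)) := by
      field_simp
      ring
    rw [h4] at h3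
    exact (mul_eq_zero.1 h3).resolve_right (by positivity)
  · intro he0
    refine ⟨![(P + Q) / 3 - P, (P + Q) / 3 - Q, (P + Q) / 3, -(H 2) / 2, H 2 / 2], 0,
      fun κ' hκ' => ?_⟩
    rw [(hform κ' hκ').2, he0, Fin.sum_univ_five]
    simp only [Matrix.cons_val]
    unfold sideY
    ring

theorem isInessential_of_isMassLinear_conormalY (ha : ∀ i, ∃ m : ℤ, a i = m)
    (hκ : κ ∈ chamberY a) (h : a 0 = 0 ∨ a 1 = 0 ∨ a 0 = a 1) {H : Fin 3 → ℝ}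
    (hH : IsMassLinear (conormalY a) κ H) :
    IsInessential latticeZ3 (conormalY a) κ H := by
  rw [isMassLinear_conormalY_iff ha hκ] at hH
  set P := H 0 - a 0 * H 2 / 2 with hP
  set Q := H 1 - a 1 * H 2 / 2 with hQ
  have h34 := (facetEquiv_three_four (κ := κ) ha).isInessential_sub
  -- A multiple of the inessential vector `η 3 - η 4` reduces to third coordinate zero. In each case
  -- of `h` the linear condition then leaves only combinations of differences of equivalent side
  -- conormals.
  have key : ∀ {G : Fin 3 → ℝ}, IsInessential latticeZ3 (conormalY a) κ G →
      G = ![P, Q, 0] → IsInessential latticeZ3 (conormalY a) κ H := by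
    intro G hG hGe
    have : H = G + (-(H 2) / 2) • (conormalY a 3 - conormalY a 4) := by
      rw [hGe]
      ext i
      fin_cases i <;> simp [conormalY, hP, hQ] <;> ring
    rw [this]
    exact hG.add (h34.smul _)
  by_cases h0 : a 0 = 0
  · have h02 := (facetEquiv_zero_two (κ := κ) ha h0).isInessential_sub
    by_cases h1 : a 1 = 0
    · have h12 := (facetEquiv_one_two (κ := κ) ha h1).isInessential_sub
      refine key ((h02.smul (-(P - (P + Q) / 3))).add (h12.smul (-(Q - (P + Q) / 3)))) ?_
      ext i
      fin_cases i <;> simp [conormalY] <;> ring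
    · have hPQ : P = 2 * Q := by
        have : a 1 * (P - 2 * Q) = 0 := by
          rw [h0] at hH
          linear_combination hH
        exact sub_eq_zero.1 ((mul_eq_zero.1 this).resolve_left h1)
      refine key (h02.smul (-Q)) ?_
      ext i
      fin_cases i <;> simp [conormalY, hPQ]
      ring
  by_cases h1 : a 1 = 0
  · have h12 := (facetEquiv_one_two (κ := κ) ha h1).isInessential_sub
    have hPQ : Q = 2 * P := by
      have : a 0 * (Q - 2 * P) = 0 := by
        rw [h1] at hH
        linear_combination hH
      exact sub_eq_zero.1 ((mul_eq_zero.1 this).resolve_left h0)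
    refine key (h12.smul (-P)) ?_
    ext i
    fin_cases i <;> simp [conormalY, hPQ]
    ring
  · have h2 := (h.resolve_left h0).resolve_left h1
    have h01 := (facetEquiv_zero_one (κ := κ) ha h2).isInessential_sub
    have hPQ : Q = -P := by
      have : a 1 * (Q + P) = 0 := by
        rw [h2] at hH
        linear_combination -hH
      exact eq_neg_of_add_eq_zero_left ((mul_eq_zero.1 this).resolve_left h1)
    refine key (h01.smul (-P)) ?_
    ext i
    fin_cases i <;> simp [conormalY, hPQ]

theorem not_facetEquiv_three (ha : ∀ i, ∃ m : ℤ, a i = m) (hκ : κ ∈ chamberY a) {i : Fin 5}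
    (hi : i = 0 ∨ i = 1 ∨ i = 2) : ¬ FacetEquiv latticeZ3 (conormalY a) κ i 3 := by
  intro h
  -- In a tall polytope with base of side `1`, the center of mass is at distance at most `1` from
  -- the sides, but at distance at least `3 / 2` from facets `3` and `4`.
  set s := |a 0| + |a 1| + 3 with hs
  have g0 := le_abs_self (a 0)
  have g1 := le_abs_self (a 1)
  have g2 := abs_nonneg (a 0)
  have g3 := abs_nonneg (a 1)
  have e1 : sideY ![0, 0, 1, 0, s] = 1 := by simp [sideY]
  have e2 : heightY a ![0, 0, 1, 0, s] = s := by simp [heightY]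
  have hmem : ![0, 0, 1, 0, s] ∈ chamberY a := by
    rw [mem_chamberY_iff, e1, e2]
    refine ⟨one_pos, ?_, ?_, ?_⟩ <;> linarith
  obtain ⟨hD, h0, h1⟩ := sub_centerOfMass_conormalY hmem
  have hi3 := h.sub_centerOfMass_conormalY ha hκ hmem
  have h34 := (facetEquiv_three_four (κ := κ) ha).sub_centerOfMass_conormalY ha hκ hmem
  obtain ⟨c0, c1, c2, c3, c4⟩ := apply_conormalY a
    (centerOfMass (polytope (conormalY a) ![0, 0, 1, 0, s]))
  set x := coordinates (centerOfMass (polytope (conormalY a) ![0, 0, 1, 0, s])) with hx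
  rw [e1, e2] at hD
  rw [c0, e1, e2, eq_div_iff (by positivity)] at h0
  rw [c1, e1, e2, eq_div_iff (by positivity)] at h1
  rw [c3, c4] at h34
  rw [c3] at hi3
  simp only [Matrix.cons_val] at h0 h1 h34 hi3
  have hbound : ∀ u : ℝ, 0 ≤ u * (4 * (3 * s - (a 0 + a 1) * 1)) →
      u * (4 * (3 * s - (a 0 + a 1) * 1)) ≤ 1 * (4 * (3 * s - (a 0 + a 1) * 1)) →
      0 ≤ u ∧ u ≤ 1 := fun u hu hu' =>
    ⟨nonneg_of_mul_nonneg_left hu (by positivity), le_of_mul_le_mul_right hu' (by positivity)⟩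
  obtain ⟨hu, hu'⟩ := hbound x.1.1 (by linarith) (by linarith)
  obtain ⟨hv, hv'⟩ := hbound x.1.2 (by linarith) (by linarith)
  have k0 : a 0 * x.1.1 ≤ |a 0| := (mul_le_mul_of_nonneg_right g0 hu).trans
    (mul_le_of_le_one_right g2 hu')
  have k1 : a 1 * x.1.2 ≤ |a 1| := (mul_le_mul_of_nonneg_right g1 hv).trans
    (mul_le_of_le_one_right g3 hv')
  rcases hi with rfl | rfl | rfl
  · rw [c0] at hi3
    simp only [Matrix.cons_val] at hi3
    linarith
  · rw [c1] at hi3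
    simp only [Matrix.cons_val] at hi3
    linarith
  · rw [c2] at hi3
    simp only [Matrix.cons_val] at hi3
    linarith

theorem not_facetEquiv_four (ha : ∀ i, ∃ m : ℤ, a i = m) (hκ : κ ∈ chamberY a) {i : Fin 5}
    (hi : i = 0 ∨ i = 1 ∨ i = 2) : ¬ FacetEquiv latticeZ3 (conormalY a) κ i 4 := fun h =>
  not_facetEquiv_three ha hκ hi (h.trans (facetEquiv_three_four ha).symm)

/-- Up to a common nonzero factor and signs, the differences of the distances from the center of
mass to the three sides are `a 0 - a 1`, `a 0` and `a 1`. -/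
theorem not_facetEquiv_triangle (ha : ∀ i, ∃ m : ℤ, a i = m) (hκ : κ ∈ chamberY a)
    (h0 : a 0 ≠ 0) (h1 : a 1 ≠ 0) (h01 : a 0 ≠ a 1) :
    ¬ FacetEquiv latticeZ3 (conormalY a) κ 0 1 ∧ ¬ FacetEquiv latticeZ3 (conormalY a) κ 0 2 ∧
      ¬ FacetEquiv latticeZ3 (conormalY a) κ 1 2 := by
  obtain ⟨hD, hu, hv⟩ := sub_centerOfMass_conormalY hκ
  have hK := (mem_chamberY_iff.1 hκ).1
  obtain ⟨c0, c1, c2, -, -⟩ := apply_conormalY a (centerOfMass (polytope (conormalY a) κ))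
  have hsum : κ 2 - centerOfMass (polytope (conormalY a) κ) (conormalY a 2) = sideY κ -
      (κ 0 - centerOfMass (polytope (conormalY a) κ) (conormalY a 0)) -
      (κ 1 - centerOfMass (polytope (conormalY a) κ) (conormalY a 1)) := by
    rw [c0, c1, c2]
    unfold sideY
    ring
  rw [eq_div_iff (by positivity)] at hu hv
  have hK2 : sideY κ * sideY κ ≠ 0 := (mul_pos hK hK).ne'
  refine ⟨fun h => ?_, fun h => ?_, fun h => ?_⟩
  · have := h.sub_centerOfMass_conormalY ha hκ hκ
    rw [this] at hu
    have : (sideY κ * sideY κ) * (a 0 - a 1) = 0 := by linear_combination hu - hv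
    exact h01 (sub_eq_zero.1 ((mul_eq_zero.1 this).resolve_left hK2))
  · have := h.sub_centerOfMass_conormalY ha hκ hκ
    rw [hsum] at this
    have : (sideY κ * sideY κ) * a 0 = 0 := by
      linear_combination -(4 * (3 * heightY a κ - (a 0 + a 1) * sideY κ)) * this + 2 * hu + hv
    exact h0 ((mul_eq_zero.1 this).resolve_left hK2)
  · have := h.sub_centerOfMass_conormalY ha hκ hκ
    rw [hsum] at this
    have : (sideY κ * sideY κ) * a 1 = 0 := by
      linear_combination -(4 * (3 * heightY a κ - (a 0 + a 1) * sideY κ)) * this + hu + 2 * hv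
    exact h1 ((mul_eq_zero.1 this).resolve_left hK2)

theorem hasEssentialMassLinear_conormalY (ha : ∀ i, ∃ m : ℤ, a i = m) (hκ : κ ∈ chamberY a)
    (h0 : a 0 ≠ 0) (h1 : a 1 ≠ 0) (h01 : a 0 ≠ a 1) :
    HasEssentialMassLinear latticeZ3 (conormalY a) κ := by
  -- A solution of the linear condition with third coordinate zero. The only classes of facets are
  -- three singletons and `{3, 4}`, so an inessential vector is a multiple of `η 3 - η 4`, whose
  -- third coordinate is not zero; the solution would have to vanish, which forces `a 0 = 0`.
  refine ⟨![a 0 - 2 * a 1, 2 * a 0 - a 1, 0], (isMassLinear_conormalY_iff ha hκ _).2 ?_, ?_⟩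
  · simp
    ring
  rintro ⟨β, hβ, hs⟩
  obtain ⟨n01, n02, n12⟩ := not_facetEquiv_triangle ha hκ h0 h1 h01
  have n03 := not_facetEquiv_three ha hκ (i := 0) (by simp)
  have n13 := not_facetEquiv_three ha hκ (i := 1) (by simp)
  have n23 := not_facetEquiv_three ha hκ (i := 2) (by simp)
  have n04 := not_facetEquiv_four ha hκ (i := 0) (by simp)
  have n14 := not_facetEquiv_four ha hκ (i := 1) (by simp)
  have n24 := not_facetEquiv_four ha hκ (i := 2) (by simp)
  have hr := fun i => FacetEquiv.refl (L := latticeZ3) (η := conormalY a) (κ := κ) i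
  have b0 := hs 0
  have b1 := hs 1
  have b2 := hs 2
  have b3 := hs 3
  rw [Finset.sum_filter, Fin.sum_univ_five, if_pos (hr 0), if_neg n01, if_neg n02, if_neg n03,
    if_neg n04] at b0
  rw [Finset.sum_filter, Fin.sum_univ_five, if_neg (fun h => n01 h.symm), if_pos (hr 1),
    if_neg n12, if_neg n13, if_neg n14] at b1
  rw [Finset.sum_filter, Fin.sum_univ_five, if_neg (fun h => n02 h.symm),
    if_neg (fun h => n12 h.symm), if_pos (hr 2), if_neg n23, if_neg n24] at b2
  rw [Finset.sum_filter, Fin.sum_univ_five, if_neg (fun h => n03 h.symm),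
    if_neg (fun h => n13 h.symm), if_neg (fun h => n23 h.symm), if_pos (hr 3),
    if_pos (facetEquiv_three_four ha)] at b3
  simp only [add_zero, zero_add] at b0 b1 b2 b3
  rw [sum_smul_conormalY, b0, b1, b2] at hβ
  have c0 := congrFun hβ 0
  have c1 := congrFun hβ 1
  have c2 := congrFun hβ 2
  simp only [Matrix.cons_val] at c0 c1 c2
  have b4 : β 4 = 0 := by linarith
  rw [b4] at c0 c1
  exact h0 (by linarith)

theorem hasEssentialMassLinear_conormalY_iff (ha : ∀ i, ∃ m : ℤ, a i = m)
    (hκ : κ ∈ chamberY a) :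
    HasEssentialMassLinear latticeZ3 (conormalY a) κ ↔ a 0 ≠ 0 ∧ a 1 ≠ 0 ∧ a 0 ≠ a 1 := by
  refine ⟨fun ⟨H, hH, hne⟩ => ?_, fun h => hasEssentialMassLinear_conormalY ha hκ h.1 h.2.1 h.2.2⟩
  by_contra hcon
  refine hne (isInessential_of_isMassLinear_conormalY ha hκ ?_ hH)
  by_contra! h
  exact hcon h

end FacetsY

end MassPolytope

theorem theorem1p2 :
    (∀ (t : Type*) [NormedAddCommGroup t] [NormedSpace ℝ t] [FiniteDimensional ℝ t]
      (L : Submodule ℤ t) [DiscreteTopology L] [IsZLattice ℝ L]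
      (N : ℕ) (η : Fin N → t) (κ : Fin N → ℝ),
      Module.finrank ℝ t = 3 →
      MassPolytope.IsSmooth L η κ →
      MassPolytope.HasEssentialMassLinear L η κ →
      ∃ a : Fin 2 → ℤ, ∃ κ' ∈ MassPolytope.chamberY (fun i => (a i : ℝ)),
        MassPolytope.AffineEquivalent L MassPolytope.latticeZ3
          (MassPolytope.polytope η κ)
          (MassPolytope.polytope (MassPolytope.conormalY fun i => (a i : ℝ)) κ')) ∧
    (∀ a : Fin 2 → ℤ, ∀ κ ∈ MassPolytope.chamberY (fun i => (a i : ℝ)),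
      (MassPolytope.HasEssentialMassLinear MassPolytope.latticeZ3
          (MassPolytope.conormalY fun i => (a i : ℝ)) κ ↔
        a 0 ≠ 0 ∧ a 1 ≠ 0 ∧ a 0 ≠ a 1)) := by
  refine ⟨?_, ?_⟩
  · intro t _ _ _ L _ _ N η κ h3 h hess
    exact h.affineEquivalent_of_hasEssentialMassLinear h3 hess
  · intro a κ hκ
    rw [MassPolytope.hasEssentialMassLinear_conormalY_iff (fun i => ⟨a i, rfl⟩) hκ]
    norm_cast
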